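/- Let $G$ be a finite pseudograph (a graph in which loops and multiple edges are allowed, and which need not be connected) with at least one node. A \emph{tube} of $G$ is a proper connected subgraph that contains at least one edge between every pair of its nodes joined by an edge of $G$. Two tubes are \emph{compatible} if one properly contains the other, or if they are disjoint and cannot be connected by a single edge of $G$. A \emph{tubing} is a set of pairwise compatible tubes that does not contain all the connected components of $G$. A loop $e$ at a node $v$ is \emph{excluded} by a tube $t$ if $v\in t$ and $e\notin t$; a tubing \emph{excludes all loops} if every loop of $G$ is excluded by at least one of its tubes. Let $H=G_m$ be the loop-free graph obtained from $G$ by replacing the loops at each node $v$ that has loops by edges between $v$ and a new ghost node $v'$; for a tube $t$ of $G$ let $\phi(t)=t_m$ be the subgraph of $H$ obtained by replacing the loops of $t$ in the same way. A \emph{bundle} of $H$ is the nonempty set of all edges between two distinct nodes. Put $c=|H|^2$, where $|\cdot|$ counts nodes and edges, and for a tube $s$ of $H$ put $$\Lambda(s)=c^{|V(s)|}+\sum_{B\,:\,B\cap E(s)\neq\emptyset}c^{|B\cap E(s)|}+|H-s|^2 ,$$ where $B$ runs over the bundles of $H$. The pseudograph associahedron $\mathcal KG$ is the polyhedron of all $x\in\mathbb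 R^{V(H)\cup E(H)}$ such that $\sum_{v\in V(H)}x_v=c^{|V(H)|}$, $\sum_{e\in B}x_e=c^{|B|}$ for every bundle $B$ of $H$, and $\sum_{y\in s}x_y\ge\Lambda(s)$ (the sum is over the nodes and edges of $s$) for every tube $s$ of $H$ that is not a single ghost node. The face of $\mathcal KG$ corresponding to a tubing $T$ of $G$ is $$F_T=\Big\{x\in\mathcal KG \;:\; \sum_{y\in \phi(t)}x_y=\Lambda(\phi(t))\ \text{ for all } t\in T\Big\}.$$ Then $T\mapsto F_T$ is an isomorphism from the set of tubings of $G$, ordered by reverse containment, onto the poset of nonempty faces of $\mathcal KG$ (including $\mathcal KG$ itself), ordered by containment; and the face $F_T$ is compact if and only if $T$ excludes all loops of $G$. In other words, the compact faces of $\mathcal KG$ are exactly those corresponding to the tubings that exclude all loops. -/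

import Mathlib

open scoped Graph

namespace Pseudograph

variable {α β : Type*}

/-! Pseudographs are Mathlib's multigraphs `Graph α β`, with loops and multiple edges allowed;
`s ≤ t` means that `s` is a subgraph of `t`. -/

/-! ### Tubes and tubings -/

/-- A graph is connected if it has a node and any two nodes are joined by a walk. -/
def Connected (H : Graph α β) : Prop :=
  V(H).Nonempty ∧ ∀ x ∈ V(H), ∀ y ∈ V(H), Relation.ReflTransGen H.Adj x y

/-- The connected components of `G` are its maximal connected subgraphs. -/
def IsComponent (G K : Graph α β) : Prop :=
  Maximal (fun H : Graph α β => H ≤ G ∧ Connected H) K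

/-- A tube of `G` is a proper connected subgraph which contains at least one edge between every
pair of its nodes that is joined by an edge of `G`. -/
structure IsTube (G t : Graph α β) : Prop where
  lt : t < G
  connected : Connected t
  adj : ∀ x ∈ V(t), ∀ y ∈ V(t), x ≠ y → G.Adj x y → t.Adj x y

/-- Two tubes are compatible if one properly contains the other, or if they are disjoint and
cannot be connected by a single edge of `G`. -/
def TubesCompatible (G s t : Graph α β) : Prop :=
  s < t ∨ t < s ∨ (Disjoint V(s) V(t) ∧ ∀ x ∈ V(s), ∀ y ∈ V(t), ¬ G.Adj x y)

/-- A tubing of `G` is a set of pairwise compatible tubes which does not contain all the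
connected components of `G`. -/
structure IsTubing (G : Graph α β) (T : Set (Graph α β)) : Prop where
  isTube : ∀ t ∈ T, IsTube G t
  compatible : T.Pairwise (TubesCompatible G)
  not_all_components : ¬ ∀ K, IsComponent G K → K ∈ T

/-- The type of tubings of `G`, partially ordered by containment. -/
abbrev Tubing (G : Graph α β) := {T : Set (Graph α β) // IsTubing G T}

/-- The edge or loop `e` of `G` is excluded by the tube `t` if `t` contains the node or nodes
incident to `e` but does not contain `e` itself. -/
def Excludes (G t : Graph α β) (e : β) : Prop :=
  e ∈ E(G) ∧ (∀ x, G.Inc e x → x ∈ V(t)) ∧ e ∉ E(t)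

/-- A tubing excludes all loops if every loop of `G` is excluded by one of its tubes. -/
def ExcludesAllLoops (G : Graph α β) (T : Set (Graph α β)) : Prop :=
  ∀ e x, G.IsLoopAt e x → ∃ t ∈ T, Excludes G t e

/-! ### The loop-free graph -/

/-- The loop-free graph associated with `G`: the loops at a node `v` become edges between `v`
(written `Sum.inl v`) and a new ghost node (written `Sum.inr v`), which is present if and only
if there is a loop at `v`. Applied to a subgraph `t` of `G`, this gives the subgraph of the
loop-free graph of `G` in which every loop of `t` is replaced by its associated edge. -/
def loopFree (G : Graph α β) : Graph (α ⊕ α) β where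
  vertexSet := Sum.inl '' V(G) ∪ Sum.inr '' {v | ∃ e, G.IsLoopAt e v}
  IsLink e a b :=
    (∃ x y, x ≠ y ∧ G.IsLink e x y ∧ a = Sum.inl x ∧ b = Sum.inl y) ∨
    (∃ x, G.IsLoopAt e x ∧
      ((a = Sum.inl x ∧ b = Sum.inr x) ∨ (a = Sum.inr x ∧ b = Sum.inl x)))
  isLink_symm := by
    refine fun e _ => ⟨fun a b h => ?_⟩
    rcases h with ⟨x, y, hne, h, ha, hb⟩ | ⟨x, h, h' | h'⟩
    · exact Or.inl ⟨y, x, hne.symm, h.symm, hb, ha⟩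
    · exact Or.inr ⟨x, h, Or.inr ⟨h'.2, h'.1⟩⟩
    · exact Or.inr ⟨x, h, Or.inl ⟨h'.2, h'.1⟩⟩
  eq_or_eq_of_isLink_of_isLink := by
    rintro e a b c d (⟨x, y, hne, h, rfl, rfl⟩ | ⟨x, h, ⟨rfl, rfl⟩ | ⟨rfl, rfl⟩⟩)
      (⟨z, w, hne', h', rfl, rfl⟩ | ⟨z, h', ⟨rfl, rfl⟩ | ⟨rfl, rfl⟩⟩)
    · rcases h.left_eq_or_eq h' with rfl | rfl <;> simp
    · exact absurd ((h'.eq_of_inc h.inc_left).symm.trans (h'.eq_of_inc h.inc_right)) hne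
    · exact absurd ((h'.eq_of_inc h.inc_left).symm.trans (h'.eq_of_inc h.inc_right)) hne
    · exact absurd ((h.eq_of_inc h'.inc_left).symm.trans (h.eq_of_inc h'.inc_right)) hne'
    · exact Or.inl (congrArg _ (h.eq_of_inc h'.inc))
    · exact Or.inr (congrArg _ (h.eq_of_inc h'.inc))
    · exact absurd ((h.eq_of_inc h'.inc_left).symm.trans (h.eq_of_inc h'.inc_right)) hne'
    · exact Or.inr (congrArg _ (h.eq_of_inc h'.inc))
    · exact Or.inl (congrArg _ (h.eq_of_inc h'.inc))
  left_mem_of_isLink := by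
    rintro e a b (⟨x, y, hne, h, rfl, rfl⟩ | ⟨x, h, ⟨rfl, rfl⟩ | ⟨rfl, rfl⟩⟩)
    · exact Or.inl ⟨x, h.left_mem, rfl⟩
    · exact Or.inl ⟨x, h.vertex_mem, rfl⟩
    · exact Or.inr ⟨x, ⟨e, h⟩, rfl⟩

/-! ### Halfspaces -/

/-- The Euclidean space with one coordinate for each node and each edge of `H`. -/
abbrev Coord (H : Graph α β) := V(H) ⊕ E(H) → ℝ

/-- The sum of the coordinates of the nodes in `W`. -/
noncomputable def nodeSum {H : Graph α β} (x : Coord H) (W : Set α) : ℝ :=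
  ∑ᶠ (v : V(H)) (_ : (v : α) ∈ W), x (Sum.inl v)

/-- The sum of the coordinates of the edges in `F`. -/
noncomputable def edgeSum {H : Graph α β} (x : Coord H) (F : Set β) : ℝ :=
  ∑ᶠ (e : E(H)) (_ : (e : β) ∈ F), x (Sum.inr e)

/-- The sum of the coordinates of the nodes and edges of the subgraph `t`. -/
noncomputable def tubeSum {H : Graph α β} (x : Coord H) (t : Graph α β) : ℝ :=
  nodeSum x V(t) + edgeSum x E(t)

/-- The bundles of `H`: the nonempty sets of all edges between two distinct nodes. For a
subgraph `t` of `H`, the bundles of `t` are the nonempty intersections of the bundles of `H`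
with the edge set of `t`. -/
def bundles (H : Graph α β) : Set (Set β) :=
  {B | ∃ x y, x ≠ y ∧ H.Adj x y ∧ B = {e | H.IsLink e x y}}

/-- The constant `c`: the square of the number of nodes and edges of `H`. -/
noncomputable def const (H : Graph α β) : ℝ :=
  ((V(H).ncard + E(H).ncard : ℕ) : ℝ) ^ 2

/-- The bound `Λ(t) = c ^ |V(t)| + ∑ i, c ^ |E(i,t)| + |H - t| ^ 2`, where `E(i,t)` runs over
the nonempty sets of edges of the bundles of `H` in `t`. -/
noncomputable def bound (H t : Graph α β) : ℝ :=
  const H ^ V(t).ncard + ∑ᶠ B ∈ bundles t, const H ^ B.ncard +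
    (((V(H) \ V(t)).ncard + (E(H) \ E(t)).ncard : ℕ) : ℝ) ^ 2

/-! ### The pseudograph associahedron -/

/-- The pseudograph associahedron of `G`, as a polyhedron in the coordinate space of the
loop-free graph of `G`: the intersection of the hyperplanes of the node set and of the bundles
with the halfspaces of all tubes of the loop-free graph, except for the halfspaces of the
singleton tubes of ghost nodes. -/
def associahedron (G : Graph α β) : Set (Coord (loopFree G)) :=
  {x | nodeSum x V(loopFree G) = const (loopFree G) ^ V(loopFree G).ncard ∧
    (∀ B ∈ bundles (loopFree G), edgeSum x B = const (loopFree G) ^ B.ncard) ∧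
    ∀ s, IsTube (loopFree G) s → (∀ v, V(s) ≠ {Sum.inr v}) → bound (loopFree G) s ≤ tubeSum x s}

/-- The type of faces of a polyhedron `P`: the nonempty subsets on which some linear functional
is maximal over `P` (with `P` itself included), partially ordered by containment. -/
abbrev Face {ι : Type*} (P : Set (ι → ℝ)) := {F : Set (ι → ℝ) // F.Nonempty ∧ IsExposed ℝ P F}

/-- The set of points of the pseudograph associahedron that lie on the bounding hyperplanes of
all the tubes of the tubing `T`. -/
def faceOf (G : Graph α β) (T : Set (Graph α β)) : Set (Coord (loopFree G)) :=
  {x | x ∈ associahedron G ∧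
    ∀ t ∈ T, tubeSum x (loopFree t) = bound (loopFree G) (loopFree t)}

end Pseudograph

/-! Write `H` for `loopFree G`. A face of a polyhedron is determined by the constraints that are
tight at a generic point of it, so the face poset is the poset of tight sets, reversed. Passing from
`G` to `H` identifies the tubes of `G` with the tubes of `H` other than single ghosts, and it
preserves tubings. The isomorphism thus amounts to this: the tight sets at points of the polyhedron
are exactly the tubings of `H` by such tubes.

Tight sets are tubings (`isTubing_tight`) because the bound is strongly supermodular. Let `s` and
`t` be tight but incompatible. Up to a gain of the right sign, the two equalities add up to the
inequalities for the union and the intersection. If neither node set contains the other, `c ^ |V(s)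
∪ V(t)|` exceeds everything else. If the node sets are nested, then either some bundle is split
crosswise and yields a gain of `2 * c`, more than the two squared coranks, or the strict convexity
of the squared corank decides. If all components were tight, the total node sum would be too small.

Every tubing is a tight set (`exists_tight_eq_tubing`). The polyhedron contains `center`. Tubes are
made tight one at a time: minimise the tube sum of `t` over the current face; if `t` is not tight at
the minimum, `exists_mem_lineal_tubeSum_neg` gives a feasible direction that lowers it further, a
contradiction. Superfluous tight tubes are relaxed afterwards, since the tube sums of a tubing are
independent on the direction space (`exists_mem_lineal_tubeSum_eq`).

For compactness, look at recession directions. If a loop at `v` is not excluded, one can add to `v`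
and subtract from its ghost forever without leaving the face. If all loops are excluded, a recession
direction vanishes on edges and on each node-ghost sum, and then on every node by means of a tube
that contains the node but none of its loops. -/

namespace Pseudograph

/-! ### Faces and tight sets of abstract polyhedra. -/

section Polyhedron

open Filter Topology

variable {E σ : Type*} [AddCommGroup E] [Module ℝ E]

/-- The points of the affine set `A` which satisfy the inequalities `b s ≤ a s x` for `s ∈ S`. -/
def polyhedron (A : Set E) (S : Set σ) (a : σ → E →ₗ[ℝ] ℝ) (b : σ → ℝ) : Set E :=
  {x | x ∈ A ∧ ∀ s ∈ S, b s ≤ a s x}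

/-- The indices of the inequalities which are equalities at `x`. -/
def tight (S : Set σ) (a : σ → E →ₗ[ℝ] ℝ) (b : σ → ℝ) (x : E) : Set σ :=
  {s | s ∈ S ∧ a s x = b s}

/-- `A` is a translate of `L`, or empty. -/
def IsTranslate (A : Set E) (L : Submodule ℝ E) : Prop :=
  ∀ x ∈ A, ∀ y, y ∈ A ↔ y - x ∈ L

variable {A : Set E} {L : Submodule ℝ E} {S : Set σ} {a : σ → E →ₗ[ℝ] ℝ} {b : σ → ℝ}

theorem IsTranslate.add_smul_mem (hA : IsTranslate A L) {x d : E} (hx : x ∈ A) (hd : d ∈ L)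
    (r : ℝ) : x + r • d ∈ A := by
  rw [hA x hx]
  simpa using L.smul_mem r hd

/-- For a short step, the finitely many slack constraints stay slack by continuity, and a tight one
either stays tight (derivative zero) or becomes slack (derivative positive). -/
theorem exists_move (hA : IsTranslate A L) (hS : S.Finite) {x d : E}
    (hx : x ∈ polyhedron A S a b) (hd : d ∈ L)
    (h : ∀ s ∈ tight S a b x, 0 ≤ a s d) :
    ∃ ε : ℝ, 0 < ε ∧ x + ε • d ∈ polyhedron A S a b ∧
      tight S a b (x + ε • d) = {s ∈ tight S a b x | a s d = 0} := by
  have key : ∀ s ∈ S, ∀ᶠ ε in 𝓝[>] (0 : ℝ), b s ≤ a s (x + ε • d) ∧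
      (a s (x + ε • d) = b s ↔ a s x = b s ∧ a s d = 0) := by
    intro s hs
    rcases (hx.2 s hs).eq_or_lt with heq | hlt
    · have h0 : 0 ≤ a s d := h s ⟨hs, heq.symm⟩
      filter_upwards [self_mem_nhdsWithin] with ε hε
      have hε : 0 < ε := hε
      simp only [map_add, map_smul, smul_eq_mul]
      refine ⟨by nlinarith, fun h1 => ⟨heq.symm, ?_⟩, fun h1 => by rw [h1.1, h1.2]; simp⟩
      have : ε * a s d = 0 := by linarith
      exact (mul_eq_zero.1 this).resolve_left hε.ne'
    · have hc : Tendsto (fun ε : ℝ => a s x + ε * a s d) (𝓝[>] 0) (𝓝 (a s x)) := by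
        have : Continuous (fun ε : ℝ => a s x + ε * a s d) := by fun_prop
        simpa using (this.tendsto 0).mono_left nhdsWithin_le_nhds
      filter_upwards [hc.eventually (lt_mem_nhds hlt)] with ε hε
      simp only [map_add, map_smul, smul_eq_mul]
      exact ⟨hε.le, fun h1 => absurd h1 hε.ne', fun h1 => absurd h1.1 hlt.ne'⟩
  obtain ⟨ε, hε, h0⟩ := ((hS.eventually_all.2 key).and
    (self_mem_nhdsWithin : Set.Ioi (0 : ℝ) ∈ 𝓝[>] 0)).exists
  refine ⟨ε, h0, ⟨hA.add_smul_mem hx.1 hd ε, fun s hs => (hε s hs).1⟩, ?_⟩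
  ext s
  constructor
  · rintro ⟨hs, h1⟩
    exact ⟨⟨hs, ((hε s hs).2.1 h1).1⟩, ((hε s hs).2.1 h1).2⟩
  · rintro ⟨⟨hs, h1⟩, h2⟩
    exact ⟨hs, (hε s hs).2.2 ⟨h1, h2⟩⟩

/-- The ray from `x` along `d` must leave the polyhedron, since it decreases the constraint `t`.
Stop where the first new constraint becomes tight; the old ones stay tight because `d` lies in their
kernels. -/
theorem exists_hit (hA : IsTranslate A L) (hS : S.Finite) {x d : E}
    (hx : x ∈ polyhedron A S a b) (hd : d ∈ L)
    (h : ∀ s ∈ tight S a b x, a s d = 0) {t : σ} (ht : t ∈ S) (htd : a t d < 0) :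
    ∃ y ∈ polyhedron A S a b, tight S a b x ⊂ tight S a b y ∧ a t y ≤ a t x := by
  -- Ratio test: `s` is the decreasing constraint that is reached after the shortest step.
  obtain ⟨s, ⟨hs, hsd⟩, hmin⟩ := Set.exists_min_image {s ∈ S | a s d < 0}
    (fun s => (b s - a s x) / a s d) (hS.subset (Set.sep_subset _ _)) ⟨t, ht, htd⟩
  set r := (b s - a s x) / a s d with hr
  have hr0 : 0 ≤ r := div_nonneg_of_nonpos (by linarith [hx.2 s hs]) hsd.le
  have hy : ∀ u, a u (x + r • d) = a u x + r * a u d := fun u => by simp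
  have hts : a s (x + r • d) = b s := by
    rw [hy, hr, div_mul_cancel₀ _ hsd.ne]; ring
  refine ⟨x + r • d, ⟨hA.add_smul_mem hx.1 hd r, fun u hu => ?_⟩, ⟨fun u hu => ?_, fun hsub => ?_⟩,
    ?_⟩
  · rw [hy]
    rcases lt_or_ge (a u d) 0 with hneg | hpos
    · have := hmin u ⟨hu, hneg⟩
      rw [le_div_iff_of_neg hneg] at this
      linarith
    · nlinarith [hx.2 u hu]
  · exact ⟨hu.1, by rw [hy, h u hu, hu.2]; ring⟩
  · exact hsd.ne (h s (hsub ⟨hs, hts⟩))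
  · rw [hy]; nlinarith

/-- A linear functional that is one of the constraints attains its minimum on a face, in the form
that no feasible direction at some point of the face decreases it. -/
theorem exists_min (hA : IsTranslate A L) (hS : S.Finite) {t : σ} (ht : t ∈ S) {T : Set σ}
    (hT : ∃ x ∈ polyhedron A S a b, T ⊆ tight S a b x) :
    ∃ y ∈ polyhedron A S a b, T ⊆ tight S a b y ∧
      ∀ d ∈ L, (∀ s ∈ T, a s d = 0) → (∀ s ∈ tight S a b y, 0 ≤ a s d) → 0 ≤ a t d := by
  have htf : ∀ x, (tight S a b x).Finite := fun x => hS.subset fun s hs => hs.1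
  -- Points at which `a t` is constant along the smallest face through the point. As the face may be
  -- unbounded, minimisation goes through these points instead of compactness.
  let term : Set E := {y | y ∈ polyhedron A S a b ∧ T ⊆ tight S a b y ∧
    ∀ d ∈ L, (∀ s ∈ tight S a b y, a s d = 0) → a t d = 0}
  -- Any point descends to such a point without raising `a t`: each use of `exists_hit` enlarges the
  -- tight set.
  have hterm : ∀ (k : ℕ) (x : E), S.ncard - (tight S a b x).ncard ≤ k → x ∈ polyhedron A S a b →
      T ⊆ tight S a b x → ∃ y ∈ term, a t y ≤ a t x := by
    intro k
    induction k with
    | zero =>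
      intro x hk hx hTx
      refine ⟨x, ⟨hx, hTx, fun d _ h => h t ?_⟩, le_rfl⟩
      have : tight S a b x = S := Set.eq_of_subset_of_ncard_le (fun s hs => hs.1) (by omega) hS
      rw [this]; exact ht
    | succ k ih =>
      intro x hk hx hTx
      by_cases hc : x ∈ term
      · exact ⟨x, hc, le_rfl⟩
      have : ∃ d ∈ L, (∀ s ∈ tight S a b x, a s d = 0) ∧ a t d < 0 := by
        by_contra! hcon
        refine hc ⟨hx, hTx, fun d hd h => le_antisymm ?_ (hcon d hd h)⟩
        have := hcon (-d) (L.neg_mem hd) (fun s hs => by simp [h s hs])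
        simpa using this
      obtain ⟨d, hd, h0, hneg⟩ := this
      obtain ⟨y, hy, hss, hle⟩ := exists_hit hA hS hx hd h0 ht hneg
      have hlt := Set.ncard_lt_ncard hss (htf y)
      have hle' : (tight S a b y).ncard ≤ S.ncard := Set.ncard_le_ncard (fun s hs => hs.1) hS
      obtain ⟨z, hz, hz'⟩ := ih y (by omega) hy (hTx.trans hss.subset)
      exact ⟨z, hz, hz'.trans hle⟩
  -- Two such points with the same tight set have the same value, and there are only finitely many
  -- tight sets.
  have hfin : (a t '' term).Finite := by
    have hinj : Set.InjOn (fun v : ℝ => {U : Set σ | ∃ y ∈ term, tight S a b y = U ∧ a t y = v})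
        (a t '' term) := by
      rintro _ ⟨y, hy, rfl⟩ _ ⟨z, hz, rfl⟩ heq
      have : tight S a b y ∈ {U : Set σ | ∃ w ∈ term, tight S a b w = U ∧ a t w = a t z} := by
        beta_reduce at heq
        rw [← heq]; exact ⟨y, hy, rfl, rfl⟩
      obtain ⟨w, hw, hwy, hwz⟩ := this
      rw [← hwz]
      have := hy.2.2 (y - w) ((hA w hw.1.1 y).1 hy.1.1) fun s hs => by
        have hsw : s ∈ tight S a b w := hwy ▸ hs
        rw [map_sub, hs.2, hsw.2, sub_self]
      rw [map_sub] at this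
      linarith
    refine Set.Finite.of_finite_image (f := fun v : ℝ =>
      {U : Set σ | ∃ y ∈ term, tight S a b y = U ∧ a t y = v}) ?_ hinj
    refine (hS.finite_subsets.finite_subsets).subset ?_
    rintro _ ⟨v, _, rfl⟩ U ⟨y, _, rfl, _⟩
    exact fun s hs => hs.1
  obtain ⟨x, hx, hTx⟩ := hT
  obtain ⟨y₀, hy₀, -⟩ := hterm _ x le_rfl hx hTx
  obtain ⟨_, ⟨y, hy, rfl⟩, hmin⟩ := Set.exists_min_image _ id hfin ⟨_, y₀, hy₀, rfl⟩
  refine ⟨y, hy.1, hy.2.1, fun d hd h0 hpos => ?_⟩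
  by_contra! hneg
  -- A short step along a decreasing direction, followed by a descent, would beat the minimal value.
  obtain ⟨ε, hε, hmem, htd⟩ := exists_move hA hS hy.1 hd hpos
  obtain ⟨z, hz, hzle⟩ := hterm _ _ le_rfl hmem (fun s hs => by
    rw [htd]; exact ⟨hy.2.1 hs, h0 s hs⟩)
  have h1 := hmin _ ⟨z, hz, rfl⟩
  simp only [id, map_add, map_smul, smul_eq_mul] at h1 hzle
  nlinarith

/-- If the sets in `𝒯` are closed under subsets and contain all tight sets, and there are enough
directions to relax constraints and to make new constraints tight, then every set in `𝒯` is the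
set of tight constraints of some point. -/
theorem exists_tight_eq (hA : IsTranslate A L) (hS : S.Finite) {𝒯 : Set (Set σ)}
    (hsub : ∀ T ∈ 𝒯, T ⊆ S) (hdown : ∀ T ∈ 𝒯, ∀ T' ⊆ T, T' ∈ 𝒯)
    (hne : (polyhedron A S a b).Nonempty)
    (htight : ∀ x ∈ polyhedron A S a b, tight S a b x ∈ 𝒯)
    (hsurj : ∀ T ∈ 𝒯, ∀ g : σ → ℝ, ∃ d ∈ L, ∀ s ∈ T, a s d = g s)
    (hdir : ∀ T' ∈ 𝒯, ∀ T ⊆ T', ∀ t ∉ T', insert t T ∈ 𝒯 →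
      ∃ d ∈ L, (∀ s ∈ T, a s d = 0) ∧ (∀ s ∈ T', 0 ≤ a s d) ∧ a t d < 0)
    {T : Set σ} (hT : T ∈ 𝒯) : ∃ x ∈ polyhedron A S a b, tight S a b x = T := by
  classical
  have hex : ∃ x ∈ polyhedron A S a b, T ⊆ tight S a b x := by
    have hfin : T.Finite := hS.subset (hsub T hT)
    induction T, hfin using Set.Finite.induction_on with
    | empty => exact ⟨hne.some, hne.some_mem, Set.empty_subset _⟩
    | @insert t T _ _ ih =>
      -- Minimise `a t` over the face of `T`. Were `t` slack at the minimum, `hdir` for the tight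
      -- set there would contradict minimality.
      obtain ⟨y, hy, hTy, hmin⟩ := exists_min hA hS (hsub _ hT (Set.mem_insert t T))
        (ih (hdown _ hT _ (Set.subset_insert t T)))
      refine ⟨y, hy, Set.insert_subset ?_ hTy⟩
      by_contra hty
      obtain ⟨d, hd, h0, hpos, hneg⟩ := hdir _ (htight y hy) T hTy t hty hT
      exact absurd (hmin d hd h0 hpos) hneg.not_ge
  obtain ⟨x, hx, hTx⟩ := hex
  -- This direction keeps the constraints in `T` tight and relaxes every other tight one.
  obtain ⟨d, hd, hg⟩ := hsurj _ (htight x hx) fun s => if s ∈ T then 0 else 1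
  obtain ⟨ε, -, hmem, hti⟩ := exists_move hA hS hx hd fun s hs => by
    rw [hg s hs]; split_ifs <;> simp
  refine ⟨_, hmem, ?_⟩
  rw [hti]
  ext s
  constructor
  · rintro ⟨hs, h0⟩
    rw [hg s hs] at h0
    by_contra hsT
    simp [hsT] at h0
  · intro hs
    exact ⟨hTx hs, by rw [hg s (hTx hs), if_pos hs]⟩

/-- A nonempty set of maximizers of a linear functional on a polyhedron is the set of points at
which the constraints that are tight at one of its points are tight. -/
theorem exists_eq_of_maximizers (hA : IsTranslate A L) (hS : S.Finite) (l : E →ₗ[ℝ] ℝ)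
    {F : Set E} (hF : F.Nonempty)
    (hl : F = {x ∈ polyhedron A S a b | ∀ y ∈ polyhedron A S a b, l y ≤ l x}) :
    ∃ x ∈ polyhedron A S a b,
      F = {z ∈ polyhedron A S a b | tight S a b x ⊆ tight S a b z} := by
  have htf : ∀ x, (tight S a b x).Finite := fun x => hS.subset fun s hs => hs.1
  -- A point with the fewest tight constraints is generic in `F`: the midpoint with any other `z` in
  -- `F` has only common tight constraints, so those of `x` are tight at `z`.
  obtain ⟨x, hxF, hmin⟩ : ∃ x ∈ F, ∀ y ∈ F, (tight S a b x).ncard ≤ (tight S a b y).ncard := by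
    have := exists_minimalFor_of_wellFoundedLT (fun x => x ∈ F)
      (fun x => (tight S a b x).ncard) hF
    obtain ⟨x, hx⟩ := this
    exact ⟨x, hx.1, fun y hy => by
      by_contra! hlt
      exact absurd (hx.2 hy hlt.le) (not_le.2 hlt)⟩
  have hmax : ∀ z, z ∈ F ↔ z ∈ polyhedron A S a b ∧ ∀ y ∈ polyhedron A S a b, l y ≤ l z :=
    fun z => by rw [hl]; rfl
  have hx := (hmax x).1 hxF
  refine ⟨x, hx.1, ?_⟩
  ext z
  constructor
  · intro hz
    have hz' := (hmax z).1 hz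
    refine ⟨hz'.1, ?_⟩
    set m : E := x + (1 / 2 : ℝ) • (z - x) with hm
    have hmv : ∀ s, a s m = (a s x + a s z) / 2 := fun s => by
      rw [hm, map_add, map_smul, map_sub, smul_eq_mul]; ring
    have hmP : m ∈ polyhedron A S a b :=
      ⟨hA.add_smul_mem hx.1.1 ((hA x hx.1.1 z).1 hz'.1.1) _, fun s hs => by
        rw [hmv]; linarith [hx.1.2 s hs, hz'.1.2 s hs]⟩
    have hmF : m ∈ F := (hmax m).2 ⟨hmP, fun y hy => by
      rw [hm, map_add, map_smul, map_sub, smul_eq_mul]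
      linarith [hx.2 y hy, hz'.2 y hy, hx.2 z hz'.1]⟩
    have hsub : tight S a b m ⊆ tight S a b x ∩ tight S a b z := by
      rintro s ⟨hs, h⟩
      rw [hmv] at h
      have h1 := hx.1.2 s hs
      have h2 := hz'.1.2 s hs
      exact ⟨⟨hs, by linarith⟩, ⟨hs, by linarith⟩⟩
    have heq : tight S a b m = tight S a b x :=
      Set.eq_of_subset_of_ncard_le (hsub.trans Set.inter_subset_left) (hmin m hmF) (htf x)
    rw [← heq]
    exact hsub.trans Set.inter_subset_right
  · rintro ⟨hz, hsub⟩
    -- Since `z` shares all tight constraints of `x`, the segment from `z` to `x` can be prolonged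
    -- beyond `x`. As `x` is a maximizer, `l` does not increase there, so `l z` is maximal too.
    obtain ⟨ε, hε, hmem, -⟩ := exists_move hA hS hx.1 ((hA z hz.1 x).1 hx.1.1) fun s hs => by
      rw [map_sub, hs.2, (hsub hs).2, sub_self]
    have := hx.2 _ hmem
    rw [map_add, map_smul, map_sub, smul_eq_mul] at this
    have hlz : l x ≤ l z := by
      by_contra! hlt
      nlinarith
    exact (hmax z).2 ⟨hz, fun y hy => (hx.2 y hy).trans hlz⟩

end Polyhedron

/-! ### Node, edge and tube sums as linear functionals. -/

section Sums

variable {γ β : Type*} {H : Graph γ β}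

open Classical in
theorem nodeSum_eq_sum [Fintype V(H)] (x : Coord H) (W : Set γ) :
    nodeSum x W = ∑ v : V(H), if (v : γ) ∈ W then x (Sum.inl v) else 0 := by
  rw [nodeSum, finsum_eq_sum_of_fintype]
  exact Finset.sum_congr rfl fun v _ => finsum_eq_if

open Classical in
theorem edgeSum_eq_sum [Fintype E(H)] (x : Coord H) (F : Set β) :
    edgeSum x F = ∑ e : E(H), if (e : β) ∈ F then x (Sum.inr e) else 0 := by
  rw [edgeSum, finsum_eq_sum_of_fintype]
  exact Finset.sum_congr rfl fun v _ => finsum_eq_if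

/-- `nodeSum` as a linear functional. -/
noncomputable def nodeSumL (H : Graph γ β) [Finite V(H)] (W : Set γ) : Coord H →ₗ[ℝ] ℝ where
  toFun x := nodeSum x W
  map_add' x y := by
    classical
    have := Fintype.ofFinite V(H)
    simp only [nodeSum_eq_sum, ← Finset.sum_add_distrib]
    exact Finset.sum_congr rfl fun v _ => by split_ifs <;> simp
  map_smul' r x := by
    classical
    have := Fintype.ofFinite V(H)
    simp only [nodeSum_eq_sum, RingHom.id_apply, smul_eq_mul, Finset.mul_sum]
    exact Finset.sum_congr rfl fun v _ => by split_ifs <;> simp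

/-- `edgeSum` as a linear functional. -/
noncomputable def edgeSumL (H : Graph γ β) [Finite E(H)] (F : Set β) : Coord H →ₗ[ℝ] ℝ where
  toFun x := edgeSum x F
  map_add' x y := by
    classical
    have := Fintype.ofFinite E(H)
    simp only [edgeSum_eq_sum, ← Finset.sum_add_distrib]
    exact Finset.sum_congr rfl fun v _ => by split_ifs <;> simp
  map_smul' r x := by
    classical
    have := Fintype.ofFinite E(H)
    simp only [edgeSum_eq_sum, RingHom.id_apply, smul_eq_mul, Finset.mul_sum]
    exact Finset.sum_congr rfl fun v _ => by split_ifs <;> simp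

variable [Finite V(H)] [Finite E(H)]

/-- `tubeSum` as a linear functional. -/
noncomputable def tubeSumL (H : Graph γ β) [Finite V(H)] [Finite E(H)] (t : Graph γ β) :
    Coord H →ₗ[ℝ] ℝ := nodeSumL H V(t) + edgeSumL H E(t)

omit [Finite E(H)] in
@[simp] theorem nodeSumL_apply (W : Set γ) (x : Coord H) : nodeSumL H W x = nodeSum x W := rfl
omit [Finite V(H)] in
@[simp] theorem edgeSumL_apply (F : Set β) (x : Coord H) : edgeSumL H F x = edgeSum x F := rfl
@[simp] theorem tubeSumL_apply (t : Graph γ β) (x : Coord H) :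
    tubeSumL H t x = tubeSum x t := rfl

/-- The vector with a single nonzero coordinate, equal to one, at a node. -/
noncomputable def nodeVec (v : V(H)) : Coord H := by
  classical exact Pi.single (Sum.inl v) 1

/-- The vector with a single nonzero coordinate, equal to one, at an edge. -/
noncomputable def edgeVec (e : E(H)) : Coord H := by
  classical exact Pi.single (Sum.inr e) 1

omit [Finite E(H)] in
theorem nodeSum_nodeVec (v : V(H)) (W : Set γ) :
    nodeSum (nodeVec v) W = W.indicator 1 (v : γ) := by
  classical
  have := Fintype.ofFinite V(H)
  rw [nodeSum_eq_sum, Finset.sum_eq_single v]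
  · simp [nodeVec, Set.indicator_apply]
  · intro w _ hw
    simp [nodeVec, hw]
  · simp

omit [Finite V(H)] [Finite E(H)] in
theorem nodeSum_edgeVec (e : E(H)) (W : Set γ) : nodeSum (edgeVec e) W = 0 := by
  simp [nodeSum, edgeVec]

omit [Finite V(H)] [Finite E(H)] in
theorem edgeSum_nodeVec (v : V(H)) (F : Set β) : edgeSum (nodeVec v) F = 0 := by
  simp [edgeSum, nodeVec]

omit [Finite V(H)] in
theorem edgeSum_edgeVec (e : E(H)) (F : Set β) :
    edgeSum (edgeVec e) F = F.indicator 1 (e : β) := by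
  classical
  have := Fintype.ofFinite E(H)
  rw [edgeSum_eq_sum, Finset.sum_eq_single e]
  · simp [edgeVec, Set.indicator_apply]
  · intro w _ hw
    simp [edgeVec, hw]
  · simp

end Sums

/-! ### Connected subgraphs, components and compatible families. -/

section Connectivity

variable {γ β : Type*} {H s t p K : Graph γ β}

theorem Connected.exists_adj (ht : Connected t) {W : Set γ} {a b : γ} (ha : a ∈ V(t))
    (haW : a ∈ W) (hb : b ∈ V(t)) (hbW : b ∉ W) :
    ∃ x ∈ W, ∃ y ∉ W, t.Adj x y := by
  by_contra! hcon
  have : ∀ c, Relation.ReflTransGen t.Adj a c → c ∈ W := by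
    intro c hc
    induction hc with
    | refl => exact haW
    | tail _ h ih =>
      by_contra hn
      exact hcon _ ih _ hn h
  exact hbW (this b (ht.2 a ha b hb))

theorem le_iff_of_le_le (hs : s ≤ H) (ht : t ≤ H) : s ≤ t ↔ V(s) ⊆ V(t) ∧ E(s) ⊆ E(t) :=
  (Graph.Compatible.of_le_le hs ht).le_iff

theorem finite_subgraphs (H : Graph γ β) [Finite V(H)] [Finite E(H)] :
    {s : Graph γ β | s ≤ H}.Finite := by
  have hV : V(H).Finite := Set.toFinite _
  have hE : E(H).Finite := Set.toFinite _
  refine Set.Finite.of_finite_image (f := fun s => (V(s), E(s))) ?_ ?_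
  · refine (hV.finite_subsets.prod hE.finite_subsets).subset ?_
    rintro _ ⟨s, hs, rfl⟩
    exact ⟨hs.vertexSet_mono, hs.edgeSet_mono⟩
  · intro s hs t ht h
    simp only [Prod.mk.injEq] at h
    exact (Graph.Compatible.of_le_le hs ht).ext h.1 h.2

theorem reach_mem {a b : γ} (ha : a ∈ V(H)) (h : Relation.ReflTransGen H.Adj a b) :
    b ∈ V(H) := by
  induction h with
  | refl => exact ha
  | tail _ h _ => exact h.right_mem

theorem reach_symm {a b : γ} (h : Relation.ReflTransGen H.Adj a b) :
    Relation.ReflTransGen H.Adj b a := by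
  induction h with
  | refl => exact .refl
  | tail _ h ih => exact .head h.symm ih

/-- The subgraph of all nodes which can be reached from the node `a`. -/
def componentOf (H : Graph γ β) (a : γ) : Graph γ β :=
  H.induce {b | Relation.ReflTransGen H.Adj a b}

theorem componentOf_le {a : γ} (ha : a ∈ V(H)) : componentOf H a ≤ H :=
  Graph.induce_le fun _ hb => reach_mem ha hb

theorem connected_componentOf (H : Graph γ β) (a : γ) : Connected (componentOf H a) := by
  have hstart : ∀ b, Relation.ReflTransGen H.Adj a b →
      Relation.ReflTransGen (componentOf H a).Adj a b := by
    intro b hb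
    induction hb with
    | refl => exact .refl
    | tail h1 h2 ih =>
      obtain ⟨e, he⟩ := h2
      exact ih.tail ⟨e, he, h1, h1.tail ⟨e, he⟩⟩
  refine ⟨⟨a, .refl⟩, fun x hx y hy => ?_⟩
  exact (reach_symm (hstart x hx)).trans (hstart y hy)

theorem Connected.le_componentOf (hs : Connected s) (hsH : s ≤ H) {a : γ} (ha : a ∈ V(s)) :
    s ≤ componentOf H a := by
  have hV : ∀ b ∈ V(s), b ∈ V(componentOf H a) := fun b hb =>
    Relation.ReflTransGen.mono (fun _ _ h => Graph.Adj.mono hsH h) _ _ (hs.2 a ha b hb)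
  exact ⟨hV, fun e x y h => ⟨h.mono hsH, hV _ h.left_mem, hV _ h.right_mem⟩⟩

theorem isComponent_componentOf {a : γ} (ha : a ∈ V(H)) : IsComponent H (componentOf H a) :=
  ⟨⟨componentOf_le ha, connected_componentOf H a⟩, fun _ hs hle =>
    hs.2.le_componentOf hs.1 (hle.vertexSet_mono .refl)⟩

theorem IsComponent.le (hK : IsComponent H K) : K ≤ H := hK.1.1

theorem IsComponent.connected (hK : IsComponent H K) : Connected K := hK.1.2

theorem IsComponent.eq_componentOf (hK : IsComponent H K) {a : γ} (ha : a ∈ V(K)) :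
    K = componentOf H a :=
  le_antisymm (hK.connected.le_componentOf hK.le ha)
    (hK.2 ⟨componentOf_le (hK.le.vertexSet_mono ha), connected_componentOf H a⟩
      (hK.connected.le_componentOf hK.le ha))

theorem Connected.exists_isComponent (hs : Connected s) (hsH : s ≤ H) :
    ∃ K, IsComponent H K ∧ s ≤ K := by
  obtain ⟨a, ha⟩ := hs.1
  exact ⟨_, isComponent_componentOf (hsH.vertexSet_mono ha), hs.le_componentOf hsH ha⟩

theorem IsComponent.mem_of_adj (hK : IsComponent H K) {x y : γ} (hx : x ∈ V(K))
    (h : H.Adj x y) : y ∈ V(K) := by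
  rw [hK.eq_componentOf hx]
  exact .single h

theorem IsComponent.edge_mem (hK : IsComponent H K) {x y : γ} {e : β} (hx : x ∈ V(K))
    (h : H.IsLink e x y) : e ∈ E(K) := by
  rw [hK.eq_componentOf hx]
  exact Graph.IsLink.edge_mem (x := x) (y := y) ⟨h, .refl, .single ⟨e, h⟩⟩

theorem IsComponent.eq_of_mem {K' : Graph γ β} (hK : IsComponent H K) (hK' : IsComponent H K')
    {x : γ} (hx : x ∈ V(K)) (hx' : x ∈ V(K')) : K = K' := by
  rw [hK.eq_componentOf hx, hK'.eq_componentOf hx']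

theorem le_or_le_of_pairwise {T : Set (Graph γ β)} (hT : T.Pairwise (TubesCompatible H))
    (hs : s ∈ T) (ht : t ∈ T) {x : γ} (hxs : x ∈ V(s)) (hxt : x ∈ V(t)) : s ≤ t ∨ t ≤ s := by
  by_cases hst : s = t
  · exact Or.inl hst.le
  rcases hT hs ht hst with h | h | h
  · exact Or.inl h.le
  · exact Or.inr h.le
  · exact absurd hxt (Set.disjoint_left.1 h.1 hxs)

theorem le_or_le_of_adj {T : Set (Graph γ β)} (hT : T.Pairwise (TubesCompatible H))
    (hs : s ∈ T) (ht : t ∈ T) {x y : γ} (hxs : x ∈ V(s)) (hyt : y ∈ V(t)) (hxy : H.Adj x y) :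
    s ≤ t ∨ t ≤ s := by
  by_cases hst : s = t
  · exact Or.inl hst.le
  rcases hT hs ht hst with h | h | h
  · exact Or.inl h.le
  · exact Or.inr h.le
  · exact absurd hxy (h.2 x hxs y hyt)

/-- The set of nodes and edges of a graph. -/
def elems (t : Graph γ β) : Set (γ ⊕ β) := {y | Sum.elim (· ∈ V(t)) (· ∈ E(t)) y}

theorem elems_mono (h : s ≤ t) : elems s ⊆ elems t := by
  rintro (v | e) hy
  · exact h.vertexSet_mono hy
  · exact h.edgeSet_mono hy

/-- A connected subgraph which lies in none of the pairwise compatible subgraphs in `T` has a node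
or edge which lies in none of them. -/
theorem exists_mem_elems [Finite V(H)] [Finite E(H)] {T : Set (Graph γ β)}
    (hT : T.Pairwise (TubesCompatible H)) (hTH : ∀ s ∈ T, s ≤ H) (hp : Connected p)
    (hpH : p ≤ H) (hpT : ∀ s ∈ T, ¬ p ≤ s) : ∃ y ∈ elems p, ∀ s ∈ T, y ∉ elems s := by
  by_contra! hcon
  obtain ⟨a, ha⟩ := hp.1
  have hfin : {s ∈ T | (V(s) ∩ V(p)).Nonempty}.Finite :=
    (finite_subgraphs H).subset fun s hs => hTH s hs.1
  obtain ⟨s₀, hs₀, has₀⟩ := hcon (Sum.inl a) ha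
  -- If `T` covered `p`, a maximal member `r` meeting `p` would contain `p`: a member covering a
  -- node next to `r`, or an edge at a node of `r`, is comparable with `r`, hence contained in it.
  obtain ⟨r, hr⟩ := hfin.exists_maximal ⟨s₀, hs₀, a, has₀, ha⟩
  obtain ⟨hrT, b, hbr, hbp⟩ := hr.1
  have hV : V(p) ⊆ V(r) := by
    intro c hc
    by_contra hcr
    obtain ⟨x, hx, y, hy, hxy⟩ := hp.exists_adj hbp hbr hc hcr
    obtain ⟨s, hs, hys⟩ := hcon (Sum.inl y) hxy.right_mem
    rcases le_or_le_of_adj hT hrT hs hx hys (hxy.mono hpH) with h | h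
    · exact hy ((hr.2 ⟨hs, y, hys, hxy.right_mem⟩ h).vertexSet_mono hys)
    · exact hy (h.vertexSet_mono hys)
  refine hpT r hrT ((le_iff_of_le_le hpH (hTH r hrT)).2 ⟨hV, fun e he => ?_⟩)
  obtain ⟨s, hs, hes⟩ := hcon (Sum.inr e) he
  obtain ⟨x, y, hxy⟩ := p.exists_isLink_of_mem_edgeSet he
  have hxs : x ∈ V(s) :=
    (((hTH s hs).isLink_iff hes).2 (hxy.mono hpH)).left_mem
  rcases le_or_le_of_pairwise hT hrT hs (hV hxy.left_mem) hxs with h | h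
  · exact (hr.2 ⟨hs, x, hxs, hxy.left_mem⟩ h).edgeSet_mono hes
  · exact h.edgeSet_mono hes

end Connectivity

/-! ### Directions that control the tube sums of a tubing. -/

section Directions

variable {γ β : Type*} {H s t p K : Graph γ β} [Finite V(H)] [Finite E(H)]

omit [Finite V(H)] [Finite E(H)] in
theorem mem_of_isLink_of_edge_mem (hs : s ≤ H) {e : β} {a b : γ} (he : H.IsLink e a b)
    (hes : e ∈ E(s)) : a ∈ V(s) ∧ b ∈ V(s) :=
  ⟨((hs.isLink_iff hes).2 he).left_mem, ((hs.isLink_iff hes).2 he).right_mem⟩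

theorem indicator_one_congr {ι κ : Type*} {A : Set ι} {B : Set κ} {y : ι} {z : κ}
    (h : y ∈ A ↔ z ∈ B) : (A.indicator 1 y : ℝ) = B.indicator 1 z := by
  by_cases hy : y ∈ A
  · simp [hy, h.1 hy]
  · simp [hy, mt h.2 hy]

theorem indicator_one_nonneg {ι : Type*} (A : Set ι) (y : ι) :
    (0 : ℝ) ≤ A.indicator 1 y := Set.indicator_nonneg (fun _ _ => zero_le_one) _

/-- The directions of the affine space spanned by the associahedron. -/
noncomputable def lineal (H : Graph γ β) [Finite V(H)] [Finite E(H)] : Submodule ℝ (Coord H) where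
  carrier := {d | nodeSum d V(H) = 0 ∧ ∀ B ∈ bundles H, edgeSum d B = 0}
  zero_mem' := ⟨map_zero (nodeSumL H V(H)), fun B _ => map_zero (edgeSumL H B)⟩
  add_mem' := fun {x y} hx hy => ⟨(map_add (nodeSumL H V(H)) x y).trans (by
    simp [hx.1, hy.1]), fun B hB => (map_add (edgeSumL H B) x y).trans (by
    simp [hx.2 B hB, hy.2 B hB])⟩
  smul_mem' := fun r x hx => ⟨(map_smul (nodeSumL H V(H)) r x).trans (by simp [hx.1]),
    fun B hB => (map_smul (edgeSumL H B) r x).trans (by simp [hx.2 B hB])⟩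

theorem mem_lineal {d : Coord H} :
    d ∈ lineal H ↔ nodeSum d V(H) = 0 ∧ ∀ B ∈ bundles H, edgeSum d B = 0 := Iff.rfl

/-- A vector with node sum one and bundle sums zero whose value at each subgraph in `T` tells
whether the subgraph contains `y`. -/
structure IsProbe (H : Graph γ β) (T : Set (Graph γ β)) (y : γ ⊕ β) (u : Coord H) : Prop where
  node : nodeSum u V(H) = 1
  bundle : ∀ B ∈ bundles H, edgeSum u B = 0
  tube : ∀ s ∈ T, tubeSum u s = (elems s).indicator 1 y

theorem IsProbe.sub_mem {T T' : Set (Graph γ β)} {y y' : γ ⊕ β} {u u' : Coord H}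
    (h : IsProbe H T y u) (h' : IsProbe H T' y' u') : u - u' ∈ lineal H := by
  refine ⟨(map_sub (nodeSumL H V(H)) u u').trans (by simp [h.node, h'.node]), fun B hB =>
    (map_sub (edgeSumL H B) u u').trans (by simp [h.bundle B hB, h'.bundle B hB])⟩

theorem tubeSum_sub (x y : Coord H) (s : Graph γ β) :
    tubeSum (x - y) s = tubeSum x s - tubeSum y s := map_sub (tubeSumL H s) x y

theorem tubeSum_add (x y : Coord H) (s : Graph γ β) :
    tubeSum (x + y) s = tubeSum x s + tubeSum y s := map_add (tubeSumL H s) x y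

theorem tubeSum_smul (r : ℝ) (x : Coord H) (s : Graph γ β) :
    tubeSum (r • x) s = r * tubeSum x s := map_smul (tubeSumL H s) r x

omit [Finite E(H)] in
theorem tubeSum_nodeVec (v : V(H)) (s : Graph γ β) :
    tubeSum (nodeVec v) s = V(s).indicator 1 (v : γ) := by
  rw [tubeSum, nodeSum_nodeVec, edgeSum_nodeVec, add_zero]

omit [Finite V(H)] in
theorem tubeSum_edgeVec (e : E(H)) (s : Graph γ β) :
    tubeSum (edgeVec e) s = E(s).indicator 1 (e : β) := by
  rw [tubeSum, nodeSum_edgeVec, edgeSum_edgeVec, zero_add]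

omit [Finite E(H)] in
theorem isProbe_nodeVec (T : Set (Graph γ β)) (v : V(H)) :
    IsProbe H T (Sum.inl (v : γ)) (nodeVec v) where
  node := by rw [nodeSum_nodeVec, Set.indicator_of_mem v.2]; rfl
  bundle B _ := edgeSum_nodeVec v B
  tube s _ := by rw [tubeSum_nodeVec]; exact indicator_one_congr Iff.rfl

theorem edgeVec_sub_mem {a b : γ} {e g : E(H)} (he : H.IsLink e a b) (hg : H.IsLink g a b) :
    edgeVec e - edgeVec g ∈ lineal H := by
  refine ⟨(map_sub (nodeSumL H V(H)) _ _).trans (by simp [nodeSum_edgeVec]), fun B hB =>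
    (map_sub (edgeSumL H B) _ _).trans ?_⟩
  obtain ⟨x, y, -, -, rfl⟩ := hB
  rw [edgeSumL_apply, edgeSumL_apply, edgeSum_edgeVec, edgeSum_edgeVec, sub_eq_zero]
  exact indicator_one_congr (by simp [he.isLink_iff, hg.isLink_iff])

/-- Tubes of `T` containing both ends form a chain, and `g` is an edge of the smallest one. If
neither end could serve as `v`, there would be a tube with `a` but not `b` and a tube with `b` but
not `a`; these are joined by `e` and not nested, hence incompatible. -/
theorem exists_pivot [H.Loopless] {T : Set (Graph γ β)} (hT : T.Pairwise (TubesCompatible H))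
    (hTt : ∀ s ∈ T, IsTube H s) {e : β} {a b : γ} (he : H.IsLink e a b) :
    ∃ g v, H.IsLink g a b ∧ (v = a ∨ v = b) ∧
      (∀ s ∈ T, a ∈ V(s) → b ∈ V(s) → g ∈ E(s)) ∧ ∀ s ∈ T, v ∈ V(s) → a ∈ V(s) ∧ b ∈ V(s) := by
  have hg : ∃ g, H.IsLink g a b ∧ ∀ s ∈ T, a ∈ V(s) → b ∈ V(s) → g ∈ E(s) := by
    by_cases hne : {s ∈ T | a ∈ V(s) ∧ b ∈ V(s)}.Nonempty
    · have hfin : {s ∈ T | a ∈ V(s) ∧ b ∈ V(s)}.Finite :=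
        (finite_subgraphs H).subset fun s hs => (hTt s hs.1).lt.le
      obtain ⟨r, hr⟩ := hfin.exists_minimal hne
      obtain ⟨hrT, har, hbr⟩ := hr.1
      obtain ⟨g, hg⟩ := (hTt r hrT).adj a har b hbr he.ne he.adj
      refine ⟨g, hg.mono (hTt r hrT).lt.le, fun s hs has hbs => ?_⟩
      rcases le_or_le_of_pairwise hT hrT hs har has with h | h
      · exact h.edgeSet_mono hg.edge_mem
      · exact (hr.2 ⟨hs, has, hbs⟩ h).edgeSet_mono hg.edge_mem
    · exact ⟨e, he, fun s hs has hbs => absurd ⟨s, hs, has, hbs⟩ hne⟩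
  have hv : ∃ v, (v = a ∨ v = b) ∧ ∀ s ∈ T, v ∈ V(s) → a ∈ V(s) ∧ b ∈ V(s) := by
    by_contra! hcon
    obtain ⟨s, hs, has, h1⟩ := hcon a (Or.inl rfl)
    obtain ⟨r, hr, hbr, h2⟩ := hcon b (Or.inr rfl)
    rcases le_or_le_of_adj hT hs hr has hbr he.adj with h | h
    · exact h2 (h.vertexSet_mono has) hbr
    · exact h1 has (h.vertexSet_mono hbr)
  obtain ⟨g, hg⟩ := hg
  obtain ⟨v, hv⟩ := hv
  exact ⟨g, v, hg.1, hv.1, hg.2, hv.2⟩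

/-- The unit vector of an edge has nonzero bundle sum. Subtracting the parallel edge `g` repairs
this and adding the node `v` gives node sum one. A tube of `T` contains `g` exactly when it contains
`v`, so the two corrections cancel in its tube sum. -/
theorem isProbe_edge {T : Set (Graph γ β)} (hTH : ∀ s ∈ T, s ≤ H)
    {e g : E(H)} {v : V(H)} {a b : γ} (he : H.IsLink e a b) (hg : H.IsLink g a b)
    (hv : (v : γ) = a ∨ (v : γ) = b)
    (hgT : ∀ s ∈ T, a ∈ V(s) → b ∈ V(s) → (g : β) ∈ E(s))
    (hvT : ∀ s ∈ T, (v : γ) ∈ V(s) → a ∈ V(s) ∧ b ∈ V(s)) :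
    IsProbe H T (Sum.inr (e : β)) (edgeVec e - edgeVec g + nodeVec v) := by
  have h0 := edgeVec_sub_mem he hg
  refine ⟨(map_add (nodeSumL H V(H)) _ _).trans ?_, fun B hB =>
    (map_add (edgeSumL H B) _ _).trans ?_, fun s hs => ?_⟩
  · rw [nodeSumL_apply, h0.1, nodeSumL_apply, nodeSum_nodeVec, Set.indicator_of_mem v.2]
    simp
  · rw [edgeSumL_apply, h0.2 B hB, edgeSumL_apply, edgeSum_nodeVec, add_zero]
  · rw [tubeSum_add, tubeSum_sub, tubeSum_edgeVec, tubeSum_edgeVec, tubeSum_nodeVec]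
    have : (g : β) ∈ E(s) ↔ (v : γ) ∈ V(s) := by
      constructor
      · intro h
        have := mem_of_isLink_of_edge_mem (hTH s hs) hg h
        rcases hv with hv | hv <;> rw [hv]
        exacts [this.1, this.2]
      · intro h
        exact hgT s hs (hvT s hs h).1 (hvT s hs h).2
    rw [indicator_one_congr this, sub_add_cancel]
    exact indicator_one_congr Iff.rfl

theorem exists_isProbe [H.Loopless] {T : Set (Graph γ β)}
    (hT : T.Pairwise (TubesCompatible H)) (hTt : ∀ s ∈ T, IsTube H s) {y : γ ⊕ β}
    (hy : y ∈ elems H) : ∃ u, IsProbe H T y u := by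
  rcases y with v | e
  · exact ⟨_, isProbe_nodeVec T ⟨v, hy⟩⟩
  · obtain ⟨a, b, he⟩ := H.exists_isLink_of_mem_edgeSet hy
    obtain ⟨g, v, hg, hv, h1, h2⟩ := exists_pivot hT hTt he
    have hvH : v ∈ V(H) := by
      rcases hv with rfl | rfl
      exacts [he.left_mem, he.right_mem]
    exact ⟨_, isProbe_edge (e := ⟨e, hy⟩) (g := ⟨g, hg.edge_mem⟩) (v := ⟨v, hvH⟩)
      (fun s hs => (hTt s hs).lt.le) he hg hv h1 h2⟩

/-- The tube sums of the tubes in a tubing take arbitrary values on `lineal H`. -/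
theorem exists_mem_lineal_tubeSum_eq [H.Loopless] {T : Set (Graph γ β)} (hT : IsTubing H T)
    (g : Graph γ β → ℝ) : ∃ d ∈ lineal H, ∀ s ∈ T, tubeSum d s = g s := by
  have hTH : ∀ s ∈ T, s ≤ H := fun s hs => (hT.isTube s hs).lt.le
  have hfin : T.Finite := (finite_subgraphs H).subset hTH
  obtain ⟨K, hK, hKT⟩ : ∃ K, IsComponent H K ∧ K ∉ T := by
    have := hT.not_all_components; push Not at this; exact this
  -- A missing component supplies an element outside all tubes of `T`. Its probe corrects the node
  -- sum without touching any tube sum.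
  obtain ⟨y₀, hy₀, hy₀T⟩ := exists_mem_elems hT.compatible hTH hK.connected hK.le
    fun s hs hle => hKT (by
      rwa [← le_antisymm (hK.2 ⟨hTH s hs, (hT.isTube s hs).connected⟩ hle) hle])
  obtain ⟨u₀, hu₀⟩ := exists_isProbe hT.compatible hT.isTube (elems_mono hK.le hy₀)
  -- Triangularity: an element of `s` lying only in tubes that contain `s` gives a direction that
  -- affects `s` and larger tubes alone.
  have hzeta : ∀ s ∈ T, ∃ d ∈ lineal H, tubeSum d s = 1 ∧
      ∀ r ∈ T, ¬ s ≤ r → tubeSum d r = 0 := by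
    intro s hs
    obtain ⟨y, hy, hyT⟩ := exists_mem_elems (T := {r ∈ T | ¬ s ≤ r})
      (hT.compatible.mono (Set.sep_subset _ _)) (fun r hr => hTH r hr.1)
      (hT.isTube s hs).connected (hTH s hs) fun r hr => hr.2
    obtain ⟨u, hu⟩ := exists_isProbe hT.compatible hT.isTube (elems_mono (hTH s hs) hy)
    refine ⟨u - u₀, hu.sub_mem hu₀, ?_, fun r hr hsr => ?_⟩
    · rw [tubeSum_sub, hu.tube s hs, hu₀.tube s hs, Set.indicator_of_mem hy,
        Set.indicator_of_notMem (hy₀T s hs)]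
      simp
    · rw [tubeSum_sub, hu.tube r hr, hu₀.tube r hr, Set.indicator_of_notMem (hyT r ⟨hr, hsr⟩),
        Set.indicator_of_notMem (hy₀T r hr), sub_zero]
  have main : ∀ (k : ℕ) (U : Set (Graph γ β)), U ⊆ T → U.ncard = k →
      ∃ d ∈ lineal H, ∀ s ∈ U, tubeSum d s = g s := by
    intro k
    induction k with
    | zero =>
      intro U hU hk
      rw [Set.ncard_eq_zero (hfin.subset hU)] at hk
      exact ⟨0, zero_mem _, by simp [hk]⟩
    | succ k ih =>
      intro U hU hk
      have hUf := hfin.subset hU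
      -- Correcting the value at a maximal tube of `U` leaves the values at the other tubes of `U`
      -- unchanged.
      obtain ⟨s, hs⟩ := hUf.exists_maximal (Set.nonempty_of_ncard_ne_zero (by omega))
      obtain ⟨d', hd', hd'U⟩ := ih (U \ {s}) (Set.sdiff_subset.trans hU) (by
        rw [Set.ncard_sdiff_singleton_of_mem hs.1]; omega)
      obtain ⟨z, hz, hzs, hzT⟩ := hzeta s (hU hs.1)
      refine ⟨d' + (g s - tubeSum d' s) • z,
        add_mem hd' (Submodule.smul_mem _ _ hz), fun r hr => ?_⟩
      rw [tubeSum_add, tubeSum_smul]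
      by_cases hrs : r = s
      · subst hrs; rw [hzs]; ring
      · rw [hzT r (hU hr) fun hle => hrs (le_antisymm (hs.2 hr hle) hle), hd'U r ⟨hr, hrs⟩]
        ring
  exact main _ T subset_rfl rfl

/-- If the tubing `T'` contains `T` but not `t`, and `T` can be extended by `t`, then some
direction decreases the tube sum of `t` without changing the tube sums of `T` and without
decreasing those of `T'`. -/
theorem exists_mem_lineal_tubeSum_neg [H.Loopless] {T T' : Set (Graph γ β)} (hT' : IsTubing H T')
    (hTT' : T ⊆ T') (ht : t ∉ T') (hTt : IsTubing H (insert t T)) :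
    ∃ d ∈ lineal H, (∀ s ∈ T, tubeSum d s = 0) ∧ (∀ s ∈ T', 0 ≤ tubeSum d s) ∧
      tubeSum d t < 0 := by
  have hTH : ∀ s ∈ T', s ≤ H := fun s hs => (hT'.isTube s hs).lt.le
  have htt := hTt.isTube t (Set.mem_insert t T)
  have hcomp : ∀ s ∈ T, TubesCompatible H s t := fun s hs =>
    hTt.compatible (Set.mem_insert_of_mem t hs) (Set.mem_insert t T)
      (fun h => ht (h ▸ hTT' hs))
  -- a subgraph in `T` which meets `t` contains `t` or is contained in it
  have hcross : ∀ s ∈ T, ∀ y ∈ elems s, ∀ y' ∈ elems t, y ∉ elems t →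
      (∃ a ∈ V(s), ∃ b ∈ V(t), a = b ∨ H.Adj a b) → y' ∈ elems s := by
    rintro s hs y hys y' hyt hyn ⟨a, ha, b, hb, hab⟩
    rcases hcomp s hs with h | h | h
    · exact absurd (elems_mono h.le hys) hyn
    · exact elems_mono h.le hyt
    · rcases hab with rfl | hab
      · exact absurd hb (Set.disjoint_left.1 h.1 ha)
      · exact absurd hab (h.2 a ha b hb)
  by_contra hno
  -- A probe for `T'` need not detect membership in `t`, as `t` may be incompatible with `T'`. It
  -- does so when `y` is not an edge with exactly one end in `t`.
  have hprobe : ∀ y ∈ elems H, (∀ e a b, y = Sum.inr e → H.IsLink e a b →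
      (a ∈ V(t) ↔ b ∈ V(t))) →
      ∃ u, IsProbe H T' y u ∧ tubeSum u t = (elems t).indicator 1 y := by
    rintro (v | e) hy hends
    · exact ⟨_, isProbe_nodeVec T' ⟨v, hy⟩, (isProbe_nodeVec {t} ⟨v, hy⟩).tube t rfl⟩
    obtain ⟨a, b, he⟩ := H.exists_isLink_of_mem_edgeSet hy
    have hab := hends e a b rfl he
    obtain ⟨g, v, hg, hv, h1, h2⟩ := exists_pivot hT'.compatible hT'.isTube he
    have hvH : v ∈ V(H) := by
      rcases hv with rfl | rfl
      exacts [he.left_mem, he.right_mem]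
    refine ⟨_, isProbe_edge (e := ⟨e, hy⟩) (g := ⟨g, hg.edge_mem⟩) (v := ⟨v, hvH⟩)
      hTH he hg hv h1 h2, ?_⟩
    refine (isProbe_edge (T := {t}) (e := ⟨e, hy⟩) (g := ⟨g, hg.edge_mem⟩) (v := ⟨v, hvH⟩)
      (by rintro s rfl; exact htt.lt.le) he hg hv ?_ ?_).tube t rfl
    -- If the pivot `g` is not in `t`, then `t` contains a parallel edge `f`, and the difference of
    -- the unit vectors of `g` and `f` is already the desired direction.
    · rintro s rfl has hbs
      by_contra hgt
      obtain ⟨f, hf⟩ := htt.adj a has b hbs he.ne he.adj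
      have hfH := hf.mono htt.lt.le
      refine hno ⟨_, edgeVec_sub_mem (e := ⟨g, hg.edge_mem⟩) (g := ⟨f, hfH.edge_mem⟩) hg hfH,
        fun r hr => ?_, fun r hr => ?_, ?_⟩
      · rw [tubeSum_sub, tubeSum_edgeVec, tubeSum_edgeVec]
        have hrH := hTH r (hTT' hr)
        have : g ∈ E(r) ↔ f ∈ E(r) := by
          constructor
          · intro h
            exact hcross r hr (Sum.inr g) h (Sum.inr f) hf.edge_mem hgt
              ⟨a, (mem_of_isLink_of_edge_mem hrH hg h).1, a, has, Or.inl rfl⟩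
          · intro h
            have := mem_of_isLink_of_edge_mem hrH hfH h
            exact h1 r (hTT' hr) this.1 this.2
        exact sub_eq_zero.2 (indicator_one_congr this)
      · rw [tubeSum_sub, tubeSum_edgeVec, tubeSum_edgeVec]
        by_cases h : f ∈ E(r)
        · have := mem_of_isLink_of_edge_mem (hTH r hr) hfH h
          simp [h, h1 r hr this.1 this.2]
        · simp only [Set.indicator_of_notMem h, sub_zero]
          exact indicator_one_nonneg _ _
      · rw [tubeSum_sub, tubeSum_edgeVec, tubeSum_edgeVec]
        simp [hgt, hf.edge_mem]
    · rintro s rfl hvs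
      rcases hv with rfl | rfl
      exacts [⟨hvs, hab.1 hvs⟩, ⟨hab.2 hvs, hvs⟩]
  -- It suffices to find `y` outside `t` and `y'` inside such that tubes of `T` containing `y`
  -- contain `y'`, and tubes of `T'` containing `y'` contain `y`. Moving weight from `y'` to `y`
  -- then lowers the sum of `t` only.
  have finish : ∀ y ∈ elems H, ∀ y' ∈ elems t, y ∉ elems t →
      (∀ e a b, y = Sum.inr e → H.IsLink e a b → (a ∈ V(t) ↔ b ∈ V(t))) →
      (∀ s ∈ T, y ∈ elems s → y' ∈ elems s) → (∀ s ∈ T', y' ∈ elems s → y ∈ elems s) →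
      False := by
    intro y hy y' hy' hyt hends h1 h2
    obtain ⟨u, hu, hut⟩ := hprobe y hy hends
    obtain ⟨u', hu', hut'⟩ := hprobe y' (elems_mono htt.lt.le hy') (by
      rintro e a b rfl he
      have := mem_of_isLink_of_edge_mem htt.lt.le he hy'
      simp [this])
    refine hno ⟨u - u', hu.sub_mem hu', fun s hs => ?_, fun s hs => ?_, ?_⟩
    · have : y ∈ elems s ↔ y' ∈ elems s := ⟨h1 s hs, h2 s (hTT' hs)⟩
      rw [tubeSum_sub, hu.tube s (hTT' hs), hu'.tube s (hTT' hs)]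
      exact sub_eq_zero.2 (indicator_one_congr this)
    · rw [tubeSum_sub, hu.tube s hs, hu'.tube s hs]
      by_cases h : y' ∈ elems s
      · simp [h, h2 s hs h]
      · simp only [Set.indicator_of_notMem h, sub_zero]
        exact indicator_one_nonneg _ _
    · rw [tubeSum_sub, hut, hut', Set.indicator_of_mem hy', Set.indicator_of_notMem hyt]
      simp
  obtain ⟨K, hK, htK⟩ := htt.connected.exists_isComponent htt.lt.le
  by_cases hKt : t = K
  · subst hKt
    -- When `t` is a component, weight moves from an element of `t` in no tube of `T'` to an element
    -- of another component `K'` not in `T`, chosen to lie in no tube of `T'` except possibly `K'`.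
    obtain ⟨K', hK', hK'T⟩ : ∃ K', IsComponent H K' ∧ K' ∉ insert t T := by
      have := hTt.not_all_components; push Not at this; exact this
    obtain ⟨y', hy', hy'T⟩ := exists_mem_elems hT'.compatible hTH htt.connected htt.lt.le
      fun s hs hle => ht (by
        rwa [← le_antisymm (hK.2 ⟨hTH s hs, (hT'.isTube s hs).connected⟩ hle) hle])
    obtain ⟨y, hy, hyT⟩ := exists_mem_elems (T := {r ∈ T' | ¬ K' ≤ r})
      (hT'.compatible.mono (Set.sep_subset _ _)) (fun r hr => hTH r hr.1)
      hK'.connected hK'.le fun r hr => hr.2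
    have hdisj : ∀ x ∈ V(K'), x ∉ V(t) := fun x hx hxt =>
      hK'T (by rw [hK.eq_of_mem hK' hxt hx]; exact Set.mem_insert _ _)
    refine finish y (elems_mono hK'.le hy) y' hy' ?_ ?_ ?_ ?_
    · rcases y with v | e
      · exact hdisj v hy
      · intro het
        obtain ⟨a, b, he⟩ := K'.exists_isLink_of_mem_edgeSet hy
        exact hdisj a he.left_mem
          (mem_of_isLink_of_edge_mem htt.lt.le (he.mono hK'.le) het).1
    · rintro e a b rfl he
      have := mem_of_isLink_of_edge_mem hK'.le he hy
      simp [hdisj a this.1, hdisj b this.2]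
    · intro s hs hys
      exfalso
      have hle : K' ≤ s := by
        by_contra hle
        exact hyT s ⟨hTT' hs, hle⟩ hys
      have : K' = s := le_antisymm hle
        (hK'.2 ⟨hTH s (hTT' hs), (hT'.isTube s (hTT' hs)).connected⟩ hle)
      exact hK'T (Set.mem_insert_of_mem _ (this ▸ hs))
    · intro s hs h
      exact absurd h (hy'T s hs)
  -- Here `p` is the smallest tube of `T'` around `t`, or the component when there is none. Weight
  -- moves within `p`: from an element of `t` lying only in tubes that contain `p`, to an edge of
  -- `p` outside `t` or a node of `p` adjacent to `t`.
  · obtain ⟨p, hpc, hpH, htp, hne, hleast⟩ : ∃ p, Connected p ∧ p ≤ H ∧ t ≤ p ∧ t ≠ p ∧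
        ∀ s ∈ T', t ≤ s → p ≤ s := by
      by_cases hne : {s ∈ T' | t ≤ s}.Nonempty
      · obtain ⟨p, hp⟩ := ((finite_subgraphs H).subset fun s hs => hTH s hs.1 :
          {s ∈ T' | t ≤ s}.Finite).exists_minimal hne
        obtain ⟨hpT, htp⟩ := hp.1
        refine ⟨p, (hT'.isTube p hpT).connected, hTH p hpT, htp, fun h => ht (h ▸ hpT),
          fun s hs hts => ?_⟩
        obtain ⟨a, ha⟩ := htt.connected.1
        rcases le_or_le_of_pairwise hT'.compatible hpT hs (htp.vertexSet_mono ha)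
          (hts.vertexSet_mono ha) with h | h
        · exact h
        · exact hp.2 ⟨hs, hts⟩ h
      · exact ⟨K, hK.connected, hK.le, htK, hKt, fun s hs hts => absurd ⟨s, hs, hts⟩ hne⟩
    obtain ⟨y', hy', hy'T⟩ := exists_mem_elems (T := {r ∈ T' | ¬ p ≤ r})
      (hT'.compatible.mono (Set.sep_subset _ _)) (fun r hr => hTH r hr.1)
      htt.connected htt.lt.le fun r hr hle => hr.2 (hleast r hr.1 hle)
    have hpy : ∀ y ∈ elems p, ∀ s ∈ T', y' ∈ elems s → y ∈ elems s := by
      intro y hy s hs hs'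
      by_cases hle : p ≤ s
      · exact elems_mono hle hy
      · exact absurd hs' (hy'T s ⟨hs, hle⟩)
    by_cases hV : V(p) ⊆ V(t)
    · have : ¬ E(p) ⊆ E(t) := fun hE => hne
        (le_antisymm htp ((le_iff_of_le_le hpH htt.lt.le).2 ⟨hV, hE⟩))
      obtain ⟨e, hep, het⟩ := Set.not_subset.1 this
      obtain ⟨a, b, he⟩ := p.exists_isLink_of_mem_edgeSet hep
      have heH := he.mono hpH
      refine finish (Sum.inr e) (hpH.edgeSet_mono hep) y' hy' het ?_ ?_ (hpy _ hep)
      · rintro e' c d h he'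
        obtain rfl := Sum.inr_injective h
        have := mem_of_isLink_of_edge_mem hpH he' hep
        simp [hV this.1, hV this.2]
      · intro s hs hes
        exact hcross s hs _ hes y' hy' het ⟨a, (mem_of_isLink_of_edge_mem
          (hTH s (hTT' hs)) heH hes).1, a, hV he.left_mem, Or.inl rfl⟩
    · obtain ⟨c, hcp, hct⟩ := Set.not_subset.1 hV
      obtain ⟨a, ha⟩ := htt.connected.1
      obtain ⟨w, hw, v, hv, hwv⟩ := hpc.exists_adj (htp.vertexSet_mono ha) ha hcp hct
      refine finish (Sum.inl v) (hpH.vertexSet_mono hwv.right_mem) y' hy' hv (by simp) ?_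
        (hpy _ hwv.right_mem)
      intro s hs hvs
      exact hcross s hs _ hvs y' hy' hv ⟨v, hvs, w, hw, Or.inr (hwv.mono hpH).symm⟩

end Directions

/-! ### Inequalities between powers of `c`. -/

section Numeric

/-- The power `c ^ k`, with value zero for `k = 0`. -/
noncomputable def pospow (c : ℝ) (k : ℕ) : ℝ := if k = 0 then 0 else c ^ k

/-- The difference of the power terms is `c ^ i * (c ^ p - 1) * (c ^ r - 1)`, less one when `i = 0`
because `pospow` vanishes there. Since `4 ≤ c`, `(c - 1) ^ 2` is at least `2 * c + 1`, which also
pays for that loss. -/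
theorem pospow_add_le {c : ℝ} (hc : 4 ≤ c) (i : ℕ) {p r : ℕ} (hp : 1 ≤ p) (hr : 1 ≤ r) :
    pospow c (i + p) + pospow c (i + r) + 2 * c ≤ pospow c (i + p + r) + pospow c i := by
  have hP : c ≤ c ^ p := le_self_pow₀ (by linarith) (by omega)
  have hR : c ≤ c ^ r := le_self_pow₀ (by linarith) (by omega)
  have h1 : (c - 1) * (c - 1) ≤ (c ^ p - 1) * (c ^ r - 1) :=
    mul_le_mul (by linarith) (by linarith) (by linarith) (by linarith)
  have h2 : 2 * c + 1 ≤ (c - 1) * (c - 1) := by nlinarith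
  unfold pospow
  rw [if_neg (by omega), if_neg (by omega), if_neg (by omega)]
  rcases Nat.eq_zero_or_pos i with rfl | hi
  · simp only [Nat.zero_add, if_true, pow_add]
    nlinarith
  · rw [if_neg (by omega)]
    have hI : 1 ≤ c ^ i := one_le_pow₀ (by linarith)
    simp only [pow_add]
    have h3 : (c ^ p - 1) * (c ^ r - 1) ≤ c ^ i * ((c ^ p - 1) * (c ^ r - 1)) :=
      le_mul_of_one_le_left (by linarith) hI
    nlinarith

theorem pospow_union_add_inter {β : Type*} {c : ℝ} (hc : 4 ≤ c) {X Y : Set β} (hX : X.Finite)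
    (hY : Y.Finite) : pospow c X.ncard + pospow c Y.ncard ≤
      pospow c (X ∪ Y).ncard + pospow c (X ∩ Y).ncard ∧
    (¬ X ⊆ Y → ¬ Y ⊆ X → pospow c X.ncard + pospow c Y.ncard + 2 * c ≤
      pospow c (X ∪ Y).ncard + pospow c (X ∩ Y).ncard) := by
  by_cases hXY : X ⊆ Y
  · refine ⟨?_, fun h => absurd hXY h⟩
    rw [Set.union_eq_self_of_subset_left hXY, Set.inter_eq_self_of_subset_left hXY]
    linarith
  by_cases hYX : Y ⊆ X
  · refine ⟨?_, fun _ h => absurd hYX h⟩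
    rw [Set.union_eq_self_of_subset_right hYX, Set.inter_eq_self_of_subset_right hYX]
  have h1 := Set.ncard_union_add_ncard_inter X Y hX hY
  have h2 : (X ∩ Y).ncard < X.ncard := Set.ncard_lt_ncard
    ⟨Set.inter_subset_left, fun h => hXY fun z hz => (h hz).2⟩ hX
  have h3 : (X ∩ Y).ncard < Y.ncard := Set.ncard_lt_ncard
    ⟨Set.inter_subset_right, fun h => hYX fun z hz => (h hz).1⟩ hY
  have key := pospow_add_le hc (X ∩ Y).ncard (p := X.ncard - (X ∩ Y).ncard)
    (r := Y.ncard - (X ∩ Y).ncard) (by omega) (by omega)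
  rw [show (X ∩ Y).ncard + (X.ncard - (X ∩ Y).ncard) + (Y.ncard - (X ∩ Y).ncard) =
      (X ∪ Y).ncard by omega, show (X ∩ Y).ncard + (X.ncard - (X ∩ Y).ncard) = X.ncard by omega,
    show (X ∩ Y).ncard + (Y.ncard - (X ∩ Y).ncard) = Y.ncard by omega] at key
  exact ⟨by linarith, fun _ _ => key⟩

/-- The left side is below `4 * c ^ (m - 1)`. The summand `2 * (c - 1)` makes room for two squared
coranks. -/
theorem pow_add_pow_lt {c : ℝ} (hc : 4 ≤ c) {a b m : ℕ} (ha : 1 ≤ a) (ham : a < m) (hbm : b < m) :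
    c ^ a + c ^ b + 2 * (c - 1) < c ^ m := by
  obtain ⟨k, rfl⟩ : ∃ k, m = k + 1 := ⟨m - 1, by omega⟩
  have h1 : c ^ a ≤ c ^ k := pow_le_pow_right₀ (by linarith) (by omega)
  have h2 : c ^ b ≤ c ^ k := pow_le_pow_right₀ (by linarith) (by omega)
  have h3 : c ≤ c ^ k := le_self_pow₀ (by linarith) (by omega)
  rw [pow_succ]
  nlinarith

/-- With `c = n ^ 2` and `b ≤ n`, an equal share `c ^ b / b` is at least `2 * c ^ (b - 1)`. So `k <
b` equal shares exceed `c ^ k` by the largest possible squared corank. -/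
theorem pow_add_le_mul_div {n k b : ℕ} (hk : 1 ≤ k) (hkb : k < b) (hbn : b ≤ n) :
    ((n : ℝ) ^ 2) ^ k + ((n : ℝ) ^ 2 - 1) ≤ k * (((n : ℝ) ^ 2) ^ b / b) := by
  obtain ⟨m, rfl⟩ : ∃ m, b = m + 1 := ⟨b - 1, by omega⟩
  have hn : (2 : ℝ) ≤ n := by exact_mod_cast (by omega : 2 ≤ n)
  set c : ℝ := (n : ℝ) ^ 2
  have hc : 4 ≤ c := by nlinarith
  have h1 : c ^ k ≤ c ^ m := pow_le_pow_right₀ (by linarith) (by omega)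
  have h3 : c ≤ c ^ m := le_self_pow₀ (by linarith) (by omega)
  have hb : (0 : ℝ) < ((m + 1 : ℕ) : ℝ) := by positivity
  have hbn' : ((m + 1 : ℕ) : ℝ) ≤ n := by exact_mod_cast hbn
  have h4 : 2 * c ^ m ≤ c ^ (m + 1) / ((m + 1 : ℕ) : ℝ) := by
    rw [le_div_iff₀ hb, pow_succ]
    have : 2 * ((m + 1 : ℕ) : ℝ) ≤ c := by nlinarith
    nlinarith
  have hk' : (1 : ℝ) ≤ k := by exact_mod_cast hk
  nlinarith

theorem pospow_le_mul_div {n k b : ℕ} (hkb : k ≤ b) (hbn : b ≤ n) :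
    pospow ((n : ℝ) ^ 2) k ≤ k * (((n : ℝ) ^ 2) ^ b / b) := by
  unfold pospow
  split_ifs with hk
  · simp [hk]
  rcases hkb.eq_or_lt with rfl | hlt
  · have : (k : ℝ) ≠ 0 := by exact_mod_cast hk
    field_simp
    exact le_rfl
  · have := pow_add_le_mul_div (Nat.one_le_iff_ne_zero.2 hk) hlt hbn
    have hn : (1 : ℝ) ≤ n := by exact_mod_cast (by omega : 1 ≤ n)
    nlinarith

end Numeric

/-! ### Bundles and the excess of a pair of node and edge sets. -/

section Gamma

variable {γ β : Type*} {H s t : Graph γ β}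

theorem bundles_finite (H : Graph γ β) [Finite E(H)] : (bundles H).Finite := by
  refine (Set.toFinite E(H)).finite_subsets.subset ?_
  rintro _ ⟨x, y, -, -, rfl⟩
  exact fun e he => Graph.IsLink.edge_mem he

/-- The bundles of `H` as a finset. -/
noncomputable def bundleFinset (H : Graph γ β) [Finite E(H)] : Finset (Set β) :=
  (bundles_finite H).toFinset

@[simp] theorem mem_bundleFinset [Finite E(H)] {B : Set β} :
    B ∈ bundleFinset H ↔ B ∈ bundles H := by simp [bundleFinset]

theorem bundle_subset {B : Set β} (hB : B ∈ bundles H) : B ⊆ E(H) := by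
  obtain ⟨x, y, -, -, rfl⟩ := hB
  exact fun e he => Graph.IsLink.edge_mem he

theorem bundle_nonempty {B : Set β} (hB : B ∈ bundles H) : B.Nonempty := by
  obtain ⟨x, y, -, ⟨e, he⟩, rfl⟩ := hB
  exact ⟨e, he⟩

theorem bundle_eq_of_mem {B : Set β} (hB : B ∈ bundles H) {e : β} {a b : γ} (he : e ∈ B)
    (hab : H.IsLink e a b) : B = {f | H.IsLink f a b} := by
  obtain ⟨x, y, -, -, rfl⟩ := hB
  have he : H.IsLink e x y := he
  rcases hab.eq_and_eq_or_eq_and_eq he with ⟨rfl, rfl⟩ | ⟨rfl, rfl⟩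
  · rfl
  · ext f; exact H.isLink_comm

theorem exists_bundle [H.Loopless] {e : β} (he : e ∈ E(H)) : ∃ B ∈ bundles H, e ∈ B := by
  obtain ⟨a, b, hab⟩ := H.exists_isLink_of_mem_edgeSet he
  exact ⟨_, ⟨a, b, hab.ne, hab.adj, rfl⟩, hab⟩

theorem bundle_unique {B B' : Set β} (hB : B ∈ bundles H) (hB' : B' ∈ bundles H) {e : β}
    (he : e ∈ B) (he' : e ∈ B') : B = B' := by
  obtain ⟨a, b, hab⟩ := H.exists_isLink_of_mem_edgeSet (bundle_subset hB he)
  rw [bundle_eq_of_mem hB he hab, bundle_eq_of_mem hB' he' hab]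

theorem bundles_of_le [H.Loopless] (hs : s ≤ H) :
    bundles s = (· ∩ E(s)) '' {B ∈ bundles H | (B ∩ E(s)).Nonempty} := by
  have hset : ∀ x y, {e | s.IsLink e x y} = {e | H.IsLink e x y} ∩ E(s) := by
    intro x y
    ext e
    exact ⟨fun h => ⟨h.mono hs, h.edge_mem⟩, fun h => (hs.isLink_iff h.2).2 h.1⟩
  ext B
  constructor
  · rintro ⟨x, y, hne, ⟨e, he⟩, rfl⟩
    refine ⟨_, ⟨⟨x, y, hne, ⟨e, he.mono hs⟩, rfl⟩, e, he.mono hs, he.edge_mem⟩, (hset x y).symm⟩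
  · rintro ⟨_, ⟨⟨x, y, hne, -, rfl⟩, e, he, hes⟩, rfl⟩
    exact ⟨x, y, hne, ⟨e, (hs.isLink_iff hes).2 he⟩, (hset x y).symm⟩

theorem finsum_bundles_of_le [Finite E(H)] [H.Loopless] (hs : s ≤ H) (c : ℝ) :
    ∑ᶠ B ∈ bundles s, c ^ B.ncard = ∑ B ∈ bundleFinset H, pospow c (B ∩ E(s)).ncard := by
  classical
  rw [bundles_of_le hs, finsum_mem_image]
  · rw [finsum_mem_eq_finite_toFinset_sum _ ((bundles_finite H).subset (Set.sep_subset _ _))]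
    refine Finset.sum_subset_zero_on_sdiff ?_ ?_ ?_
    · intro B hB
      simp only [Set.Finite.mem_toFinset, Set.mem_ofPred_eq] at hB
      simpa using hB.1
    · intro B hB
      simp only [Finset.mem_sdiff, mem_bundleFinset, Set.Finite.mem_toFinset, Set.mem_ofPred_eq,
        not_and, Set.not_nonempty_iff_eq_empty] at hB
      rw [hB.2 hB.1]; simp [pospow]
    · intro B hB
      simp only [Set.Finite.mem_toFinset, Set.mem_ofPred_eq] at hB
      have hf : (B ∩ E(s)).Finite :=
        (Set.toFinite E(H)).subset (Set.inter_subset_left.trans (bundle_subset hB.1))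
      rw [pospow, if_neg ((Set.ncard_pos hf).2 hB.2).ne']
  · rintro B ⟨hB, e, he, hes⟩ B' ⟨hB', -⟩ h
    have : e ∈ B' ∩ E(s) := by
      have h' : B ∩ E(s) = B' ∩ E(s) := h
      rw [← h']; exact ⟨he, hes⟩
    exact bundle_unique hB hB' he this.1

variable [Finite V(H)] [Finite E(H)]

omit [Finite V(H)] in
theorem edgeSum_eq_sum_bundles [H.Loopless] (x : Coord H) (F : Set β) :
    edgeSum x F = ∑ B ∈ bundleFinset H, edgeSum x (B ∩ F) := by
  classical
  have := Fintype.ofFinite E(H)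
  simp only [edgeSum_eq_sum]
  rw [Finset.sum_comm]
  refine Finset.sum_congr rfl fun e _ => ?_
  obtain ⟨B, hB, heB⟩ := exists_bundle (H := H) e.2
  rw [Finset.sum_eq_single B]
  · simp [heB]
  · intro B' hB' hne
    rw [if_neg]
    rintro ⟨h, -⟩
    exact hne (bundle_unique (mem_bundleFinset.1 hB') hB h heB)
  · intro h; exact absurd (mem_bundleFinset.2 hB) h

omit [Finite E(H)] in
theorem nodeSum_union_add_inter (x : Coord H) (W W' : Set γ) :
    nodeSum x (W ∪ W') + nodeSum x (W ∩ W') = nodeSum x W + nodeSum x W' := by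
  classical
  have := Fintype.ofFinite V(H)
  simp only [nodeSum_eq_sum, ← Finset.sum_add_distrib]
  refine Finset.sum_congr rfl fun v _ => ?_
  by_cases h : (v : γ) ∈ W <;> by_cases h' : (v : γ) ∈ W' <;> simp [h, h']

omit [Finite V(H)] in
theorem edgeSum_union_add_inter (x : Coord H) (F F' : Set β) :
    edgeSum x (F ∪ F') + edgeSum x (F ∩ F') = edgeSum x F + edgeSum x F' := by
  classical
  have := Fintype.ofFinite E(H)
  simp only [edgeSum_eq_sum, ← Finset.sum_add_distrib]
  refine Finset.sum_congr rfl fun v _ => ?_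
  by_cases h : (v : β) ∈ F <;> by_cases h' : (v : β) ∈ F' <;> simp [h, h']

omit [Finite V(H)] [Finite E(H)] in
theorem nodeSum_empty (x : Coord H) : nodeSum x ∅ = 0 := by simp [nodeSum]

omit [Finite V(H)] [Finite E(H)] in
theorem edgeSum_empty (x : Coord H) : edgeSum x ∅ = 0 := by simp [edgeSum]

/-- The sum of the coordinates of the nodes in `W` and the edges in `F`, minus the total size of
the bundles of `F` as it enters in `bound`. -/
noncomputable def excess (x : Coord H) (W : Set γ) (F : Set β) : ℝ :=
  nodeSum x W +
    ∑ B ∈ bundleFinset H, (edgeSum x (B ∩ F) - pospow (const H) (B ∩ F).ncard)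

/-- The squared number of nodes and edges of `H` which are not in `s`. -/
noncomputable def corank (H s : Graph γ β) : ℝ :=
  (((V(H) \ V(s)).ncard + (E(H) \ E(s)).ncard : ℕ) : ℝ) ^ 2

omit [Finite V(H)] in
-- In terms of `excess`, the inequality of a tube has a right side that involves only its number of
-- nodes and its corank.
theorem tubeSum_sub_bound [H.Loopless] (hs : s ≤ H) (x : Coord H) :
    tubeSum x s - bound H s = excess x V(s) E(s) - (const H ^ V(s).ncard + corank H s) := by
  rw [tubeSum, bound, finsum_bundles_of_le hs, edgeSum_eq_sum_bundles, excess,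
    Finset.sum_sub_distrib, corank]
  ring

omit [Finite V(H)] in
-- A full bundle contributes zero to the excess, just like an absent one, so absent bundles may be
-- filled in freely.
theorem excess_congr {x : Coord H} (hx : ∀ B ∈ bundles H, edgeSum x B = const H ^ B.ncard)
    (W : Set γ) {F F' : Set β}
    (h : ∀ B ∈ bundles H, B ∩ F' = B ∩ F ∨ B ∩ F = ∅ ∧ B ∩ F' = B) :
    excess x W F' = excess x W F := by
  unfold excess
  congr 1
  refine Finset.sum_congr rfl fun B hB => ?_
  have hB := mem_bundleFinset.1 hB
  rcases h B hB with h | ⟨h1, h2⟩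
  · rw [h]
  · have hf : B.Finite := (Set.toFinite E(H)).subset (bundle_subset hB)
    rw [h1, h2, edgeSum_empty, hx B hB, pospow, pospow, if_pos (Set.ncard_empty _),
      if_neg ((Set.ncard_pos hf).2 (bundle_nonempty hB)).ne']
    ring

omit [Finite V(H)] in
theorem excess_full {x : Coord H} (hx : ∀ B ∈ bundles H, edgeSum x B = const H ^ B.ncard)
    (W : Set γ) : excess x W E(H) = nodeSum x W := by
  rw [excess_congr hx W (F := ∅) fun B hB => Or.inr ⟨Set.inter_empty _,
    Set.inter_eq_self_of_subset_left (bundle_subset hB)⟩]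
  simp [excess, edgeSum_empty, pospow]

/-- All edges in `F` have both ends in `W`. -/
def EdgesIn (H : Graph γ β) (F : Set β) (W : Set γ) : Prop :=
  ∀ e ∈ F, ∀ a b, H.IsLink e a b → a ∈ W ∧ b ∈ W

theorem excess_union (x : Coord H) {W W' : Set γ} {F F' : Set β} (hW : Disjoint W W')
    (hF : EdgesIn H F W) (hF' : EdgesIn H F' W') :
    excess x (W ∪ W') (F ∪ F') = excess x W F + excess x W' F' := by
  have h1 := nodeSum_union_add_inter x W W'
  rw [hW.inter_eq, nodeSum_empty, add_zero] at h1
  unfold excess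
  rw [h1]
  have : ∀ B ∈ bundleFinset H,
      edgeSum x (B ∩ (F ∪ F')) - pospow (const H) (B ∩ (F ∪ F')).ncard =
      (edgeSum x (B ∩ F) - pospow (const H) (B ∩ F).ncard) +
      (edgeSum x (B ∩ F') - pospow (const H) (B ∩ F').ncard) := by
    intro B hB
    have hB := mem_bundleFinset.1 hB
    have : B ∩ F = ∅ ∨ B ∩ F' = ∅ := by
      by_contra! hcon
      obtain ⟨⟨e, heB, he⟩, ⟨f, hfB, hf⟩⟩ := hcon
      obtain ⟨a, b, -, -, rfl⟩ := hB
      exact Set.disjoint_left.1 hW (hF e he a b heB).1 (hF' f hf a b hfB).1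
    rw [Set.inter_union_distrib_left]
    rcases this with h | h <;> rw [h] <;> simp [edgeSum_empty, pospow]
  rw [Finset.sum_congr rfl this, Finset.sum_add_distrib]
  ring

end Gamma

/-! ### Tight tubes are pairwise compatible. -/

section TightTubes

variable {γ β : Type*} {H s t : Graph γ β}

theorem Connected.mono (ht : Connected t) (hV : V(s) = V(t))
    (h : ∀ x y, t.Adj x y → s.Adj x y) : Connected s := by
  refine ⟨hV ▸ ht.1, fun x hx y hy => ?_⟩
  exact Relation.ReflTransGen.mono (fun a b hab => h a b hab) _ _ (ht.2 x (hV ▸ hx) y (hV ▸ hy))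

/-- The subgraph of `H` with the nodes in `W` and the edges in `F` between them. -/
def subgraphOn (H : Graph γ β) (W : Set γ) (F : Set β) : Graph γ β := (H.induce W).restrict F

@[simp] theorem vertexSet_subgraphOn (W : Set γ) (F : Set β) : V(subgraphOn H W F) = W := rfl

theorem subgraphOn_isLink {W : Set γ} {F : Set β} {e : β} {x y : γ} :
    (subgraphOn H W F).IsLink e x y ↔ e ∈ F ∧ H.IsLink e x y ∧ x ∈ W ∧ y ∈ W := by
  simp only [subgraphOn, Graph.restrict, Graph.induce]

theorem subgraphOn_le {W : Set γ} (hW : W ⊆ V(H)) (F : Set β) : subgraphOn H W F ≤ H :=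
  Graph.restrict_le.trans (Graph.induce_le hW)

theorem edgeSet_subgraphOn {W : Set γ} {F : Set β} (hF : EdgesIn H F W) :
    E(subgraphOn H W F) = F ∩ E(H) := by
  ext e
  constructor
  · intro he
    obtain ⟨x, y, h⟩ := Graph.exists_isLink_of_mem_edgeSet he
    rw [subgraphOn_isLink] at h
    exact ⟨h.1, h.2.1.edge_mem⟩
  · rintro ⟨heF, he⟩
    obtain ⟨x, y, h⟩ := H.exists_isLink_of_mem_edgeSet he
    exact Graph.IsLink.edge_mem (subgraphOn_isLink.2 ⟨heF, h, hF e heF x y h⟩)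

theorem Connected.induce (hs : Connected s) (hsH : s ≤ H) : Connected (H.induce V(s)) :=
  hs.mono rfl fun _ _ ⟨e, he⟩ => ⟨e, he.mono hsH, he.left_mem, he.right_mem⟩

theorem Connected.induce_union {W W' : Set γ} (hW : Connected (H.induce W))
    (hW' : Connected (H.induce W'))
    (h : ∃ a ∈ W, ∃ b ∈ W', a = b ∨ H.Adj a b) : Connected (H.induce (W ∪ W')) := by
  have h1 : ∀ x ∈ W, ∀ y ∈ W, Relation.ReflTransGen (H.induce (W ∪ W')).Adj x y :=
    fun x hx y hy => Relation.ReflTransGen.mono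
      (fun a b ⟨e, h, ha, hb⟩ => ⟨e, h, Or.inl ha, Or.inl hb⟩) _ _ (hW.2 x hx y hy)
  have h2 : ∀ x ∈ W', ∀ y ∈ W', Relation.ReflTransGen (H.induce (W ∪ W')).Adj x y :=
    fun x hx y hy => Relation.ReflTransGen.mono
      (fun a b ⟨e, h, ha, hb⟩ => ⟨e, h, Or.inr ha, Or.inr hb⟩) _ _ (hW'.2 x hx y hy)
  obtain ⟨a, ha, b, hb, hab⟩ := h
  have h3 : Relation.ReflTransGen (H.induce (W ∪ W')).Adj a b := by
    rcases hab with rfl | ⟨e, he⟩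
    · exact .refl
    · exact .single ⟨e, he, Or.inl ha, Or.inr hb⟩
  refine ⟨⟨a, Or.inl ha⟩, ?_⟩
  have h4 : ∀ x ∈ W ∪ W', Relation.ReflTransGen (H.induce (W ∪ W')).Adj a x := by
    rintro x (hx | hx)
    · exact h1 a ha x hx
    · exact h3.trans (h2 b hb x hx)
  intro x hx y hy
  exact (reach_symm (h4 x hx)).trans (h4 y hy)

/-- Every node in `Z` has exactly one neighbour. -/
def Pendant (H : Graph γ β) (Z : Set γ) : Prop :=
  ∀ z ∈ Z, ∃ w, H.Adj z w ∧ ∀ w', H.Adj z w' → w' = w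

/-- The tubes of `H` which are not a single node in `Z`. -/
def properTubes (H : Graph γ β) (Z : Set γ) : Set (Graph γ β) :=
  {s | IsTube H s ∧ ∀ z ∈ Z, V(s) ≠ {z}}

/-- The affine space which contains the associahedron. -/
def affineSpan (H : Graph γ β) : Set (Coord H) :=
  {x | nodeSum x V(H) = const H ^ V(H).ncard ∧
    ∀ B ∈ bundles H, edgeSum x B = const H ^ B.ncard}

variable [Finite V(H)] [Finite E(H)] {Z : Set γ} {x : Coord H}

theorem isTranslate_affineSpan : IsTranslate (affineSpan H) (lineal H) := by
  intro x hx y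
  have hV : nodeSum (y - x) V(H) = nodeSum y V(H) - nodeSum x V(H) :=
    map_sub (nodeSumL H V(H)) y x
  have hE : ∀ B, edgeSum (y - x) B = edgeSum y B - edgeSum x B :=
    fun B => map_sub (edgeSumL H B) y x
  rw [mem_lineal, hV]
  constructor
  · intro hy
    exact ⟨by rw [hy.1, hx.1, sub_self], fun B hB => by rw [hE, hy.2 B hB, hx.2 B hB, sub_self]⟩
  · intro h
    refine ⟨by rw [← hx.1]; linarith [h.1], fun B hB => ?_⟩
    have := h.2 B hB
    rw [hE] at this
    rw [← hx.2 B hB]; linarith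

theorem properTubes_finite (H : Graph γ β) [Finite V(H)] [Finite E(H)] (Z : Set γ) :
    (properTubes H Z).Finite :=
  (finite_subgraphs H).subset fun _ hs => hs.1.lt.le

/-- The associahedron as a polyhedron, for a loop-free graph `H` with ghost nodes `Z`. -/
abbrev tubePolyhedron (H : Graph γ β) [Finite V(H)] [Finite E(H)] (Z : Set γ) : Set (Coord H) :=
  polyhedron (affineSpan H) (properTubes H Z) (tubeSumL H) (bound H)

theorem corank_nonneg (H s : Graph γ β) : 0 ≤ corank H s := sq_nonneg _

/-- Properness is not required: for `s = H` the equations of the affine space give equality with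
corank zero. Hence this applies to unions of tubes. -/
theorem const_pow_add_corank_le [H.Loopless] (hx : x ∈ tubePolyhedron H Z) (hsH : s ≤ H)
    (hs : Connected s) (hadj : ∀ a ∈ V(s), ∀ b ∈ V(s), a ≠ b → H.Adj a b → s.Adj a b)
    (hZ : ∀ z ∈ Z, V(s) ≠ {z}) :
    const H ^ V(s).ncard + corank H s ≤ excess x V(s) E(s) := by
  rcases hsH.eq_or_lt with rfl | hlt
  · rw [excess_full hx.1.2, hx.1.1]
    simp [corank]
  · have h1 := hx.2 s ⟨⟨hlt, hs, hadj⟩, hZ⟩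
    have h2 := tubeSum_sub_bound hsH x
    rw [tubeSumL_apply] at h1
    linarith

/-- Arbitrary edge sets within `W` are allowed: filling in the bundles that `F` misses turns `(W,
F)` into a tube or `H`, without changing the excess. -/
theorem const_pow_le_excess [H.Loopless] (hx : x ∈ tubePolyhedron H Z) {W : Set γ}
    (hWH : W ⊆ V(H)) (hW : Connected (H.induce W)) (hZ : ∀ z ∈ Z, W ≠ {z}) {F : Set β}
    (hF : EdgesIn H F W) : const H ^ W.ncard ≤ excess x W F := by
  set F' : Set β := F ∪ {e | ∃ B ∈ bundles H, e ∈ B ∧ B ∩ F = ∅} with hF'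
  have hlink : ∀ a ∈ W, ∀ b ∈ W, H.Adj a b → (subgraphOn H W F').Adj a b := by
    rintro a ha b hb ⟨e, he⟩
    by_cases hB : {f | H.IsLink f a b} ∩ F = ∅
    · exact ⟨e, subgraphOn_isLink.2 ⟨Or.inr ⟨_, ⟨a, b, he.ne, he.adj, rfl⟩, he, hB⟩, he, ha, hb⟩⟩
    · obtain ⟨f, hf, hfF⟩ := Set.nonempty_iff_ne_empty.2 hB
      exact ⟨f, subgraphOn_isLink.2 ⟨Or.inl hfF, hf, ha, hb⟩⟩
  have h1 := const_pow_add_corank_le hx (subgraphOn_le hWH F')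
    (hW.mono rfl fun a b ⟨e, he, ha, hb⟩ => hlink a ha b hb ⟨e, he⟩)
    (fun a ha b hb _ hab => hlink a ha b hb hab) hZ
  rw [vertexSet_subgraphOn, excess_congr hx.1.2 W (F := F)] at h1
  · linarith [corank_nonneg H (subgraphOn H W F')]
  intro B hB
  by_cases hBF : B ∩ F = ∅
  · obtain ⟨a, b, hne, hab, rfl⟩ := hB
    by_cases hW : a ∈ W ∧ b ∈ W
    · refine Or.inr ⟨hBF, Set.inter_eq_self_of_subset_left fun e he => ?_⟩
      exact Graph.IsLink.edge_mem (subgraphOn_isLink.2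
        ⟨Or.inr ⟨_, ⟨a, b, hne, hab, rfl⟩, he, hBF⟩, he, hW⟩)
    · left
      rw [hBF, Set.eq_empty_iff_forall_notMem]
      rintro e ⟨he, heS⟩
      obtain ⟨c, d, h⟩ := Graph.exists_isLink_of_mem_edgeSet heS
      have h := subgraphOn_isLink.1 h
      rcases h.2.1.eq_and_eq_or_eq_and_eq he with ⟨rfl, rfl⟩ | ⟨rfl, rfl⟩
      exacts [hW h.2.2, hW h.2.2.symm]
  · left
    ext e
    constructor
    · rintro ⟨he, heS⟩
      obtain ⟨c, d, h⟩ := Graph.exists_isLink_of_mem_edgeSet heS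
      rcases (subgraphOn_isLink.1 h).1 with h | ⟨B', hB', heB', hB'F⟩
      · exact ⟨he, h⟩
      · exact absurd (bundle_unique hB hB' he heB' ▸ hB'F) hBF
    · rintro ⟨he, heF⟩
      obtain ⟨a, b, h⟩ := H.exists_isLink_of_mem_edgeSet (bundle_subset hB he)
      exact ⟨he, Graph.IsLink.edge_mem (subgraphOn_isLink.2 ⟨Or.inl heF, h, hF e heF a b h⟩)⟩

/-- Splitting off a connected component of the graph induced on `W`. -/
theorem exists_excess_split (x : Coord H) {W : Set γ} (hne : W.Nonempty) :
    ∃ C ⊆ W, C.Nonempty ∧ Connected (H.induce C) ∧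
      (∀ a ∈ C, ∀ b ∈ W, H.Adj a b → b ∈ C) ∧
      ∀ F, EdgesIn H F W → EdgesIn H (F ∩ E(H.induce C)) C ∧
        EdgesIn H (F \ E(H.induce C)) (W \ C) ∧
        excess x W F = excess x C (F ∩ E(H.induce C)) + excess x (W \ C) (F \ E(H.induce C)) := by
  obtain ⟨a, ha⟩ := hne
  set C := V(componentOf (H.induce W) a) with hC
  have hCW : C ⊆ W := (componentOf_le (H := H.induce W) ha).vertexSet_mono
  have hadj : ∀ a ∈ C, ∀ b ∈ W, H.Adj a b → b ∈ C := by
    rintro b hb d hd ⟨e, he⟩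
    exact Relation.ReflTransGen.tail hb ⟨e, he, hCW hb, hd⟩
  refine ⟨C, hCW, ⟨a, .refl⟩, ?_, hadj, fun F hF => ?_⟩
  · exact (connected_componentOf (H.induce W) a).mono rfl
      fun b d ⟨e, he, hb, hd⟩ => ⟨e, he.1, hb, hd⟩
  · have hF1 : EdgesIn H (F ∩ E(H.induce C)) C := by
      rintro e ⟨-, he⟩ b d h
      obtain ⟨b', d', h', hb', hd'⟩ := Graph.exists_isLink_of_mem_edgeSet he
      rcases h.eq_and_eq_or_eq_and_eq h' with ⟨rfl, rfl⟩ | ⟨rfl, rfl⟩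
      exacts [⟨hb', hd'⟩, ⟨hd', hb'⟩]
    have hF2 : EdgesIn H (F \ E(H.induce C)) (W \ C) := by
      rintro e ⟨heF, he⟩ b d h
      have hbd := hF e heF b d h
      have hiff : b ∈ C ↔ d ∈ C :=
        ⟨fun hb => hadj b hb d hbd.2 h.adj, fun hd => hadj d hd b hbd.1 h.adj.symm⟩
      have hb : b ∉ C := fun hb =>
        he (Graph.IsLink.edge_mem (x := b) (y := d) ⟨h, hb, hiff.1 hb⟩)
      exact ⟨⟨hbd.1, hb⟩, ⟨hbd.2, fun hd => hb (hiff.2 hd)⟩⟩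
    refine ⟨hF1, hF2, ?_⟩
    rw [← excess_union x Set.disjoint_sdiff_right hF1 hF2, Set.union_sdiff_cancel hCW,
      Set.inter_union_sdiff]

theorem const_nonneg (H : Graph γ β) : 0 ≤ const H := sq_nonneg _

omit [Finite V(H)] in
theorem excess_empty (x : Coord H) {F : Set β} (hF : EdgesIn H F ∅) : excess x ∅ F = 0 := by
  rw [excess, nodeSum_empty, zero_add]
  refine Finset.sum_eq_zero fun B hB => ?_
  have : B ∩ F = ∅ := by
    rw [Set.eq_empty_iff_forall_notMem]
    rintro e ⟨he, heF⟩
    obtain ⟨a, b, h⟩ := H.exists_isLink_of_mem_edgeSet (bundle_subset (mem_bundleFinset.1 hB) he)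
    exact (hF e heF a b h).1
  rw [this, edgeSum_empty]
  simp [pospow]

/-- Peel off components of the graph induced on `W`; each has nonnegative excess. The condition on
`Z` keeps a single ghost, for which there is no inequality, from being a component. -/
theorem excess_nonneg [H.Loopless] (hZp : Pendant H Z) (hx : x ∈ tubePolyhedron H Z) {W : Set γ}
    (hWH : W ⊆ V(H)) (hZ : ∀ z ∈ Z, z ∈ W → ∀ w, H.Adj z w → w ∈ W) {F : Set β}
    (hF : EdgesIn H F W) : 0 ≤ excess x W F := by
  induction hk : W.ncard using Nat.strong_induction_on generalizing W F with
  | _ k ih =>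
    subst hk
    rcases W.eq_empty_or_nonempty with rfl | hne
    · rw [excess_empty x hF]
    obtain ⟨C, hCW, hCne, hC, hadj, hsplit⟩ := exists_excess_split x hne
    obtain ⟨hF1, hF2, heq⟩ := hsplit F hF
    have hWf : W.Finite := (Set.toFinite V(H)).subset hWH
    have h1 := const_pow_le_excess hx (hCW.trans hWH) hC (fun z hz hCz => by
      have hzC : z ∈ C := hCz ▸ Set.mem_singleton z
      obtain ⟨w, hw, -⟩ := hZp z hz
      have hwC := hadj z hzC w (hZ z hz (hCW hzC) w hw) hw
      rw [hCz] at hwC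
      exact hw.ne hwC.symm) hF1
    have h2 := ih (W \ C).ncard (Set.ncard_lt_ncard
      ⟨Set.sdiff_subset, fun h => by
        obtain ⟨a, ha⟩ := hCne
        exact (h (hCW ha)).2 ha⟩ hWf) (Set.sdiff_subset.trans hWH)
      (fun z hz hzW w hw => ⟨hZ z hz hzW.1 w hw, fun hwC =>
        hzW.2 (hadj w hwC z hzW.1 hw.symm)⟩) hF2 rfl
    have h3 : 0 ≤ const H ^ C.ncard := pow_nonneg (const_nonneg H) _
    rw [heq]; linarith

theorem tight_excess [H.Loopless] (hs : s ∈ tight (properTubes H Z) (tubeSumL H) (bound H) x) :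
    excess x V(s) E(s) = const H ^ V(s).ncard + corank H s := by
  have h1 := tubeSum_sub_bound hs.1.1.lt.le x
  have h2 := hs.2
  rw [tubeSumL_apply] at h2
  linarith

theorem two_le_of_isTube (hs : IsTube H s) : 2 ≤ V(H).ncard + E(H).ncard := by
  have hle := hs.lt.le
  have hVf : V(H).Finite := Set.toFinite _
  have hEf : E(H).Finite := Set.toFinite _
  have h1 : 1 ≤ V(s).ncard := (Set.ncard_pos (hVf.subset hle.vertexSet_mono)).2 hs.connected.1
  rcases Graph.vertexSet_ssubset_or_edgeSet_ssubset_of_lt hs.lt with h | h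
  · have := Set.ncard_lt_ncard h hVf; omega
  · have := Set.ncard_lt_ncard h hEf
    have := Set.ncard_le_ncard hle.vertexSet_mono hVf; omega

theorem four_le_const (hs : IsTube H s) : 4 ≤ const H := by
  have h : (2 : ℝ) ≤ ((V(H).ncard + E(H).ncard : ℕ) : ℝ) := by
    exact_mod_cast two_le_of_isTube hs
  rw [const]; nlinarith

theorem corank_eq (hs : s ≤ H) : corank H s =
    (((V(H).ncard + E(H).ncard : ℕ) : ℝ) - ((V(s).ncard + E(s).ncard : ℕ) : ℝ)) ^ 2 := by
  have hVf : V(H).Finite := Set.toFinite _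
  have hEf : E(H).Finite := Set.toFinite _
  have h1 := Set.ncard_sdiff_add_ncard_of_subset hs.vertexSet_mono hVf
  have h2 := Set.ncard_sdiff_add_ncard_of_subset hs.edgeSet_mono hEf
  rw [corank, ← h1, ← h2]
  push_cast
  ring

/-- At most `n - 1` of the `n` nodes and edges are missing, and `(n - 1) ^ 2 ≤ n ^ 2 - 1`. -/
theorem corank_le (hs : s ≤ H) (hne : V(s).Nonempty) : corank H s ≤ const H - 1 := by
  have hVf : V(H).Finite := Set.toFinite _
  have hEf : E(H).Finite := Set.toFinite _
  have h1 : 1 ≤ V(s).ncard := (Set.ncard_pos (hVf.subset hs.vertexSet_mono)).2 hne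
  have h2 := Set.ncard_le_ncard hs.vertexSet_mono hVf
  have h3 := Set.ncard_le_ncard hs.edgeSet_mono hEf
  rw [corank_eq hs, const]
  have h4 : (1 : ℝ) ≤ ((V(s).ncard + E(s).ncard : ℕ) : ℝ) := by exact_mod_cast (by omega)
  have h5 : ((V(s).ncard + E(s).ncard : ℕ) : ℝ) ≤ ((V(H).ncard + E(H).ncard : ℕ) : ℝ) := by
    exact_mod_cast (by omega)
  nlinarith

/-- Coordinate sums are modular, so the defect comes from the powers alone and does not depend on
`x`. -/
theorem excess_add_excess [H.Loopless] (x : Coord H) (W W' : Set γ) (F F' : Set β) :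
    excess x W F + excess x W' F' = excess x (W ∪ W') (F ∪ F') + excess x (W ∩ W') (F ∩ F') +
      ∑ B ∈ bundleFinset H, (pospow (const H) (B ∩ F ∪ B ∩ F').ncard +
        pospow (const H) (B ∩ F ∩ (B ∩ F')).ncard - pospow (const H) (B ∩ F).ncard -
        pospow (const H) (B ∩ F').ncard) := by
  have h1 := nodeSum_union_add_inter x W W'
  have h2 := edgeSum_union_add_inter x F F'
  simp only [edgeSum_eq_sum_bundles x (F ∪ F'), edgeSum_eq_sum_bundles x (F ∩ F'),
    edgeSum_eq_sum_bundles x F, edgeSum_eq_sum_bundles x F'] at h2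
  unfold excess
  simp only [Finset.sum_sub_distrib, Finset.sum_add_distrib, ← Set.inter_union_distrib_left,
    ← Set.inter_inter_distrib_left]
  linarith

omit [Finite V(H)] [Finite E(H)] in
theorem edgesIn_of_le (hs : s ≤ H) : EdgesIn H E(s) V(s) := fun _ he _ _ h =>
  mem_of_isLink_of_edge_mem hs h he

omit [Finite V(H)] [Finite E(H)] in
theorem EdgesIn.mono {F F' : Set β} {W W' : Set γ} (h : EdgesIn H F W) (hF : F' ⊆ F)
    (hW : W ⊆ W') : EdgesIn H F' W' := fun e he a b hab =>
  ⟨hW (h e (hF he) a b hab).1, hW (h e (hF he) a b hab).2⟩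

omit [Finite V(H)] in
theorem sum_gain_nonneg (hc : 4 ≤ const H) (F F' : Set β) :
    0 ≤ ∑ B ∈ bundleFinset H, (pospow (const H) (B ∩ F ∪ B ∩ F').ncard +
        pospow (const H) (B ∩ F ∩ (B ∩ F')).ncard - pospow (const H) (B ∩ F).ncard -
        pospow (const H) (B ∩ F').ncard) ∧
    ((∃ B ∈ bundles H, ¬ B ∩ F ⊆ B ∩ F' ∧ ¬ B ∩ F' ⊆ B ∩ F) →
      2 * const H ≤ ∑ B ∈ bundleFinset H, (pospow (const H) (B ∩ F ∪ B ∩ F').ncard +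
        pospow (const H) (B ∩ F ∩ (B ∩ F')).ncard - pospow (const H) (B ∩ F).ncard -
        pospow (const H) (B ∩ F').ncard)) := by
  have hf : ∀ B ∈ bundleFinset H, ∀ F, (B ∩ F).Finite := fun B hB F =>
    (Set.toFinite E(H)).subset
      (Set.inter_subset_left.trans (bundle_subset (mem_bundleFinset.1 hB)))
  have hnn : ∀ B ∈ bundleFinset H, 0 ≤ pospow (const H) (B ∩ F ∪ B ∩ F').ncard +
        pospow (const H) (B ∩ F ∩ (B ∩ F')).ncard - pospow (const H) (B ∩ F).ncard -
        pospow (const H) (B ∩ F').ncard := fun B hB => by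
    linarith [(pospow_union_add_inter hc (hf B hB F) (hf B hB F')).1]
  refine ⟨Finset.sum_nonneg hnn, ?_⟩
  rintro ⟨B, hB, h1, h2⟩
  have hB := mem_bundleFinset.2 hB
  refine le_trans ?_ (Finset.single_le_sum hnn hB)
  linarith [(pospow_union_add_inter hc (hf B hB F) (hf B hB F')).2 h1 h2]

omit [Finite V(H)] [Finite E(H)] in
theorem adj_of_isTube [H.Loopless] (hs : IsTube H s) {a b : γ} (ha : a ∈ V(s)) (hb : b ∈ V(s))
    (hab : H.Adj a b) : ({f | H.IsLink f a b} ∩ E(s)).Nonempty := by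
  obtain ⟨e, he⟩ := hs.adj a ha b hb hab.ne hab
  exact ⟨e, he.mono hs.lt.le, he.edge_mem⟩

/-- Tight tubes with nested node sets are nested. -/
theorem le_or_le_of_tight [H.Loopless] (hx : x ∈ tubePolyhedron H Z)
    (hs : s ∈ tight (properTubes H Z) (tubeSumL H) (bound H) x)
    (ht : t ∈ tight (properTubes H Z) (tubeSumL H) (bound H) x) (hst : V(s) ⊆ V(t)) :
    s ≤ t ∨ t ≤ s := by
  by_contra! hcon
  have hsH := hs.1.1.lt.le
  have htH := ht.1.1.lt.le
  have hc := four_le_const hs.1.1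
  have hqs := corank_le hsH hs.1.1.connected.1
  have hqt := corank_le htH ht.1.1.connected.1
  have hsum := excess_add_excess x V(s) V(t) E(s) E(t)
  rw [tight_excess hs, tight_excess ht, Set.union_eq_self_of_subset_left hst,
    Set.inter_eq_self_of_subset_left hst] at hsum
  obtain ⟨hg, hg'⟩ := sum_gain_nonneg hc E(s) E(t)
  have hFu : EdgesIn H (E(s) ∪ E(t)) V(t) := by
    rintro e (he | he)
    exacts [(edgesIn_of_le hsH).mono subset_rfl hst e he, edgesIn_of_le htH e he]
  have hFi : EdgesIn H (E(s) ∩ E(t)) V(s) :=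
    (edgesIn_of_le hsH).mono Set.inter_subset_left subset_rfl
  have hEs := hsH.edgeSet_mono
  have hEt := htH.edgeSet_mono
  -- A bundle split crosswise gains `2 * c`, more than both squared coranks, so bounds that ignore
  -- corank suffice.
  by_cases hnest : ∃ B ∈ bundles H, ¬ B ∩ E(s) ⊆ B ∩ E(t) ∧ ¬ B ∩ E(t) ⊆ B ∩ E(s)
  · have h1 := const_pow_le_excess hx htH.vertexSet_mono (ht.1.1.connected.induce htH) ht.1.2 hFu
    have h2 := const_pow_le_excess hx hsH.vertexSet_mono (hs.1.1.connected.induce hsH) hs.1.2 hFi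
    have h3 := hg' hnest
    linarith
  · push Not at hnest
    have hau : ∀ a ∈ V(t), ∀ b ∈ V(t), H.Adj a b →
        (subgraphOn H V(t) (E(s) ∪ E(t))).Adj a b := by
      intro a ha b hb hab
      obtain ⟨f, hf, hft⟩ := adj_of_isTube ht.1.1 ha hb hab
      exact ⟨f, subgraphOn_isLink.2 ⟨Or.inr hft, hf, ha, hb⟩⟩
    -- Within each bundle the two edge sets are nested, so the intersection keeps the smaller one,
    -- which is nonempty between adjacent nodes. Thus union and intersection obey the inequality
    -- with corank.
    have hai : ∀ a ∈ V(s), ∀ b ∈ V(s), H.Adj a b →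
        (subgraphOn H V(s) (E(s) ∩ E(t))).Adj a b := by
      intro a ha b hb hab
      obtain ⟨f, hf, hft⟩ := adj_of_isTube ht.1.1 (hst ha) (hst hb) hab
      obtain ⟨g, hg, hgs⟩ := adj_of_isTube hs.1.1 ha hb hab
      by_cases hsub : {f | H.IsLink f a b} ∩ E(s) ⊆ {f | H.IsLink f a b} ∩ E(t)
      · exact ⟨g, subgraphOn_isLink.2 ⟨⟨hgs, (hsub ⟨hg, hgs⟩).2⟩, hg, ha, hb⟩⟩
      · have := hnest _ ⟨a, b, hab.ne, hab, rfl⟩ hsub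
        exact ⟨f, subgraphOn_isLink.2 ⟨⟨(this ⟨hf, hft⟩).2, hft⟩, hf, ha, hb⟩⟩
    have hleu := subgraphOn_le htH.vertexSet_mono (E(s) ∪ E(t))
    have hlei := subgraphOn_le hsH.vertexSet_mono (E(s) ∩ E(t))
    have h1 := const_pow_add_corank_le hx hleu
      ((ht.1.1.connected.induce htH).mono rfl fun a b ⟨e, he, ha, hb⟩ => hau a ha b hb ⟨e, he⟩)
      (fun a ha b hb _ => hau a ha b hb) ht.1.2
    have h2 := const_pow_add_corank_le hx hlei
      ((hs.1.1.connected.induce hsH).mono rfl fun a b ⟨e, he, ha, hb⟩ => hai a ha b hb ⟨e, he⟩)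
      (fun a ha b hb _ => hai a ha b hb) hs.1.2
    rw [corank_eq hleu] at h1
    rw [corank_eq hlei] at h2
    rw [edgeSet_subgraphOn hFu, vertexSet_subgraphOn,
      Set.inter_eq_self_of_subset_left (Set.union_subset hEs hEt)] at h1
    rw [edgeSet_subgraphOn hFi, vertexSet_subgraphOn,
      Set.inter_eq_self_of_subset_left (Set.inter_subset_left.trans hEs)] at h2
    rw [corank_eq hsH, corank_eq htH] at hsum
    have hEf : E(H).Finite := Set.toFinite _
    have hVf : V(H).Finite := Set.toFinite _
    have hn := Set.ncard_union_add_ncard_inter E(s) E(t) (hEf.subset hEs) (hEf.subset hEt)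
    have hn1 : E(t).ncard < (E(s) ∪ E(t)).ncard := by
      refine Set.ncard_lt_ncard ⟨Set.subset_union_right, fun h => hcon.1 ?_⟩
        (hEf.subset (Set.union_subset hEs hEt))
      exact (le_iff_of_le_le hsH htH).2 ⟨hst, Set.subset_union_left.trans h⟩
    have hn2 : V(s).ncard + E(s).ncard < V(t).ncard + (E(s) ∪ E(t)).ncard := by
      have h3 := Set.ncard_le_ncard hst (hVf.subset htH.vertexSet_mono)
      have h4 : E(s).ncard ≤ (E(s) ∪ E(t)).ncard := Set.ncard_le_ncard Set.subset_union_left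
        (hEf.subset (Set.union_subset hEs hEt))
      by_contra! hge
      have hV : V(s) = V(t) :=
        Set.eq_of_subset_of_ncard_le hst (by omega) (hVf.subset htH.vertexSet_mono)
      have hE : E(s) = E(s) ∪ E(t) := Set.eq_of_subset_of_ncard_le Set.subset_union_left
        (by omega) (hEf.subset (Set.union_subset hEs hEt))
      exact hcon.2 ((le_iff_of_le_le htH hsH).2
        ⟨hV.symm.subset, Set.subset_union_right.trans hE.symm.subset⟩)
    have hnr : ((E(s) ∪ E(t)).ncard : ℝ) + (E(s) ∩ E(t)).ncard = E(s).ncard + E(t).ncard := by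
      exact_mod_cast hn
    have hn1r : (E(t).ncard : ℝ) < (E(s) ∪ E(t)).ncard := by exact_mod_cast hn1
    have hn2r : (V(s).ncard : ℝ) + E(s).ncard < V(t).ncard + (E(s) ∪ E(t)).ncard := by
      exact_mod_cast hn2
    push_cast at h1 h2 hsum
    -- Strict convexity of the square: the difference of the two sides is `2 * (U - S) * (U - T)`.
    have key : ∀ N S T U I : ℝ, U + I = S + T → S < U → T < U →
        (N - S) ^ 2 + (N - T) ^ 2 < (N - U) ^ 2 + (N - I) ^ 2 := by
      intro N S T U I h hS hT
      obtain rfl : I = S + T - U := by linarith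
      nlinarith [mul_pos (sub_pos.2 hS) (sub_pos.2 hT)]
    have := key (V(H).ncard + E(H).ncard) (V(s).ncard + E(s).ncard) (V(t).ncard + E(t).ncard)
      (V(t).ncard + (E(s) ∪ E(t)).ncard) (V(s).ncard + (E(s) ∩ E(t)).ncard) (by linarith)
      (by linarith) (by linarith)
    linarith

/-- By `le_or_le_of_tight`, incompatible tight tubes have node sets that are not nested. Their union
is connected and needs excess at least `c ^ |V(s) ∪ V(t)|`, while the intersection, possibly empty
or disconnected, has nonnegative excess. The two tight values are too small for that. -/
theorem pairwise_tight [H.Loopless] (hZp : Pendant H Z) (hx : x ∈ tubePolyhedron H Z) :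
    (tight (properTubes H Z) (tubeSumL H) (bound H) x).Pairwise (TubesCompatible H) := by
  intro s hs t ht hne
  by_contra hcon
  have hsH := hs.1.1.lt.le
  have htH := ht.1.1.lt.le
  have hc := four_le_const hs.1.1
  have hst : ¬ s ≤ t := fun h => hcon (Or.inl (lt_of_le_of_ne h hne))
  have hts : ¬ t ≤ s := fun h => hcon (Or.inr (Or.inl (lt_of_le_of_ne h hne.symm)))
  have hmeet : ∃ a ∈ V(s), ∃ b ∈ V(t), a = b ∨ H.Adj a b := by
    by_contra! h
    exact hcon (Or.inr (Or.inr ⟨Set.disjoint_left.2 fun a ha hb => (h a ha a hb).1 rfl,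
      fun a ha b hb => (h a ha b hb).2⟩))
  have hVst : ¬ V(s) ⊆ V(t) := fun h => by
    rcases le_or_le_of_tight hx hs ht h with h | h
    exacts [hst h, hts h]
  have hVts : ¬ V(t) ⊆ V(s) := fun h => by
    rcases le_or_le_of_tight hx ht hs h with h | h
    exacts [hts h, hst h]
  have hqs := corank_le hsH hs.1.1.connected.1
  have hqt := corank_le htH ht.1.1.connected.1
  have hsum := excess_add_excess x V(s) V(t) E(s) E(t)
  rw [tight_excess hs, tight_excess ht] at hsum
  have hg := (sum_gain_nonneg hc E(s) E(t)).1
  have hVf : V(H).Finite := Set.toFinite _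
  have hUH : V(s) ∪ V(t) ⊆ V(H) := Set.union_subset hsH.vertexSet_mono htH.vertexSet_mono
  have h1 : const H ^ (V(s) ∪ V(t)).ncard ≤ excess x (V(s) ∪ V(t)) (E(s) ∪ E(t)) := by
    refine const_pow_le_excess hx hUH ((hs.1.1.connected.induce hsH).induce_union
      (ht.1.1.connected.induce htH) hmeet) (fun z hz h => ?_) ?_
    · have hsub : V(s) ⊆ {z} := h ▸ Set.subset_union_left
      exact hs.1.2 z hz (hs.1.1.connected.1.subset_singleton_iff.1 hsub)
    · rintro e (he | he)
      exacts [(edgesIn_of_le hsH).mono subset_rfl Set.subset_union_left e he,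
        (edgesIn_of_le htH).mono subset_rfl Set.subset_union_right e he]
  -- A ghost in a larger tube brings its only neighbour along, so the intersection meets the
  -- condition of `excess_nonneg`.
  have hnbr : ∀ r, IsTube H r → (∀ z ∈ Z, V(r) ≠ {z}) → ∀ z ∈ Z, z ∈ V(r) →
      ∀ w, H.Adj z w → w ∈ V(r) := by
    intro r hr hrZ z hz hzr w hw
    obtain ⟨w', -, hw'⟩ := hZp z hz
    have : ∃ y ∈ V(r), y ≠ z := by
      by_contra! h
      exact hrZ z hz (Set.eq_singleton_iff_unique_mem.2 ⟨hzr, h⟩)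
    obtain ⟨y, hy, hyz⟩ := this
    obtain ⟨a, ha, b, hb, hab⟩ := hr.connected.exists_adj (W := {z}) hzr rfl hy hyz
    obtain rfl : a = z := ha
    rw [hw' w hw, ← hw' b (hab.mono hr.lt.le)]
    exact hab.right_mem
  have h2 : 0 ≤ excess x (V(s) ∩ V(t)) (E(s) ∩ E(t)) := by
    refine excess_nonneg hZp hx (Set.inter_subset_left.trans hsH.vertexSet_mono)
      (fun z hz hzm w hw => ⟨hnbr s hs.1.1 hs.1.2 z hz hzm.1 w hw,
        hnbr t ht.1.1 ht.1.2 z hz hzm.2 w hw⟩) fun e he a b hab => ?_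
    have h3 := edgesIn_of_le hsH e he.1 a b hab
    have h4 := edgesIn_of_le htH e he.2 a b hab
    exact ⟨⟨h3.1, h4.1⟩, ⟨h3.2, h4.2⟩⟩
  have h3 := pow_add_pow_lt hc (a := V(s).ncard) (b := V(t).ncard) (m := (V(s) ∪ V(t)).ncard)
    ((Set.ncard_pos (hVf.subset hsH.vertexSet_mono)).2 hs.1.1.connected.1)
    (Set.ncard_lt_ncard ⟨Set.subset_union_left, fun h => hVts (Set.subset_union_right.trans h)⟩
      (hVf.subset hUH))
    (Set.ncard_lt_ncard ⟨Set.subset_union_right, fun h => hVst (Set.subset_union_left.trans h)⟩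
      (hVf.subset hUH))
  linarith

end TightTubes

/-! ### Tight sets are exactly the tubings by proper tubes. -/

section Realization

variable {γ β : Type*} {H s t : Graph γ β} [Finite V(H)] [Finite E(H)] {Z : Set γ} {x : Coord H}

omit [Finite V(H)] [Finite E(H)] in
theorem reach_closed {W : Set γ} (hW : ∀ a ∈ W, ∀ b, H.Adj a b → b ∈ W) {a b : γ} (ha : a ∈ W)
    (hab : Relation.ReflTransGen H.Adj a b) : b ∈ W := by
  induction hab with
  | refl => exact ha
  | tail _ h ih => exact hW _ ih _ h

/-- If all components are tight, then the excess of a union of components is small. -/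
theorem excess_le_of_components [H.Loopless]
    (hK : ∀ K, IsComponent H K → K ∈ tight (properTubes H Z) (tubeSumL H) (bound H) x)
    {W : Set γ} (hWH : W ⊆ V(H)) (hW : ∀ a ∈ W, ∀ b, H.Adj a b → b ∈ W) {F : Set β}
    (hF : EdgesIn H F W) (hFW : ∀ e a b, a ∈ W → H.IsLink e a b → e ∈ F) :
    excess x W F ≤ W.ncard * (const H ^ (V(H).ncard - 1) + (const H - 1)) := by
  have hVf : V(H).Finite := Set.toFinite _
  induction hk : W.ncard using Nat.strong_induction_on generalizing W F with
  | _ k ih =>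
    subst hk
    rcases W.eq_empty_or_nonempty with rfl | ⟨a, ha⟩
    · rw [excess_empty x hF]; simp
    set K := componentOf H a
    have hKc : IsComponent H K := isComponent_componentOf (hWH ha)
    have haK : a ∈ V(K) := Relation.ReflTransGen.refl
    have hKt := hK K hKc
    have hc := four_le_const hKt.1.1
    have hKW : V(K) ⊆ W := by
      intro b hb
      exact reach_closed hW ha hb
    have hKF : E(K) ⊆ F := fun e he => by
      obtain ⟨b, d, h⟩ := K.exists_isLink_of_mem_edgeSet he
      exact hFW e b d (hKW h.left_mem) (h.mono hKc.le)
    have hWf : W.Finite := hVf.subset hWH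
    have hout : ∀ b, b ∉ V(K) → ∀ d, H.Adj b d → d ∉ V(K) := fun b hb d hbd hd =>
      hb (hKc.mem_of_adj hd hbd.symm)
    have hF2 : EdgesIn H (F \ E(K)) (W \ V(K)) := by
      rintro e ⟨heF, he⟩ b d h
      have hbd := hF e heF b d h
      exact ⟨⟨hbd.1, fun hb => he (hKc.edge_mem hb h)⟩,
        ⟨hbd.2, fun hd => he (hKc.edge_mem hd h.symm)⟩⟩
    have h1 := ih (W \ V(K)).ncard (Set.ncard_lt_ncard
      ⟨Set.sdiff_subset, fun h => (h ha).2 haK⟩ hWf) (Set.sdiff_subset.trans hWH)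
      (fun b hb d hbd => ⟨hW b hb.1 d hbd, hout b hb.2 d hbd⟩) hF2
      (fun e b d hb h => ⟨hFW e b d hb.1 h, fun he =>
        hb.2 (mem_of_isLink_of_edge_mem hKc.le h he).1⟩) rfl
    have h2 := excess_union x Set.disjoint_sdiff_right (edgesIn_of_le hKc.le) hF2
    rw [Set.union_sdiff_cancel hKW, Set.union_sdiff_cancel hKF, tight_excess hKt] at h2
    have hKlt : V(K).ncard ≤ V(H).ncard - 1 := by
      have hss : V(K) ⊂ V(H) := by
        refine ⟨hKc.le.vertexSet_mono, fun h => hKt.1.1.lt.not_ge ?_⟩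
        refine (le_iff_of_le_le le_rfl hKc.le).2 ⟨h, fun e he => ?_⟩
        obtain ⟨b, d, hbd⟩ := H.exists_isLink_of_mem_edgeSet he
        exact hKc.edge_mem (h hbd.left_mem) hbd
      have := Set.ncard_lt_ncard hss hVf
      omega
    have h3 : const H ^ V(K).ncard ≤ const H ^ (V(H).ncard - 1) :=
      pow_le_pow_right₀ (by linarith) hKlt
    have h4 := corank_le hKc.le hKc.connected.1
    have h5 : (1 : ℝ) ≤ V(K).ncard := by
      exact_mod_cast (Set.ncard_pos (hWf.subset hKW)).2 ⟨a, haK⟩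
    have h6 : (W.ncard : ℝ) = (W \ V(K)).ncard + V(K).ncard := by
      exact_mod_cast (Set.ncard_sdiff_add_ncard_of_subset hKW hWf).symm
    have h7 : 0 ≤ const H ^ (V(H).ncard - 1) + (const H - 1) := by
      have : 0 ≤ const H ^ (V(H).ncard - 1) := pow_nonneg (const_nonneg H) _
      linarith
    rw [h2, h6]
    nlinarith

/-- With `N` nodes, tightness of all components would force `c ^ N ≤ N * (c ^ (N - 1) + c - 1)`.
This fails because `N ≤ n`, `2 ≤ n` and `c = n ^ 2`. -/
theorem isTubing_tight [H.Loopless] (hV : V(H).Nonempty) (hZp : Pendant H Z)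
    (hx : x ∈ tubePolyhedron H Z) :
    IsTubing H (tight (properTubes H Z) (tubeSumL H) (bound H) x) := by
  refine ⟨fun t ht => ht.1.1, pairwise_tight hZp hx, fun hall => ?_⟩
  have h1 := excess_le_of_components hall subset_rfl (fun a _ b h => h.right_mem)
    (edgesIn_of_le le_rfl) (fun e a b _ h => h.edge_mem)
  rw [excess_full hx.1.2, hx.1.1] at h1
  obtain ⟨a, ha⟩ := hV
  have hK := isComponent_componentOf ha
  have hKt := (hall _ hK).1.1
  have h2 := two_le_of_isTube hKt
  have hVf : V(H).Finite := Set.toFinite _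
  -- the component of `a` is not the whole node set
  have hV2 : 2 ≤ V(H).ncard := by
    have hss : V(componentOf H a) ⊂ V(H) := by
      refine ⟨hK.le.vertexSet_mono, fun h => hKt.lt.not_ge ?_⟩
      refine (le_iff_of_le_le le_rfl hK.le).2 ⟨h, fun e he => ?_⟩
      obtain ⟨b, d, hbd⟩ := H.exists_isLink_of_mem_edgeSet he
      exact hK.edge_mem (h hbd.left_mem) hbd
    have h3 := Set.ncard_lt_ncard hss hVf
    have h4 := (Set.ncard_pos (hVf.subset hK.le.vertexSet_mono)).2 hK.connected.1
    omega
  have hc := four_le_const hKt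
  set n : ℝ := ((V(H).ncard + E(H).ncard : ℕ) : ℝ) with hn
  have hcn : const H = n ^ 2 := rfl
  have hn2 : 2 ≤ n := by rw [hn]; exact_mod_cast h2
  have hNn : (V(H).ncard : ℝ) ≤ n := by rw [hn]; exact_mod_cast Nat.le_add_right _ _
  have hQ : const H ≤ const H ^ (V(H).ncard - 1) := le_self_pow₀ (by linarith) (by omega)
  have hpow : const H ^ V(H).ncard = n ^ 2 * const H ^ (V(H).ncard - 1) := by
    rw [← hcn, ← pow_succ']; congr 1; omega
  rw [hpow] at h1
  generalize const H ^ (V(H).ncard - 1) = Q at *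
  have h5 : (V(H).ncard : ℝ) * (Q + (const H - 1)) ≤ n * (Q + (const H - 1)) :=
    mul_le_mul_of_nonneg_right hNn (by linarith)
  have h6 : n * (Q + (const H - 1)) < n * (2 * Q) := mul_lt_mul_of_pos_left (by linarith)
    (by linarith)
  have h7 : 0 ≤ (n - 2) * (n * Q) :=
    mul_nonneg (by linarith) (mul_nonneg (by linarith) (by linarith))
  linarith

/-- The point whose coordinates are constant on nodes and on each bundle. -/
noncomputable def center (H : Graph γ β) : Coord H :=
  Sum.elim (fun _ => const H ^ V(H).ncard / V(H).ncard)
    (fun e => ∑ᶠ B ∈ {B ∈ bundles H | (e : β) ∈ B}, const H ^ B.ncard / B.ncard)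

omit [Finite E(H)] in
theorem nodeSum_center {W : Set γ} (hW : W ⊆ V(H)) :
    nodeSum (center H) W = W.ncard * (const H ^ V(H).ncard / V(H).ncard) := by
  classical
  have := Fintype.ofFinite V(H)
  rw [nodeSum_eq_sum]
  simp only [center, Sum.elim_inl]
  rw [← Finset.sum_filter, Finset.sum_const, nsmul_eq_mul]
  congr 2
  rw [← Set.ncard_coe_finset, ← Set.ncard_image_of_injective _ Subtype.val_injective]
  congr 1
  ext v
  simp only [Finset.coe_filter, Finset.mem_univ, true_and, Set.mem_image, Set.mem_ofPred_eq,
    Subtype.exists, exists_and_left, exists_prop, exists_eq_right_right]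
  exact ⟨fun h => h.1, fun h => ⟨h, hW h⟩⟩

omit [Finite V(H)] in
theorem edgeSum_center {B F : Set β} (hB : B ∈ bundles H) :
    edgeSum (center H) (B ∩ F) = (B ∩ F).ncard * (const H ^ B.ncard / B.ncard) := by
  classical
  have := Fintype.ofFinite E(H)
  rw [edgeSum_eq_sum]
  refine (Finset.sum_congr rfl (g := fun e : E(H) =>
    if (e : β) ∈ B ∩ F then const H ^ B.ncard / B.ncard else 0) fun e _ => ?_).trans ?_
  · by_cases he : (e : β) ∈ B ∩ F
    · have hset : {B' ∈ bundles H | (e : β) ∈ B'} = {B} := by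
        ext B'
        simp only [Set.mem_ofPred_eq, Set.mem_singleton_iff]
        exact ⟨fun h => bundle_unique h.1 hB h.2 he.1, fun h => h ▸ ⟨hB, he.1⟩⟩
      simp only [he, if_true, center, Sum.elim_inr]
      rw [hset, finsum_mem_singleton]
    · simp only [he, if_false]
  rw [← Finset.sum_filter, Finset.sum_const, nsmul_eq_mul]
  congr 2
  rw [← Set.ncard_coe_finset, ← Set.ncard_image_of_injective _ Subtype.val_injective]
  congr 1
  ext e
  simp only [Finset.coe_filter, Finset.mem_univ, true_and, Set.mem_image, Set.mem_ofPred_eq,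
    Subtype.exists, exists_and_left, exists_prop, exists_eq_right_right]
  exact ⟨fun h => h.1, fun h => ⟨h, bundle_subset hB h.1⟩⟩

theorem center_mem [H.Loopless] (hV : V(H).Nonempty) : center H ∈ tubePolyhedron H Z := by
  have hVf : V(H).Finite := Set.toFinite _
  have hEf : E(H).Finite := Set.toFinite _
  have hN : 1 ≤ V(H).ncard := (Set.ncard_pos hVf).2 hV
  refine ⟨⟨?_, fun B hB => ?_⟩, fun s hs => ?_⟩
  · rw [nodeSum_center subset_rfl]
    have : (V(H).ncard : ℝ) ≠ 0 := by exact_mod_cast (by omega)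
    field_simp
  · have := edgeSum_center hB (F := Set.univ)
    rw [Set.inter_univ] at this
    rw [this]
    have : (B.ncard : ℝ) ≠ 0 := by
      exact_mod_cast ((Set.ncard_pos (hEf.subset (bundle_subset hB))).2 (bundle_nonempty hB)).ne'
    field_simp
  · have hsH := hs.1.lt.le
    have hsub := tubeSum_sub_bound hsH (center H)
    have hq := corank_le hsH hs.1.connected.1
    have hBn : ∀ B ∈ bundles H, B.ncard ≤ V(H).ncard + E(H).ncard := fun B hB =>
      (Set.ncard_le_ncard (bundle_subset hB) hEf).trans (Nat.le_add_left _ _)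
    have hBle : ∀ B ∈ bundles H, (B ∩ E(s)).ncard ≤ B.ncard := fun B hB =>
      Set.ncard_le_ncard Set.inter_subset_left (hEf.subset (bundle_subset hB))
    have hterm : ∀ B ∈ bundleFinset H,
        0 ≤ edgeSum (center H) (B ∩ E(s)) - pospow (const H) (B ∩ E(s)).ncard := by
      intro B hB
      have hB := mem_bundleFinset.1 hB
      rw [edgeSum_center hB]
      have := pospow_le_mul_div (hBle B hB) (hBn B hB)
      rw [const]; linarith
    have hsum := Finset.sum_nonneg hterm
    rw [tubeSumL_apply]
    rw [excess, nodeSum_center hsH.vertexSet_mono] at hsub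
    have hs1 : 1 ≤ V(s).ncard :=
      (Set.ncard_pos (hVf.subset hsH.vertexSet_mono)).2 hs.1.connected.1
    -- The margin that covers the corank comes from a bundle contained only in part if `s` has all
    -- nodes, and from the missing nodes otherwise.
    by_cases hVs : V(H) ⊆ V(s)
    · have hVeq := hsH.vertexSet_mono.antisymm hVs
      obtain ⟨e, he, hes⟩ : ∃ e ∈ E(H), e ∉ E(s) := by
        by_contra! h
        exact hs.1.lt.not_ge ((le_iff_of_le_le le_rfl hsH).2 ⟨hVs, h⟩)
      obtain ⟨a, b, hab⟩ := H.exists_isLink_of_mem_edgeSet he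
      have hB : {f | H.IsLink f a b} ∈ bundles H := ⟨a, b, hab.ne, hab.adj, rfl⟩
      have hne := adj_of_isTube hs.1 (hVs hab.left_mem) (hVs hab.right_mem) hab.adj
      have hBf := hEf.subset (bundle_subset hB)
      have hlt : ({f | H.IsLink f a b} ∩ E(s)).ncard < {f | H.IsLink f a b}.ncard :=
        Set.ncard_lt_ncard ⟨Set.inter_subset_left, fun h => hes (h hab).2⟩ hBf
      have hpos := (Set.ncard_pos (hBf.subset Set.inter_subset_left)).2 hne
      have h1 := Finset.single_le_sum hterm (mem_bundleFinset.2 hB)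
      rw [edgeSum_center hB, pospow, if_neg hpos.ne'] at h1
      have h2 := pow_add_le_mul_div hpos hlt (hBn _ hB)
      have h3 : const H = ((V(H).ncard + E(H).ncard : ℕ) : ℝ) ^ 2 := rfl
      rw [← h3] at h2
      rw [hVeq] at hsub
      have h4 : (V(H).ncard : ℝ) * (const H ^ V(H).ncard / V(H).ncard) = const H ^ V(H).ncard := by
        have : (V(H).ncard : ℝ) ≠ 0 := by exact_mod_cast (by omega)
        field_simp
      linarith
    · have hlt := Set.ncard_lt_ncard ⟨hsH.vertexSet_mono, hVs⟩ hVf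
      have h2 := pow_add_le_mul_div hs1 hlt (Nat.le_add_right _ E(H).ncard)
      have h3 : const H = ((V(H).ncard + E(H).ncard : ℕ) : ℝ) ^ 2 := rfl
      rw [← h3] at h2
      linarith

/-- Every tubing by proper tubes is the set of tight tubes at some point. -/
theorem exists_tight_eq_tubing [H.Loopless] (hV : V(H).Nonempty) (hZp : Pendant H Z)
    {T : Set (Graph γ β)} (hT : IsTubing H T) (hTp : T ⊆ properTubes H Z) :
    ∃ x ∈ tubePolyhedron H Z, tight (properTubes H Z) (tubeSumL H) (bound H) x = T := by
  refine exists_tight_eq isTranslate_affineSpan (properTubes_finite H Z)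
    (𝒯 := {T | IsTubing H T ∧ T ⊆ properTubes H Z}) (fun T hT => hT.2) ?_
    ⟨_, center_mem hV⟩ (fun x hx => ⟨isTubing_tight hV hZp hx, fun s hs => hs.1⟩) ?_ ?_ ⟨hT, hTp⟩
  · intro T hT T' hT'
    exact ⟨⟨fun t ht => hT.1.isTube t (hT' ht), hT.1.compatible.mono hT', fun h =>
      hT.1.not_all_components fun K hK => hT' (h K hK)⟩, hT'.trans hT.2⟩
  · intro T hT g
    exact exists_mem_lineal_tubeSum_eq hT.1 g
  · intro T' hT' T hTT' t ht hins
    exact exists_mem_lineal_tubeSum_neg hT'.1 hTT' ht hins.1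

end Realization

/-! ### Tubes and tubings of `G` and of its loop-free graph. -/

section LoopFree

variable {α β : Type*} {G s t K : Graph α β}

@[simp] theorem inl_mem_loopFree {v : α} : Sum.inl v ∈ V(loopFree G) ↔ v ∈ V(G) := by
  simp [loopFree]

@[simp] theorem inr_mem_loopFree {v : α} : Sum.inr v ∈ V(loopFree G) ↔ ∃ e, G.IsLoopAt e v := by
  simp [loopFree]

@[simp] theorem loopFree_isLink_inl_inl {e : β} {x y : α} :
    (loopFree G).IsLink e (Sum.inl x) (Sum.inl y) ↔ x ≠ y ∧ G.IsLink e x y := by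
  constructor
  · rintro (⟨a, b, hne, h, ha, hb⟩ | ⟨a, h, ⟨ha, hb⟩ | ⟨ha, hb⟩⟩)
    · obtain rfl := Sum.inl_injective ha
      obtain rfl := Sum.inl_injective hb
      exact ⟨hne, h⟩
    · exact absurd hb (by simp)
    · exact absurd ha (by simp)
  · rintro ⟨hne, h⟩
    exact Or.inl ⟨x, y, hne, h, rfl, rfl⟩

@[simp] theorem loopFree_isLink_inl_inr {e : β} {x y : α} :
    (loopFree G).IsLink e (Sum.inl x) (Sum.inr y) ↔ x = y ∧ G.IsLoopAt e x := by
  constructor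
  · rintro (⟨a, b, hne, h, ha, hb⟩ | ⟨a, h, ⟨ha, hb⟩ | ⟨ha, hb⟩⟩)
    · exact absurd hb (by simp)
    · obtain rfl := Sum.inl_injective ha
      obtain rfl := Sum.inr_injective hb
      exact ⟨rfl, h⟩
    · exact absurd ha (by simp)
  · rintro ⟨rfl, h⟩
    exact Or.inr ⟨x, h, Or.inl ⟨rfl, rfl⟩⟩

@[simp] theorem loopFree_isLink_inr_inl {e : β} {x y : α} :
    (loopFree G).IsLink e (Sum.inr y) (Sum.inl x) ↔ x = y ∧ G.IsLoopAt e x := by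
  rw [Graph.isLink_comm, loopFree_isLink_inl_inr]

@[simp] theorem loopFree_isLink_inr_inr {e : β} {x y : α} :
    ¬ (loopFree G).IsLink e (Sum.inr x) (Sum.inr y) := by
  rintro (⟨a, b, hne, h, ha, hb⟩ | ⟨a, h, ⟨ha, hb⟩ | ⟨ha, hb⟩⟩) <;> simp_all

theorem loopFree_isLink_of_isLink {e : β} {x y : α} (h : G.IsLink e x y) :
    ∃ b, (loopFree G).IsLink e (Sum.inl x) b := by
  by_cases hxy : x = y
  · subst hxy; exact ⟨Sum.inr x, by simpa using h⟩
  · exact ⟨Sum.inl y, by simp [hxy, h]⟩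

@[simp] theorem edgeSet_loopFree : E(loopFree G) = E(G) := by
  ext e
  constructor
  · intro he
    obtain ⟨a, b, h⟩ := Graph.exists_isLink_of_mem_edgeSet he
    rcases a with x | x <;> rcases b with y | y
    · exact (loopFree_isLink_inl_inl.1 h).2.edge_mem
    · exact (loopFree_isLink_inl_inr.1 h).2.edge_mem
    · exact (loopFree_isLink_inr_inl.1 h).2.edge_mem
    · exact absurd h loopFree_isLink_inr_inr
  · intro he
    obtain ⟨x, y, h⟩ := G.exists_isLink_of_mem_edgeSet he
    obtain ⟨b, hb⟩ := loopFree_isLink_of_isLink h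
    exact hb.edge_mem

instance loopless_loopFree (G : Graph α β) : (loopFree G).Loopless := by
  rw [Graph.loopless_iff_forall_ne_of_adj]
  rintro (x | x) b ⟨e, h⟩ rfl
  · exact (loopFree_isLink_inl_inl.1 h).1 rfl
  · exact loopFree_isLink_inr_inr h

/-- The ghost nodes of the loop-free graph of `G`. -/
def ghosts (G : Graph α β) : Set (α ⊕ α) := {z | ∃ v e, G.IsLoopAt e v ∧ z = Sum.inr v}

theorem pendant_ghosts (G : Graph α β) : Pendant (loopFree G) (ghosts G) := by
  rintro _ ⟨v, e, he, rfl⟩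
  refine ⟨Sum.inl v, ⟨e, by simpa using he⟩, ?_⟩
  rintro (w | w) ⟨f, hf⟩
  · rw [(loopFree_isLink_inr_inl.1 hf).1]
  · exact absurd hf loopFree_isLink_inr_inr

theorem loopFree_le_loopFree : loopFree s ≤ loopFree t ↔ s ≤ t := by
  constructor
  · intro h
    refine ⟨fun v hv => ?_, fun e x y hxy => ?_⟩
    · exact inl_mem_loopFree.1 (h.vertexSet_mono (inl_mem_loopFree.2 hv))
    · by_cases hne : x = y
      · subst hne
        have : (loopFree s).IsLink e (Sum.inl x) (Sum.inr x) := by simpa using hxy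
        exact (loopFree_isLink_inl_inr.1 (this.mono h)).2
      · have : (loopFree s).IsLink e (Sum.inl x) (Sum.inl y) := by simp [hne, hxy]
        exact (loopFree_isLink_inl_inl.1 (this.mono h)).2
  · intro h
    refine ⟨?_, ?_⟩
    · rintro (v | v) hv
      · exact inl_mem_loopFree.2 (h.vertexSet_mono (inl_mem_loopFree.1 hv))
      · obtain ⟨e, he⟩ := inr_mem_loopFree.1 hv
        exact inr_mem_loopFree.2 ⟨e, he.mono h⟩
    · rintro e (x | x) (y | y) hxy
      · have := loopFree_isLink_inl_inl.1 hxy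
        exact loopFree_isLink_inl_inl.2 ⟨this.1, this.2.mono h⟩
      · have := loopFree_isLink_inl_inr.1 hxy
        exact loopFree_isLink_inl_inr.2 ⟨this.1, this.2.mono h⟩
      · have := loopFree_isLink_inr_inl.1 hxy
        exact loopFree_isLink_inr_inl.2 ⟨this.1, this.2.mono h⟩
      · exact absurd hxy loopFree_isLink_inr_inr

theorem loopFree_injective : Function.Injective (loopFree : Graph α β → Graph (α ⊕ α) β) :=
  fun _ _ h => le_antisymm (loopFree_le_loopFree.1 h.le) (loopFree_le_loopFree.1 h.ge)

theorem loopFree_lt_loopFree : loopFree s < loopFree t ↔ s < t := by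
  simp only [lt_iff_le_not_ge, loopFree_le_loopFree]

/-- Sending each ghost to its node projects walks to walks. Conversely, loops can be dropped from a
walk, and each ghost hangs from its node. -/
theorem connected_loopFree : Connected (loopFree t) ↔ Connected t := by
  constructor
  · rintro ⟨⟨a, ha⟩, hconn⟩
    have hproj : ∀ a b, Relation.ReflTransGen (loopFree t).Adj a b →
        Relation.ReflTransGen t.Adj (Sum.elim id id a) (Sum.elim id id b) := by
      intro a b hab
      induction hab with
      | refl => exact .refl
      | @tail b c _ h ih =>
        obtain ⟨e, he⟩ := h
        rcases b with x | x <;> rcases c with y | y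
        · exact ih.tail ⟨e, (loopFree_isLink_inl_inl.1 he).2⟩
        · obtain rfl := (loopFree_isLink_inl_inr.1 he).1
          exact ih
        · obtain rfl := (loopFree_isLink_inr_inl.1 he).1
          exact ih
        · exact absurd he loopFree_isLink_inr_inr
    refine ⟨?_, fun x hx y hy => hproj _ _ (hconn (Sum.inl x) (by simpa) (Sum.inl y) (by simpa))⟩
    rcases a with v | v
    · exact ⟨v, inl_mem_loopFree.1 ha⟩
    · obtain ⟨e, he⟩ := inr_mem_loopFree.1 ha
      exact ⟨v, he.vertex_mem⟩
  · rintro ⟨⟨a, ha⟩, hconn⟩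
    have hlift : ∀ y, Relation.ReflTransGen t.Adj a y →
        Relation.ReflTransGen (loopFree t).Adj (Sum.inl a) (Sum.inl y) := by
      intro y hy
      induction hy with
      | refl => exact .refl
      | @tail b c _ h ih =>
        obtain ⟨e, he⟩ := h
        by_cases hbc : b = c
        · rwa [← hbc]
        · exact ih.tail ⟨e, by simp [hbc, he]⟩
    have hreach : ∀ b ∈ V(loopFree t),
        Relation.ReflTransGen (loopFree t).Adj (Sum.inl a) b := by
      rintro (v | v) hv
      · exact hlift v (hconn a ha v (inl_mem_loopFree.1 hv))
      · obtain ⟨e, he⟩ := inr_mem_loopFree.1 hv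
        exact (hlift v (hconn a ha v he.vertex_mem)).tail ⟨e, by simpa using he⟩
    exact ⟨⟨Sum.inl a, by simpa⟩, fun x hx y hy => (reach_symm (hreach x hx)).trans (hreach y hy)⟩

theorem loopFree_mem_properTubes (ht : IsTube G t) :
    loopFree t ∈ properTubes (loopFree G) (ghosts G) := by
  refine ⟨⟨loopFree_lt_loopFree.2 ht.lt, connected_loopFree.2 ht.connected, ?_⟩, ?_⟩
  · rintro (x | x) hx (y | y) hy hne ⟨e, h⟩
    · have h := loopFree_isLink_inl_inl.1 h
      obtain ⟨f, hf⟩ := ht.adj x (inl_mem_loopFree.1 hx) y (inl_mem_loopFree.1 hy) h.1 ⟨e, h.2⟩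
      exact ⟨f, by simp [h.1, hf]⟩
    · obtain rfl := (loopFree_isLink_inl_inr.1 h).1
      obtain ⟨f, hf⟩ := inr_mem_loopFree.1 hy
      exact ⟨f, by simpa using hf⟩
    · obtain rfl := (loopFree_isLink_inr_inl.1 h).1
      obtain ⟨f, hf⟩ := inr_mem_loopFree.1 hx
      exact ⟨f, by simpa using hf⟩
    · exact absurd h loopFree_isLink_inr_inr
  · rintro _ ⟨v, -, -, rfl⟩ h
    obtain ⟨a, ha⟩ := ht.connected.1
    have : Sum.inl a ∈ V(loopFree t) := inl_mem_loopFree.2 ha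
    rw [h] at this
    simp at this

/-- Together with `loopFree_mem_properTubes` and `loopFree_injective`, this makes `loopFree` a
bijection from the tubes of `G` onto the proper tubes. -/
theorem exists_loopFree_eq {s : Graph (α ⊕ α) β}
    (hs : s ∈ properTubes (loopFree G) (ghosts G)) : ∃ t, IsTube G t ∧ loopFree t = s := by
  obtain ⟨hst, hsZ⟩ := hs
  have hle := hst.lt.le
  let t : Graph α β :=
    { vertexSet := {v | Sum.inl v ∈ V(s)}
      IsLink := fun e x y => G.IsLink e x y ∧ e ∈ E(s)
      isLink_symm := fun e _ => ⟨fun x y h => ⟨h.1.symm, h.2⟩⟩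
      eq_or_eq_of_isLink_of_isLink := fun e x y v w h h' => h.1.left_eq_or_eq h'.1
      left_mem_of_isLink := fun e x y h => by
        obtain ⟨b, hb⟩ := loopFree_isLink_of_isLink h.1
        exact (mem_of_isLink_of_edge_mem hle hb h.2).1 }
  have htG : t ≤ G :=
    ⟨fun v hv => inl_mem_loopFree.1 (hle.vertexSet_mono hv), fun e x y h => h.1⟩
  have hts : loopFree t = s := by
    refine (Graph.Compatible.of_le_le (loopFree_le_loopFree.2 htG) hle).ext ?_ ?_
    · ext (v | v)
      · rw [inl_mem_loopFree]; rfl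
      · rw [inr_mem_loopFree]
        constructor
        · rintro ⟨e, he, hes⟩
          exact (mem_of_isLink_of_edge_mem hle
            (loopFree_isLink_inr_inl.2 ⟨rfl, he⟩) hes).1
        · intro hv
          obtain ⟨e, he⟩ := inr_mem_loopFree.1 (hle.vertexSet_mono hv)
          -- A ghost of `s` is not alone, so by connectedness `s` contains an edge at it, which is a
          -- loop of `t` at `v`.
          have : ∃ y ∈ V(s), y ≠ Sum.inr v := by
            by_contra! h
            exact hsZ _ ⟨v, e, he, rfl⟩ (Set.eq_singleton_iff_unique_mem.2 ⟨hv, h⟩)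
          obtain ⟨y, hy, hyv⟩ := this
          obtain ⟨a, ha, b, hb, f, hf⟩ :=
            hst.connected.exists_adj (W := {Sum.inr v}) hv rfl hy hyv
          obtain rfl : a = Sum.inr v := ha
          have hfG := hf.mono hle
          rcases b with w | w
          · obtain ⟨rfl, hloop⟩ := loopFree_isLink_inr_inl.1 hfG
            exact ⟨f, hloop, hf.edge_mem⟩
          · exact absurd hfG loopFree_isLink_inr_inr
    · rw [edgeSet_loopFree]
      ext e
      constructor
      · intro he
        obtain ⟨x, y, h⟩ := Graph.exists_isLink_of_mem_edgeSet he
        exact h.2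
      · intro he
        have : e ∈ E(G) := by
          rw [← edgeSet_loopFree]; exact hle.edgeSet_mono he
        obtain ⟨x, y, h⟩ := G.exists_isLink_of_mem_edgeSet this
        exact Graph.IsLink.edge_mem (G := t) (x := x) (y := y) ⟨h, he⟩
  refine ⟨t, ⟨loopFree_lt_loopFree.1 (hts ▸ hst.lt), connected_loopFree.1 (hts ▸ hst.connected),
    fun x hx y hy hne ⟨e, he⟩ => ?_⟩, hts⟩
  obtain ⟨f, hf⟩ := hst.adj (Sum.inl x) hx (Sum.inl y) hy (by simpa)
    ⟨e, loopFree_isLink_inl_inl.2 ⟨hne, he⟩⟩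
  exact ⟨f, (loopFree_isLink_inl_inl.1 (hf.mono hle)).2, hf.edge_mem⟩

theorem tubesCompatible_loopFree :
    TubesCompatible (loopFree G) (loopFree s) (loopFree t) ↔ TubesCompatible G s t := by
  unfold TubesCompatible
  rw [loopFree_lt_loopFree, loopFree_lt_loopFree]
  refine or_congr Iff.rfl (or_congr Iff.rfl ⟨?_, ?_⟩)
  · rintro ⟨hd, hadj⟩
    have hd' : Disjoint V(s) V(t) := Set.disjoint_left.2 fun v hv hv' =>
      Set.disjoint_left.1 hd (inl_mem_loopFree.2 hv) (inl_mem_loopFree.2 hv')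
    refine ⟨hd', fun x hx y hy ⟨e, he⟩ => ?_⟩
    refine hadj (Sum.inl x) (inl_mem_loopFree.2 hx) (Sum.inl y) (inl_mem_loopFree.2 hy)
      ⟨e, loopFree_isLink_inl_inl.2 ⟨?_, he⟩⟩
    rintro rfl
    exact Set.disjoint_left.1 hd' hx hy
  · rintro ⟨hd, hadj⟩
    have hnode : ∀ r : Graph α β, ∀ v, Sum.inr v ∈ V(loopFree r) → v ∈ V(r) := fun r v hv => by
      obtain ⟨e, he⟩ := inr_mem_loopFree.1 hv
      exact he.vertex_mem
    refine ⟨Set.disjoint_left.2 ?_, ?_⟩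
    · rintro (v | v) hv hv'
      · exact Set.disjoint_left.1 hd (inl_mem_loopFree.1 hv) (inl_mem_loopFree.1 hv')
      · exact Set.disjoint_left.1 hd (hnode s v hv) (hnode t v hv')
    · rintro (x | x) hx (y | y) hy ⟨e, he⟩
      · exact hadj x (inl_mem_loopFree.1 hx) y (inl_mem_loopFree.1 hy)
          ⟨e, (loopFree_isLink_inl_inl.1 he).2⟩
      · obtain rfl := (loopFree_isLink_inl_inr.1 he).1
        exact Set.disjoint_left.1 hd (inl_mem_loopFree.1 hx) (hnode t x hy)
      · obtain rfl := (loopFree_isLink_inr_inl.1 he).1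
        exact Set.disjoint_left.1 hd (hnode s y hx) (inl_mem_loopFree.1 hy)
      · exact loopFree_isLink_inr_inr he

theorem loopFree_componentOf {a : α} (ha : a ∈ V(G)) :
    loopFree (componentOf G a) = componentOf (loopFree G) (Sum.inl a) := by
  have hK := isComponent_componentOf ha
  have hle := loopFree_le_loopFree.2 hK.le
  have haK : Sum.inl a ∈ V(loopFree (componentOf G a)) := inl_mem_loopFree.2 .refl
  refine le_antisymm ((connected_loopFree.2 hK.connected).le_componentOf hle haK) ?_
  have hV : V(componentOf (loopFree G) (Sum.inl a)) ⊆ V(loopFree (componentOf G a)) := by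
    intro b hb
    refine reach_closed (H := loopFree G) ?_ haK hb
    rintro (x | x) hx (y | y) ⟨e, he⟩
    · exact inl_mem_loopFree.2 (hK.mem_of_adj (inl_mem_loopFree.1 hx)
        ⟨e, (loopFree_isLink_inl_inl.1 he).2⟩)
    · obtain ⟨rfl, hloop⟩ := loopFree_isLink_inl_inr.1 he
      have hx := inl_mem_loopFree.1 hx
      exact inr_mem_loopFree.2 ⟨e, hloop, hx, hx⟩
    · obtain ⟨rfl, -⟩ := loopFree_isLink_inr_inl.1 he
      obtain ⟨f, hf⟩ := inr_mem_loopFree.1 hx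
      exact inl_mem_loopFree.2 hf.vertex_mem
    · exact absurd he loopFree_isLink_inr_inr
  have haG : Sum.inl a ∈ V(loopFree G) := inl_mem_loopFree.2 ha
  refine (le_iff_of_le_le (componentOf_le haG) hle).2 ⟨hV, fun e he => ?_⟩
  obtain ⟨x, y, hxy⟩ := Graph.exists_isLink_of_mem_edgeSet he
  have hx := hV hxy.left_mem
  have hy := hV hxy.right_mem
  have hxy := hxy.mono (componentOf_le haG)
  rw [edgeSet_loopFree]
  rcases x with x | x <;> rcases y with y | y
  · exact hK.edge_mem (inl_mem_loopFree.1 hx) (loopFree_isLink_inl_inl.1 hxy).2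
  · exact hK.edge_mem (inl_mem_loopFree.1 hx) (loopFree_isLink_inl_inr.1 hxy).2
  · exact hK.edge_mem (inl_mem_loopFree.1 hy) (loopFree_isLink_inr_inl.1 hxy).2
  · exact absurd hxy loopFree_isLink_inr_inr

theorem isTubing_image_loopFree {T : Set (Graph α β)} (hT : ∀ t ∈ T, IsTube G t) :
    IsTubing (loopFree G) (loopFree '' T) ↔ IsTubing G T := by
  have hcomp : (∀ K, IsComponent (loopFree G) K → K ∈ loopFree '' T) ↔
      ∀ K, IsComponent G K → K ∈ T := by
    constructor
    · intro h K hK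
      obtain ⟨a, ha⟩ := hK.connected.1
      have haG := hK.le.vertexSet_mono ha
      obtain ⟨t, ht, htK⟩ := h _ (isComponent_componentOf (inl_mem_loopFree.2 haG))
      rw [← loopFree_componentOf haG, ← hK.eq_componentOf ha] at htK
      exact loopFree_injective htK ▸ ht
    · intro h K hK
      obtain ⟨a, ha⟩ : ∃ a, Sum.inl a ∈ V(K) := by
        obtain ⟨v | v, hv⟩ := hK.connected.1
        · exact ⟨v, hv⟩
        · obtain ⟨e, he⟩ := inr_mem_loopFree.1 (hK.le.vertexSet_mono hv)
          exact ⟨v, hK.mem_of_adj hv ⟨e, loopFree_isLink_inr_inl.2 ⟨rfl, he⟩⟩⟩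
      have haG := inl_mem_loopFree.1 (hK.le.vertexSet_mono ha)
      rw [hK.eq_componentOf ha, ← loopFree_componentOf haG]
      exact Set.mem_image_of_mem _ (h _ (isComponent_componentOf haG))
  constructor
  · intro h
    refine ⟨hT, fun s hs t ht hne => ?_, fun hall => h.not_all_components (hcomp.2 hall)⟩
    exact tubesCompatible_loopFree.1 (h.compatible (Set.mem_image_of_mem _ hs)
      (Set.mem_image_of_mem _ ht) (loopFree_injective.ne hne))
  · intro h
    refine ⟨?_, ?_, fun hall => h.not_all_components (hcomp.1 hall)⟩
    · rintro _ ⟨t, ht, rfl⟩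
      exact (loopFree_mem_properTubes (hT t ht)).1
    · rintro _ ⟨s, hs, rfl⟩ _ ⟨t, ht, rfl⟩ hne
      exact tubesCompatible_loopFree.2 (h.compatible hs ht fun h => hne (h ▸ rfl))

theorem finite_vertexSet_loopFree (hV : V(G).Finite) : V(loopFree G).Finite := by
  refine ((hV.image Sum.inl).union (hV.image Sum.inr)).subset ?_
  rintro (v | v) hv
  · exact Or.inl ⟨v, inl_mem_loopFree.1 hv, rfl⟩
  · obtain ⟨e, he⟩ := inr_mem_loopFree.1 hv
    exact Or.inr ⟨v, he.vertex_mem, rfl⟩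

variable [Finite V(loopFree G)] [Finite E(loopFree G)]

theorem associahedron_eq (G : Graph α β) [Finite V(loopFree G)] [Finite E(loopFree G)] :
    associahedron G = tubePolyhedron (loopFree G) (ghosts G) := by
  ext x
  constructor
  · rintro ⟨h1, h2, h3⟩
    refine ⟨⟨h1, h2⟩, fun s hs => h3 s hs.1 fun v hv => ?_⟩
    have hle := hs.1.lt.le
    obtain ⟨e, he⟩ := inr_mem_loopFree.1 (hle.vertexSet_mono
      (hv ▸ Set.mem_singleton _ : Sum.inr v ∈ V(s)))
    exact hs.2 _ ⟨v, e, he, rfl⟩ hv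
  · rintro ⟨⟨h1, h2⟩, h3⟩
    refine ⟨h1, h2, fun s hs hv => h3 s ⟨hs, ?_⟩⟩
    rintro _ ⟨v, -, -, rfl⟩
    exact hv v

theorem faceOf_eq {T : Set (Graph α β)} (hT : ∀ t ∈ T, IsTube G t) :
    faceOf G T = {x ∈ tubePolyhedron (loopFree G) (ghosts G) |
      loopFree '' T ⊆ tight (properTubes (loopFree G) (ghosts G)) (tubeSumL (loopFree G))
        (bound (loopFree G)) x} := by
  ext x
  rw [faceOf, associahedron_eq]
  refine and_congr Iff.rfl ⟨?_, ?_⟩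
  · rintro h _ ⟨t, ht, rfl⟩
    exact ⟨loopFree_mem_properTubes (hT t ht), h t ht⟩
  · intro h t ht
    exact (h (Set.mem_image_of_mem _ ht)).2

end LoopFree

/-! ### Recession directions. -/

section Compactness

variable {α β : Type*} {G t : Graph α β}

/-- A set in a finite-dimensional space is bounded if no nonzero direction increases all the linear
functionals that are bounded below on the set. -/
theorem isBounded_of_recession {E : Type*} [NormedAddCommGroup E] [NormedSpace ℝ E]
    [FiniteDimensional ℝ E] {F : Set E}
    (h : ∀ d : E, (∀ l : E →ₗ[ℝ] ℝ, (∃ b, ∀ x ∈ F, b ≤ l x) → 0 ≤ l d) → d = 0) :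
    Bornology.IsBounded F := by
  by_contra hF
  rw [isBounded_iff_forall_norm_le] at hF
  push Not at hF
  -- Normalise a sequence tending to infinity. A limit `d` of the unit vectors satisfies `0 ≤ l d`,
  -- because lower bounds divided by the norms tend to zero.
  choose u huF hu using fun n : ℕ => hF (n + 1)
  have hpos : ∀ n, 0 < ‖u n‖ := fun n => lt_trans (by positivity) (hu n)
  have hmem : ∀ n, ‖u n‖⁻¹ • u n ∈ Metric.sphere (0 : E) 1 := fun n => by
    rw [mem_sphere_zero_iff_norm, norm_smul, norm_inv, norm_norm, inv_mul_cancel₀ (hpos n).ne']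
  have : ProperSpace E := FiniteDimensional.proper ℝ E
  obtain ⟨d, hd, φ, hφ, hlim⟩ := (isCompact_sphere (0 : E) 1).tendsto_subseq hmem
  have hinv : Filter.Tendsto (fun n => ‖u (φ n)‖⁻¹) Filter.atTop (nhds 0) := by
    refine Filter.Tendsto.inv_tendsto_atTop ?_
    refine Filter.tendsto_atTop_mono (f := fun n : ℕ => (n : ℝ)) (fun n => ?_)
      tendsto_natCast_atTop_atTop
    have h1 : (n : ℝ) ≤ φ n := by exact_mod_cast hφ.id_le n
    linarith [hu (φ n)]
  have hd0 : d = 0 := by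
    refine h d fun l hl => ?_
    obtain ⟨b, hb⟩ := hl
    have h1 : Filter.Tendsto (fun n => l (‖u (φ n)‖⁻¹ • u (φ n))) Filter.atTop (nhds (l d)) :=
      (l.continuous_of_finiteDimensional.tendsto d).comp hlim
    have h2 : Filter.Tendsto (fun n => ‖u (φ n)‖⁻¹ * b) Filter.atTop (nhds 0) := by
      simpa using hinv.mul_const b
    refine le_of_tendsto_of_tendsto' h2 h1 fun n => ?_
    rw [map_smul, smul_eq_mul]
    exact mul_le_mul_of_nonneg_left (hb _ (huF _)) (inv_nonneg.2 (norm_nonneg _))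
  rw [hd0] at hd
  simp at hd

/-- The node `v` and its ghost node. -/
def ghostPair (v : α) : Set (α ⊕ α) := {Sum.inl v, Sum.inr v}

theorem nodeSum_eq_sum_ghostPair [Finite V(loopFree G)] (hV : V(G).Finite)
    (x : Coord (loopFree G)) (W : Set (α ⊕ α)) :
    nodeSum x W = ∑ v ∈ hV.toFinset, nodeSum x (W ∩ ghostPair v) := by
  classical
  have := Fintype.ofFinite V(loopFree G)
  simp only [nodeSum_eq_sum]
  rw [Finset.sum_comm]
  refine Finset.sum_congr rfl fun a _ => ?_
  obtain ⟨v, hv, hva⟩ : ∃ v ∈ V(G), ∀ w, (a : α ⊕ α) ∈ ghostPair w ↔ w = v := by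
    obtain ⟨a | a, ha⟩ := a
    · exact ⟨a, inl_mem_loopFree.1 ha, fun w => by simp [ghostPair, eq_comm]⟩
    · obtain ⟨e, he⟩ := inr_mem_loopFree.1 ha
      exact ⟨a, he.vertex_mem, fun w => by simp [ghostPair, eq_comm]⟩
  rw [Finset.sum_eq_single v]
  · simp [hva]
  · intro w _ hw
    rw [if_neg]
    rintro ⟨-, h⟩
    exact hw ((hva w).1 h)
  · intro h; exact absurd (hV.mem_toFinset.2 hv) h

variable [Finite V(loopFree G)] [Finite E(loopFree G)]

omit [Finite E(loopFree G)] in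
theorem nodeSum_singleton (x : Coord (loopFree G)) (a : V(loopFree G)) :
    nodeSum x {(a : α ⊕ α)} = x (Sum.inl a) := by
  classical
  have := Fintype.ofFinite V(loopFree G)
  rw [nodeSum_eq_sum, Finset.sum_eq_single a] <;> simp +contextual [Subtype.ext_iff]

omit [Finite V(loopFree G)] in
theorem edgeSum_singleton (x : Coord (loopFree G)) (e : E(loopFree G)) :
    edgeSum x {(e : β)} = x (Sum.inr e) := by
  classical
  have := Fintype.ofFinite E(loopFree G)
  rw [edgeSum_eq_sum, Finset.sum_eq_single e] <;> simp +contextual [Subtype.ext_iff]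

theorem edgeSum_eq_zero {d : Coord (loopFree G)} (hd : d ∈ lineal (loopFree G)) {F : Set β}
    (hF : ∀ B ∈ bundles (loopFree G), B ∩ F = ∅ ∨ B ∩ F = B) : edgeSum d F = 0 := by
  rw [edgeSum_eq_sum_bundles]
  refine Finset.sum_eq_zero fun B hB => ?_
  have hB := mem_bundleFinset.1 hB
  rcases hF B hB with h | h <;> rw [h]
  · exact edgeSum_empty d
  · exact hd.2 B hB

/-- A direction of the affine space of the associahedron vanishes if it does not decrease any
tube sum and if, for each loop, it keeps the tube sum of some tube that has no loop at the same
node. -/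
theorem eq_zero_of_recession (hV : V(G).Finite) {d : Coord (loopFree G)}
    (hd : d ∈ lineal (loopFree G)) (htube : ∀ t, IsTube G t → 0 ≤ tubeSum d (loopFree t))
    (hloop : ∀ e v, G.IsLoopAt e v → ∃ t, IsTube G t ∧ v ∈ V(t) ∧ (∀ f, ¬ t.IsLoopAt f v) ∧
      tubeSum d (loopFree t) = 0) : d = 0 := by
  -- The subgraphs tested below may be all of `G`, where the sum is zero by the equations.
  have hsub : ∀ t, t ≤ G → Connected t →
      (∀ x ∈ V(t), ∀ y ∈ V(t), x ≠ y → G.Adj x y → t.Adj x y) → 0 ≤ tubeSum d (loopFree t) := by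
    intro t htG ht hadj
    rcases htG.eq_or_lt with rfl | hlt
    · rw [tubeSum, hd.1, edgeSum_eq_zero hd fun B hB =>
        Or.inr (Set.inter_eq_self_of_subset_left (bundle_subset hB)), add_zero]
    · exact htube t ⟨hlt, ht, hadj⟩
  have hsingle : ∀ v, Connected (G.induce {v}) := fun v => by
    refine ⟨⟨v, rfl⟩, ?_⟩
    rintro x rfl y rfl
    exact .refl
  -- Test a node without its loops.
  have hnode : ∀ v ∈ V(G), 0 ≤ nodeSum d {Sum.inl v} := by
    intro v hv
    have hle : subgraphOn G {v} ∅ ≤ G := subgraphOn_le (by simpa) ∅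
    have hE : E(subgraphOn G {v} (∅ : Set β)) = ∅ := by
      rw [edgeSet_subgraphOn (by rintro e ⟨⟩), Set.empty_inter]
    have h := hsub (subgraphOn G {v} ∅) hle ⟨⟨v, rfl⟩, by rintro x rfl y rfl; exact .refl⟩
      (by rintro x rfl y rfl h; exact absurd rfl h)
    have hVs : V(loopFree (subgraphOn G {v} (∅ : Set β))) = {Sum.inl v} := by
      ext (w | w)
      · simp
      · simp only [inr_mem_loopFree, Set.mem_singleton_iff, reduceCtorEq, iff_false, not_exists]
        intro e he
        have := he.edge_mem
        rw [hE] at this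
        exact this
    rwa [tubeSum, hVs, edgeSet_loopFree, hE, edgeSum_empty, add_zero] at h
  -- Test a node with all its loops, whose bundle sum is zero. The resulting sums are nonnegative
  -- with total zero, so each vanishes.
  have hpair_nonneg : ∀ v ∈ V(G), 0 ≤ nodeSum d (V(loopFree G) ∩ ghostPair v) := by
    intro v hv
    have hle : G.induce {v} ≤ G := Graph.induce_le (by simpa)
    have h := hsub (G.induce {v}) hle (hsingle v) (by rintro x rfl y rfl h; exact absurd rfl h)
    have hVs : V(loopFree (G.induce {v})) = V(loopFree G) ∩ ghostPair v := by
      ext (w | w)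
      · simp only [inl_mem_loopFree, Graph.vertexSet_induce, Set.mem_singleton_iff, ghostPair,
          Set.mem_inter_iff, Set.mem_insert_iff, Sum.inl.injEq, reduceCtorEq, or_false]
        exact ⟨fun h => ⟨h ▸ hv, h⟩, fun h => h.2⟩
      · simp only [inr_mem_loopFree, ghostPair, Set.mem_inter_iff, Set.mem_insert_iff,
          Set.mem_singleton_iff, reduceCtorEq, Sum.inr.injEq, false_or]
        constructor
        · rintro ⟨e, he, hw, -⟩
          exact ⟨⟨e, he⟩, hw⟩
        · rintro ⟨⟨e, he⟩, rfl⟩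
          exact ⟨e, he, rfl, rfl⟩
    rw [tubeSum, hVs, edgeSum_eq_zero hd, add_zero] at h
    · exact h
    · intro B hB
      by_cases hne : B ∩ E(loopFree (G.induce {v})) = ∅
      · exact Or.inl hne
      right
      obtain ⟨e, he, hev⟩ := Set.nonempty_iff_ne_empty.2 hne
      rw [edgeSet_loopFree] at hev
      obtain ⟨x, y, hxy, hx, hy⟩ := Graph.exists_isLink_of_mem_edgeSet hev
      obtain rfl : x = v := hx
      obtain rfl : y = x := hy
      rw [bundle_eq_of_mem hB he (loopFree_isLink_inl_inr.2 ⟨rfl, hxy⟩)]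
      refine Set.inter_eq_self_of_subset_left fun f hf => ?_
      rw [edgeSet_loopFree]
      exact Graph.IsLink.edge_mem (x := y) (y := y) ⟨(loopFree_isLink_inl_inr.1 hf).2, rfl, rfl⟩
  have hpair : ∀ v ∈ V(G), nodeSum d (V(loopFree G) ∩ ghostPair v) = 0 := by
    have h := hd.1
    rw [nodeSum_eq_sum_ghostPair hV, Finset.sum_eq_zero_iff_of_nonneg fun v hv =>
      hpair_nonneg v (hV.mem_toFinset.1 hv)] at h
    exact fun v hv => h v (hV.mem_toFinset.2 hv)
  have hedge_nonneg : ∀ e ∈ E(G), 0 ≤ edgeSum d {e} := by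
    intro e he
    obtain ⟨x, y, hxy⟩ := G.exists_isLink_of_mem_edgeSet he
    obtain ⟨B, hB, heB⟩ := exists_bundle (H := loopFree G) (e := e) (by rwa [edgeSet_loopFree])
    -- On the ends of `e`, keep `e` alone from its bundle and every other bundle in full. All ghosts
    -- at the ends survive, so node sums cancel and only the coordinate of `e` remains.
    set t := subgraphOn G {x, y} ({e} ∪ Bᶜ) with ht
    have htG : t ≤ G := subgraphOn_le
      (by rintro z (rfl | rfl); exacts [hxy.left_mem, hxy.right_mem]) _
    have het : t.IsLink e x y := subgraphOn_isLink.2 ⟨Or.inl rfl, hxy, Or.inl rfl, Or.inr rfl⟩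
    have htc : Connected t := by
      refine ⟨⟨x, Or.inl rfl⟩, ?_⟩
      rintro a (rfl | rfl) b (rfl | rfl)
      exacts [.refl, .single het.adj, .single het.adj.symm, .refl]
    have h := hsub t htG htc (by
      rintro a (rfl | rfl) b (rfl | rfl) hab -
      exacts [absurd rfl hab, het.adj, het.adj.symm, absurd rfl hab])
    have hE : edgeSum d E(loopFree t) = edgeSum d {e} := by
      rw [edgeSum_eq_sum_bundles, Finset.sum_eq_single B]
      · congr 1
        ext f
        constructor
        · rintro ⟨hfB, hf⟩
          rw [edgeSet_loopFree] at hf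
          obtain ⟨a, b, hab⟩ := Graph.exists_isLink_of_mem_edgeSet hf
          rcases (subgraphOn_isLink.1 hab).1 with h | h
          exacts [h, absurd hfB h]
        · rintro rfl
          exact ⟨heB, by rw [edgeSet_loopFree]; exact het.edge_mem⟩
      · intro B' hB' hne
        have hB' := mem_bundleFinset.1 hB'
        by_cases hemp : B' ∩ E(loopFree t) = ∅
        · rw [hemp, edgeSum_empty]
        · obtain ⟨f, hfB, hft⟩ := Set.nonempty_iff_ne_empty.2 hemp
          rw [edgeSet_loopFree] at hft
          obtain ⟨a, b, hab⟩ := Graph.exists_isLink_of_mem_edgeSet hft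
          have hab := (subgraphOn_isLink.1 hab).2
          have hBsub : B' ⊆ E(t) := by
            intro g hg
            have hgB : g ∉ B := fun hgB => hne (bundle_unique hB' hB hg hgB)
            by_cases hloop : a = b
            · subst hloop
              rw [bundle_eq_of_mem hB' hfB (loopFree_isLink_inl_inr.2 ⟨rfl, hab.1⟩)] at hg
              exact Graph.IsLink.edge_mem (subgraphOn_isLink.2
                ⟨Or.inr hgB, (loopFree_isLink_inl_inr.1 hg).2, hab.2⟩)
            · rw [bundle_eq_of_mem hB' hfB (loopFree_isLink_inl_inl.2 ⟨hloop, hab.1⟩)] at hg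
              exact Graph.IsLink.edge_mem (subgraphOn_isLink.2
                ⟨Or.inr hgB, (loopFree_isLink_inl_inl.1 hg).2, hab.2⟩)
          rw [Set.inter_eq_self_of_subset_left (by rwa [edgeSet_loopFree]), hd.2 B' hB']
      · intro h; exact absurd (mem_bundleFinset.2 hB) h
    have hN : nodeSum d V(loopFree t) = 0 := by
      rw [nodeSum_eq_sum_ghostPair hV]
      refine Finset.sum_eq_zero fun v hv => ?_
      by_cases hvt : v ∈ V(t)
      · rw [← hpair v (hV.mem_toFinset.1 hv)]
        congr 1
        ext (w | w)
        · simp only [Set.mem_inter_iff, inl_mem_loopFree, ghostPair, Set.mem_insert_iff,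
            Sum.inl.injEq, Set.mem_singleton_iff, reduceCtorEq, or_false]
          exact ⟨fun h => ⟨htG.vertexSet_mono h.1, h.2⟩, fun h => ⟨h.2 ▸ hvt, h.2⟩⟩
        · simp only [Set.mem_inter_iff, inr_mem_loopFree, ghostPair, Set.mem_insert_iff,
            Sum.inr.injEq, Set.mem_singleton_iff, reduceCtorEq, false_or]
          constructor
          · rintro ⟨⟨f, hf⟩, rfl⟩
            exact ⟨⟨f, hf.mono htG⟩, rfl⟩
          · rintro ⟨⟨f, hf⟩, rfl⟩
            refine ⟨?_, rfl⟩
            by_cases hfB : f ∈ B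
            · refine ⟨e, subgraphOn_isLink.2 ⟨Or.inl rfl, ?_, hvt, hvt⟩⟩
              rw [bundle_eq_of_mem hB hfB (loopFree_isLink_inl_inr.2 ⟨rfl, hf⟩)] at heB
              exact (loopFree_isLink_inl_inr.1 heB).2
            · exact ⟨f, subgraphOn_isLink.2 ⟨Or.inr hfB, hf, hvt, hvt⟩⟩
      · rw [show V(loopFree t) ∩ ghostPair v = ∅ by
          rw [Set.eq_empty_iff_forall_notMem]
          rintro (w | w) ⟨h1, h2⟩
          · simp only [ghostPair, Set.mem_insert_iff, Sum.inl.injEq, Set.mem_singleton_iff,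
              reduceCtorEq, or_false] at h2
            exact hvt (h2 ▸ inl_mem_loopFree.1 h1)
          · simp only [ghostPair, Set.mem_insert_iff, Sum.inr.injEq, Set.mem_singleton_iff,
              reduceCtorEq, false_or] at h2
            obtain ⟨f, hf⟩ := inr_mem_loopFree.1 h1
            exact hvt (h2 ▸ hf.vertex_mem), nodeSum_empty]
    rwa [tubeSum, hN, hE, zero_add] at h
  have hedge : ∀ e : E(loopFree G), d (Sum.inr e) = 0 := by
    classical
    intro e
    obtain ⟨B, hB, heB⟩ := exists_bundle (H := loopFree G) e.2
    have h := hd.2 B hB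
    have := Fintype.ofFinite E(loopFree G)
    rw [edgeSum_eq_sum, Finset.sum_eq_zero_iff_of_nonneg] at h
    · have := h e (Finset.mem_univ e)
      rwa [if_pos heB] at this
    · intro f _
      split_ifs
      · rw [← edgeSum_singleton d f]
        exact hedge_nonneg f (by rw [← edgeSet_loopFree]; exact f.2)
      · exact le_rfl
  have hedge0 : ∀ F, edgeSum d F = 0 := by
    intro F
    simp [edgeSum, hedge]
  -- The tube from `hloop` has sum zero, and this sum splits into nonnegative parts, one of which is
  -- the coordinate of `v` without its ghost.
  have hinl : ∀ v ∈ V(G), nodeSum d {Sum.inl v} = 0 := by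
    intro v hv
    by_cases hl : ∃ e, G.IsLoopAt e v
    · obtain ⟨e, he⟩ := hl
      obtain ⟨t, ht, hvt, hno, h0⟩ := hloop e v he
      have htG := ht.lt.le
      rw [tubeSum, hedge0, add_zero, nodeSum_eq_sum_ghostPair hV] at h0
      have hcase : ∀ w ∈ V(t), (∀ f, ¬ t.IsLoopAt f w) →
          V(loopFree t) ∩ ghostPair w = {Sum.inl w} := by
        intro w hw hno
        ext (z | z)
        · simp only [ghostPair, Set.mem_inter_iff, inl_mem_loopFree, Set.mem_insert_iff,
            Sum.inl.injEq, Set.mem_singleton_iff, reduceCtorEq, or_false]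
          exact ⟨fun h => h.2, fun h => ⟨h ▸ hw, h⟩⟩
        · simp only [ghostPair, Set.mem_inter_iff, inr_mem_loopFree, Set.mem_insert_iff,
            Sum.inr.injEq, Set.mem_singleton_iff, reduceCtorEq, false_or, iff_false, not_and]
          rintro ⟨f, hf⟩ rfl
          exact hno f hf
      rw [Finset.sum_eq_zero_iff_of_nonneg] at h0
      · have := h0 v (hV.mem_toFinset.2 hv)
        rwa [hcase v hvt hno] at this
      · intro w hw
        have hwG := hV.mem_toFinset.1 hw
        by_cases hwt : w ∈ V(t)
        · by_cases hwl : ∀ f, ¬ t.IsLoopAt f w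
          · rw [hcase w hwt hwl]
            exact hnode w hwG
          · push Not at hwl
            obtain ⟨f, hf⟩ := hwl
            refine (hpair w hwG).symm.le.trans_eq ?_
            congr 1
            ext z
            refine and_congr_left fun hz => ?_
            rcases hz with rfl | rfl
            · simp [hwt, hwG]
            · simp only [inr_mem_loopFree]
              exact ⟨fun _ => ⟨f, hf⟩, fun _ => ⟨f, hf.mono htG⟩⟩
        · refine le_of_eq ?_
          rw [show V(loopFree t) ∩ ghostPair w = ∅ by
            rw [Set.eq_empty_iff_forall_notMem]
            rintro z ⟨h1, rfl | rfl⟩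
            · exact hwt (inl_mem_loopFree.1 h1)
            · obtain ⟨f, hf⟩ := inr_mem_loopFree.1 h1
              exact hwt hf.vertex_mem, nodeSum_empty]
    · have := hpair v hv
      rwa [show V(loopFree G) ∩ ghostPair v = {Sum.inl v} by
        ext (z | z)
        · simp only [ghostPair, Set.mem_inter_iff, inl_mem_loopFree, Set.mem_insert_iff,
            Sum.inl.injEq, Set.mem_singleton_iff, reduceCtorEq, or_false]
          exact ⟨fun h => h.2, fun h => ⟨h ▸ hv, h⟩⟩
        · simp only [ghostPair, Set.mem_inter_iff, inr_mem_loopFree, Set.mem_insert_iff,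
            Sum.inr.injEq, Set.mem_singleton_iff, reduceCtorEq, false_or, iff_false, not_and]
          rintro h rfl
          exact hl h] at this
  funext i
  rcases i with ⟨v | v, hv⟩ | e
  · rw [← nodeSum_singleton d ⟨Sum.inl v, hv⟩]
    exact hinl v (inl_mem_loopFree.1 hv)
  · obtain ⟨e, he⟩ := inr_mem_loopFree.1 hv
    have h1 := hpair v he.vertex_mem
    have h2 := nodeSum_union_add_inter d {Sum.inl v} {Sum.inr v}
    rw [show ({Sum.inl v} ∩ {Sum.inr v} : Set (α ⊕ α)) = ∅ by simp, nodeSum_empty,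
      hinl v he.vertex_mem] at h2
    rw [show V(loopFree G) ∩ ghostPair v = {Sum.inl v} ∪ {Sum.inr v} by
      rw [Set.inter_eq_self_of_subset_right]
      · rfl
      · rintro z (rfl | rfl)
        exacts [inl_mem_loopFree.2 he.vertex_mem, hv]] at h1
    rw [← nodeSum_singleton d ⟨Sum.inr v, hv⟩, Pi.zero_apply]
    simp only
    linarith
  · exact hedge e

end Compactness

/-! ### The isomorphism with the face poset and the compact faces. -/

section Faces

variable {α β : Type*} {G : Graph α β} {T T' : Set (Graph α β)}
  [Finite V(loopFree G)] [Finite E(loopFree G)]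

theorem exists_mem_faceOf (hV : V(G).Nonempty) (hT : IsTubing G T) :
    ∃ x ∈ faceOf G T, tight (properTubes (loopFree G) (ghosts G)) (tubeSumL (loopFree G))
      (bound (loopFree G)) x = loopFree '' T := by
  obtain ⟨x, hx, hxT⟩ := exists_tight_eq_tubing (H := loopFree G) (Z := ghosts G)
    (hV.elim fun v hv => ⟨Sum.inl v, inl_mem_loopFree.2 hv⟩) (pendant_ghosts G)
    ((isTubing_image_loopFree hT.isTube).2 hT) (by
      rintro _ ⟨t, ht, rfl⟩
      exact loopFree_mem_properTubes (hT.isTube t ht))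
  exact ⟨x, by rw [faceOf_eq hT.isTube]; exact ⟨hx, hxT.ge⟩, hxT⟩

/-- The forward direction uses a generic point of the face, at which no tube outside `T` is tight.
-/
theorem faceOf_subset_iff (hV : V(G).Nonempty) (hT : IsTubing G T) (hT' : IsTubing G T') :
    faceOf G T ⊆ faceOf G T' ↔ T' ⊆ T := by
  constructor
  · intro h
    obtain ⟨x, hx, hxT⟩ := exists_mem_faceOf hV hT
    have hx' := h hx
    rw [faceOf_eq hT'.isTube] at hx'
    rw [← Set.image_subset_image_iff loopFree_injective, ← hxT]
    exact hx'.2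
  · rintro h x ⟨hx, hxT⟩
    exact ⟨hx, fun t ht => hxT t (h ht)⟩

/-- Minus the sum of the tube sums over `T` exposes the face: it reaches its maximum exactly where
every summand meets its bound. -/
theorem isExposed_faceOf (hT : IsTubing G T) :
    IsExposed ℝ (associahedron G) (faceOf G T) := by
  rintro ⟨x₀, hx₀⟩
  have hfin : (loopFree '' T).Finite := (finite_subgraphs (loopFree G)).subset (by
    rintro _ ⟨t, ht, rfl⟩
    exact loopFree_le_loopFree.2 (hT.isTube t ht).lt.le)
  have hge : ∀ y ∈ associahedron G, ∀ s ∈ hfin.toFinset,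
      bound (loopFree G) s ≤ tubeSum y s := by
    intro y hy s hs
    rw [associahedron_eq] at hy
    obtain ⟨t, ht, rfl⟩ := hfin.mem_toFinset.1 hs
    exact hy.2 _ (loopFree_mem_properTubes (hT.isTube t ht))
  have heq : ∀ x ∈ faceOf G T, ∀ s ∈ hfin.toFinset, tubeSum x s = bound (loopFree G) s := by
    intro x hx s hs
    obtain ⟨t, ht, rfl⟩ := hfin.mem_toFinset.1 hs
    exact hx.2 t ht
  let l : Coord (loopFree G) →ₗ[ℝ] ℝ := -∑ s ∈ hfin.toFinset, tubeSumL (loopFree G) s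
  have hl : ∀ x, LinearMap.toContinuousLinearMap l x = -∑ s ∈ hfin.toFinset, tubeSum x s :=
    fun x => by simp [l]
  refine ⟨LinearMap.toContinuousLinearMap l, ?_⟩
  ext x
  constructor
  · intro hx
    refine ⟨hx.1, fun y hy => ?_⟩
    rw [hl, hl, Finset.sum_congr rfl (heq x hx)]
    exact neg_le_neg (Finset.sum_le_sum (hge y hy))
  · rintro ⟨hx, hmax⟩
    refine ⟨hx, fun t ht => ?_⟩
    have h1 := hmax x₀ hx₀.1
    rw [hl, hl, Finset.sum_congr rfl (heq x₀ hx₀)] at h1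
    have h2 := (Finset.sum_eq_sum_iff_of_le (hge x hx)).1
      (le_antisymm (Finset.sum_le_sum (hge x hx)) (neg_le_neg_iff.1 h1))
    exact (h2 _ (hfin.mem_toFinset.2 (Set.mem_image_of_mem _ ht))).symm

theorem exists_eq_faceOf (hV : V(G).Nonempty) {F : Set (Coord (loopFree G))} (hF : F.Nonempty)
    (hexp : IsExposed ℝ (associahedron G) F) : ∃ T, IsTubing G T ∧ faceOf G T = F := by
  obtain ⟨l, hl⟩ := hexp hF
  rw [associahedron_eq] at hl
  obtain ⟨x, hx, hFx⟩ := exists_eq_of_maximizers isTranslate_affineSpan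
    (properTubes_finite (loopFree G) (ghosts G)) l.toLinearMap hF hl
  set T : Set (Graph α β) := {t | IsTube G t ∧ loopFree t ∈ tight
    (properTubes (loopFree G) (ghosts G)) (tubeSumL (loopFree G)) (bound (loopFree G)) x} with hT
  have hTt : ∀ t ∈ T, IsTube G t := fun t ht => ht.1
  have himage : loopFree '' T = tight (properTubes (loopFree G) (ghosts G))
      (tubeSumL (loopFree G)) (bound (loopFree G)) x := by
    ext s
    constructor
    · rintro ⟨t, ht, rfl⟩
      exact ht.2
    · intro hs
      obtain ⟨t, ht, rfl⟩ := exists_loopFree_eq hs.1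
      exact ⟨t, ⟨ht, hs⟩, rfl⟩
  refine ⟨T, (isTubing_image_loopFree hTt).1 ?_, ?_⟩
  · rw [himage]
    exact isTubing_tight (hV.elim fun v hv => ⟨Sum.inl v, inl_mem_loopFree.2 hv⟩)
      (pendant_ghosts G) hx
  · rw [faceOf_eq hTt, himage, hFx]

theorem isClosed_faceOf (G : Graph α β) [Finite V(loopFree G)] [Finite E(loopFree G)]
    (T : Set (Graph α β)) : IsClosed (faceOf G T) := by
  have hn : ∀ W, Continuous fun x : Coord (loopFree G) => nodeSum x W := fun W =>
    (nodeSumL (loopFree G) W).continuous_of_finiteDimensional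
  have he : ∀ F, Continuous fun x : Coord (loopFree G) => edgeSum x F := fun F =>
    (edgeSumL (loopFree G) F).continuous_of_finiteDimensional
  have ht : ∀ t, Continuous fun x : Coord (loopFree G) => tubeSum x t := fun t =>
    (tubeSumL (loopFree G) t).continuous_of_finiteDimensional
  have : faceOf G T =
      {x | nodeSum x V(loopFree G) = const (loopFree G) ^ V(loopFree G).ncard} ∩
      (⋂ B ∈ bundles (loopFree G), {x | edgeSum x B = const (loopFree G) ^ B.ncard}) ∩
      (⋂ s ∈ {s | IsTube (loopFree G) s ∧ ∀ v, V(s) ≠ {Sum.inr v}},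
        {x | bound (loopFree G) s ≤ tubeSum x s}) ∩
      ⋂ t ∈ T, {x | tubeSum x (loopFree t) = bound (loopFree G) (loopFree t)} := by
    ext x
    simp [faceOf, associahedron, and_assoc]
  rw [this]
  refine ((IsClosed.inter (isClosed_eq (hn _) continuous_const) ?_).inter ?_).inter ?_
  · exact isClosed_biInter fun B _ => isClosed_eq (he B) continuous_const
  · exact isClosed_biInter fun s _ => isClosed_le continuous_const (ht s)
  · exact isClosed_biInter fun t _ => isClosed_eq (ht _) continuous_const

theorem isCompact_faceOf (hVfin : V(G).Finite) (hT : IsTubing G T)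
    (hex : ExcludesAllLoops G T) : IsCompact (faceOf G T) := by
  have := Fintype.ofFinite (V(loopFree G) ⊕ E(loopFree G))
  refine Metric.isCompact_of_isClosed_isBounded (isClosed_faceOf G T)
    (isBounded_of_recession fun d hd => ?_)
  -- A functional that is constant on the face is bounded below together with its negative.
  have hconst : ∀ l : Coord (loopFree G) →ₗ[ℝ] ℝ, (∃ b, ∀ x ∈ faceOf G T, l x = b) → l d = 0 := by
    rintro l ⟨b, hb⟩
    refine le_antisymm ?_ (hd l ⟨b, fun x hx => (hb x hx).ge⟩)
    have := hd (-l) ⟨-b, fun x hx => by rw [LinearMap.neg_apply, hb x hx]⟩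
    rw [LinearMap.neg_apply] at this
    linarith
  refine eq_zero_of_recession hVfin
    ⟨hconst (nodeSumL (loopFree G) _) ⟨_, fun x hx => hx.1.1⟩,
      fun B hB => hconst (edgeSumL (loopFree G) B) ⟨_, fun x hx => hx.1.2.1 B hB⟩⟩
    (fun t ht => hd (tubeSumL (loopFree G) (loopFree t))
      ⟨bound (loopFree G) (loopFree t), fun x hx => ?_⟩) fun e v he => ?_
  · have hx' := hx.1
    rw [associahedron_eq] at hx'
    exact hx'.2 _ (loopFree_mem_properTubes ht)
  · have hexv : ∀ f, G.IsLoopAt f v → ∃ t ∈ T, v ∈ V(t) ∧ f ∉ E(t) := by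
      intro f hf
      obtain ⟨t, ht, h⟩ := hex f v hf
      exact ⟨t, ht, h.2.1 v hf.inc, h.2.2⟩
    have hfin : {t ∈ T | v ∈ V(t)}.Finite := by
      refine Set.Finite.of_finite_image ((finite_subgraphs (loopFree G)).subset ?_)
        (loopFree_injective.injOn)
      rintro _ ⟨t, ht, rfl⟩
      exact loopFree_le_loopFree.2 (hT.isTube t ht.1).lt.le
    obtain ⟨t₁, ht₁, hvt₁, -⟩ := hexv e he
    -- The tubes of `T` through `v` form a chain. The smallest lies inside every tube that excludes
    -- a loop at `v`, hence contains no loop at `v`.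
    obtain ⟨t, ht⟩ := hfin.exists_minimal ⟨t₁, ht₁, hvt₁⟩
    obtain ⟨htT, hvt⟩ := ht.1
    refine ⟨t, hT.isTube t htT, hvt, fun f hf => ?_,
      hconst (tubeSumL (loopFree G) (loopFree t)) ⟨_, fun x hx => hx.2 t htT⟩⟩
    obtain ⟨r, hr, hvr, hfr⟩ := hexv f (hf.mono (hT.isTube t htT).lt.le)
    have hle : t ≤ r := by
      rcases le_or_le_of_pairwise hT.compatible htT hr hvt hvr with h | h
      exacts [h, ht.2 ⟨hr, hvr⟩ h]
    exact hfr (hle.edgeSet_mono hf.edge_mem)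

/-- If a loop at `v` is not excluded, every tube of `T` through `v` also contains the ghost of `v`.
Moving weight from the ghost to `v` preserves the sums of `T` and decreases no tube sum, since a
tube with the ghost contains `v`. The face then contains a ray. -/
theorem excludesAllLoops_of_isCompact (hV : V(G).Nonempty) (hT : IsTubing G T)
    (hc : IsCompact (faceOf G T)) : ExcludesAllLoops G T := by
  intro e v he
  by_contra! hno
  have hmem : ∀ t ∈ T, v ∈ V(t) → e ∈ E(t) := by
    intro t ht hvt
    by_contra het
    exact hno t ht ⟨he.edge_mem, fun x hx => he.eq_of_inc hx ▸ hvt, het⟩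
  have hvH : Sum.inl v ∈ V(loopFree G) := inl_mem_loopFree.2 he.vertex_mem
  have hvH' : Sum.inr v ∈ V(loopFree G) := inr_mem_loopFree.2 ⟨e, he⟩
  set d : Coord (loopFree G) := nodeVec ⟨Sum.inl v, hvH⟩ - nodeVec ⟨Sum.inr v, hvH'⟩ with hd
  have hdL : d ∈ lineal (loopFree G) :=
    (isProbe_nodeVec ∅ ⟨Sum.inl v, hvH⟩).sub_mem (isProbe_nodeVec ∅ ⟨Sum.inr v, hvH'⟩)
  have htube : ∀ t, IsTube G t → 0 ≤ tubeSum d (loopFree t) := by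
    intro t ht
    rw [hd, tubeSum_sub, tubeSum_nodeVec, tubeSum_nodeVec]
    by_cases h : Sum.inr v ∈ V(loopFree t)
    · obtain ⟨f, hf⟩ := inr_mem_loopFree.1 h
      exact (sub_eq_zero.2 (indicator_one_congr
        (iff_of_true (inl_mem_loopFree.2 hf.vertex_mem) h))).ge
    · rw [Set.indicator_of_notMem h, sub_zero]
      exact indicator_one_nonneg _ _
  have htube0 : ∀ t ∈ T, tubeSum d (loopFree t) = 0 := by
    intro t ht
    rw [hd, tubeSum_sub, tubeSum_nodeVec, tubeSum_nodeVec]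
    refine sub_eq_zero.2 (indicator_one_congr ?_)
    simp only [inl_mem_loopFree, inr_mem_loopFree]
    constructor
    · intro hvt
      have htG := (hT.isTube t ht).lt.le
      exact ⟨e, (htG.isLink_iff (hmem t ht hvt)).2 he⟩
    · rintro ⟨f, hf⟩
      exact hf.vertex_mem
  obtain ⟨x, hx, -⟩ := exists_mem_faceOf hV hT
  have hray : ∀ n : ℕ, x + (n : ℝ) • d ∈ faceOf G T := by
    intro n
    rw [faceOf_eq hT.isTube] at hx ⊢
    refine ⟨⟨isTranslate_affineSpan.add_smul_mem hx.1.1 hdL _, fun s hs => ?_⟩, ?_⟩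
    · obtain ⟨t, ht, rfl⟩ := exists_loopFree_eq hs
      have h1 := hx.1.2 _ hs
      rw [tubeSumL_apply] at h1 ⊢
      rw [tubeSum_add, tubeSum_smul]
      have := mul_nonneg (Nat.cast_nonneg (α := ℝ) n) (htube t ht)
      linarith
    · rintro _ ⟨t, ht, rfl⟩
      obtain ⟨hs, h1⟩ := hx.2 (Set.mem_image_of_mem _ ht)
      refine ⟨hs, ?_⟩
      rw [tubeSumL_apply] at h1 ⊢
      rw [tubeSum_add, tubeSum_smul, htube0 t ht, h1]
      ring
  have hcont : Continuous fun y : Coord (loopFree G) => y (Sum.inl ⟨Sum.inl v, hvH⟩) :=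
    continuous_apply _
  obtain ⟨M, hM⟩ := (hc.image hcont).bddAbove
  have hd1 : d (Sum.inl ⟨Sum.inl v, hvH⟩) = 1 := by
    simp [hd, nodeVec]
  obtain ⟨n, hn⟩ := exists_nat_gt (M - x (Sum.inl ⟨Sum.inl v, hvH⟩))
  have := hM (Set.mem_image_of_mem _ (hray n))
  simp only [Pi.add_apply, Pi.smul_apply, hd1, smul_eq_mul, mul_one] at this
  linarith

end Faces

end Pseudograph

/-- The map sending a tubing to the corresponding face is an isomorphism from the tubings of `G`,
ordered by reverse containment, onto the faces of the pseudograph associahedron of `G`, and under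
it the compact faces are exactly those of the tubings which exclude all loops. -/
theorem corollary13 {α β : Type*} (G : Graph α β) (hV : V(G).Nonempty)
    (hVfin : V(G).Finite) (hEfin : E(G).Finite) :
    ∃ Φ : (Pseudograph.Tubing G)ᵒᵈ ≃o Pseudograph.Face (Pseudograph.associahedron G),
      (∀ T : Pseudograph.Tubing G,
        (Φ (OrderDual.toDual T)).1 = Pseudograph.faceOf G T.1) ∧
      ∀ T : Pseudograph.Tubing G,
        IsCompact (Φ (OrderDual.toDual T)).1 ↔ Pseudograph.ExcludesAllLoops G T.1 := by
  have : Finite V(Pseudograph.loopFree G) :=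
    (Pseudograph.finite_vertexSet_loopFree hVfin).to_subtype
  have : Finite E(Pseudograph.loopFree G) := by
    rw [Pseudograph.edgeSet_loopFree]
    exact hEfin.to_subtype
  let f : (Pseudograph.Tubing G)ᵒᵈ ↪o Pseudograph.Face (Pseudograph.associahedron G) :=
    OrderEmbedding.ofMapLEIff
      (fun T => ⟨Pseudograph.faceOf G (OrderDual.ofDual T).1,
        let ⟨x, hx, _⟩ := Pseudograph.exists_mem_faceOf hV (OrderDual.ofDual T).2
        ⟨x, hx⟩, Pseudograph.isExposed_faceOf (OrderDual.ofDual T).2⟩)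
      fun T T' => Pseudograph.faceOf_subset_iff hV (OrderDual.ofDual T).2 (OrderDual.ofDual T').2
  have hf : Function.Surjective f := by
    rintro ⟨F, hF, hexp⟩
    obtain ⟨T, hT, hTF⟩ := Pseudograph.exists_eq_faceOf hV hF hexp
    exact ⟨OrderDual.toDual ⟨T, hT⟩, Subtype.ext hTF⟩
  refine ⟨RelIso.ofSurjective f hf, fun T => rfl, fun T => ?_⟩
  exact ⟨fun h => Pseudograph.excludesAllLoops_of_isCompact hV T.2 h,
    fun h => Pseudograph.isCompact_faceOf hVfin T.2 h⟩
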